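/- **Setting.** Let $\mathbb S=\mathbb R^2$ be the affine group with coordinates $x=(a,\ell)$ and product $(a,\ell)(a',\ell')=(a+a',e^{-2a'}\ell+\ell')$; $\mathrm da\,\mathrm d\ell$ is a left Haar measure, and the left-invariant fields of the basis $H,E$ of its Lie algebra ($[H,E]=2E$) are $\tilde H=\partial_a-2\ell\partial_\ell$, $\tilde E=\partial_\ell$. Let $\mathcal A$ be a complex associative Fréchet algebra (jointly continuous product $\mu_{\mathcal A}$, topology defined by seminorms $(|\cdot|_j)_{j\in\mathbb N}$), and let $\alpha$ be a strongly continuous action of $\mathbb S$ on $\mathcal A$ by algebra automorphisms with $|\alpha_g(a)|_j=|a|_j$ for all $g,j,a$. Let $\mathcal A_\infty$ be the space of smooth vectors: those $a$ for which $\alpha(a):g\mapsto\alpha_g(a)$ is $C^\infty$. **Oscillatory integrals.** Let $G=\mathbb S\times\mathbb S$ with Lie algebra $\mathfrak g$; for $P$ in the (real) enveloping algebra $\mathcal U(\mathfrak g)$ let $\tilde P$ be the associated left-invariant differential operator. For a Fréchet space $\mathcal E$ with seminorms $|\cdot|_j$ and a nowhere vanishing ${\bf m}:G\to\mathbb C$,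 let $\mathcal B^{\bf m}_{\mathcal E}$ be the space of $F\in C^\infty(G,\mathcal E)$ such that $\sup_G|\tilde PF|_j/|{\bf m}|<\infty$ for all $P\in\mathcal U(\mathfrak g)$ and all $j$, topologized by these suprema. A *weight* is a nowhere vanishing ${\bf m}\in\mathcal B^{\bf m}_{\mathbb C}$. Given $S\in C^\infty(G,\mathbb R)$, call $(P,{\bf m}_0)$ *admissible data* for $S$ if $P\in\mathcal U(\mathfrak g)$ has $\tilde P$ formally self-adjoint, ${\bf m}_P:=e^{-iS}\tilde Pe^{iS}$ is a weight with $1/{\bf m}_P$ integrable, and ${\bf m}_0$ is a weight with ${\bf m}_0/{\bf m}_P$ integrable. The *oscillatory integral* $\tilde\int e^{iS}:\mathcal B^{{\bf m}_0}_{\mathcal E}\to\mathcal E$ of the data is the continuous linear map $A\mapsto\int_Ge^{iS}\,\tilde P(A/{\bf m}_P)$, which extends $A\mapsto\int_Ge^{iS}A$ from the smooth compactly supported functions. **The integrand.** For $x_i=(a_i,\ell_i)$ put $$S_{\rm can}(x_1,x_2)=\sinh(2a_1)\ell_2-\sinh(2a_2)\ell_1 ,$$ $${\bf A}_{\rm can}(x_1,x_2)=\sqrt{|\mathrm{Jac}_\Phi(e,x_1,x_2)|}=4\sqrt{\cosh(2a_1)\cosh(2(a_1-a_2))\cosh(2a_2)}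 .$$ Here $e=(0,0)$ and $\Phi(x,y,z)=(t,s_zt,s_ys_zt)$, where $s_{(a,\ell)}(a',\ell')=(2a-a',2\cosh(2(a-a'))\ell-\ell')$ and $t$ is the unique solution of $s_xs_ys_zt=t$. Let $\theta>0$ and let $\Theta\in C^\infty(\mathbb R,\mathbb C)$ be nowhere vanishing and such that both $\Theta$ and $1/\Theta$ are of symbol type, where $f$ is of symbol type if there is $N\in\mathbb R$ such that for every $r\ge0$ there is $C_r$ with $|f^{(r)}(t)|\le C_r(1+|t|)^{N-r}$ for all $t\in\mathbb R$. Put $${\bf\Xi}(u)=\frac1{\Theta\big(\sinh(2u)/(2\theta)\big)},\qquad {\bf\Theta}(x_1,x_2)=\frac{{\bf\Xi}(a_1)\,{\bf\Xi}(-a_2)}{{\bf\Xi}(a_1-a_2)} .$$ **Statement.** For all $a,b\in\mathcal A_\infty$ the oscillatory integral $$a\star^\Theta_\theta b:=\frac1{\theta^2}\,\tilde\int e^{\frac i\theta S_{\rm can}}\,{\bf\Theta}\,{\bf A}_{\rm can}\,\mu_{\mathcal A}(\alpha(a)\otimes\alpha(b))$$ is well defined as an element of $\mathcal A_\infty$.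 That is, with $F(x_1,x_2)={\bf\Theta}(x_1,x_2){\bf A}_{\rm can}(x_1,x_2)\,\alpha_{x_1}(a)\,\alpha_{x_2}(b)$, there are admissible data $(P,{\bf m}_0)$ for $S_{\rm can}/\theta$ with $F\in\mathcal B^{{\bf m}_0}_{\mathcal A}$; for all admissible data for $S_{\rm can}/\theta$ the oscillatory integral on $\mathcal B^{{\bf m}_0}_{\mathcal A}$ exists whenever $F\in\mathcal B^{{\bf m}_0}_{\mathcal A}$; its value at $F$ does not depend on these data; and $\theta^{-2}$ times this value lies in $\mathcal A_\infty$. -/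

import Mathlib

open Filter Topology MeasureTheory
open scoped ContDiff

noncomputable section

/-! ### Smooth functions, symbols and weights on a Lie group with values in a Fréchet space

`G` is a (Lie) group and `γ i : ℝ → G`, `i : ι`, are the one-parameter subgroups `t ↦ exp (t Xᵢ)`
generated by a basis `(Xᵢ)` of its Lie algebra `𝔤`. The left-invariant field `X̃ᵢ` acts on functions
by `(X̃ᵢ F)(g) = d/dt F (g exp (t Xᵢ))` at `t = 0`. -/

section General

variable {G ι E κ : Type*} [Group G] [AddCommGroup E] [Module ℂ E] [TopologicalSpace E]

/-- The difference quotient whose limit at `t = 0` is `(X̃ᵢ F)(g)`. -/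
def diffQuot (γ : ι → ℝ → G) (i : ι) (F : G → E) (g : G) (t : ℝ) : E :=
  ((t⁻¹ : ℝ) : ℂ) • (F (g * γ i t) - F g)

/-- The left-invariant vector field `X̃ᵢ` acting on `E`-valued functions. -/
def leftField (γ : ι → ℝ → G) (i : ι) (F : G → E) (g : G) : E :=
  limUnder (𝓝[≠] (0 : ℝ)) (diffQuot γ i F g)

/-- `F` is differentiable along `X̃ᵢ` at every point. -/
def DiffAlong (γ : ι → ℝ → G) (i : ι) (F : G → E) : Prop :=
  ∀ g, ∃ y, Tendsto (diffQuot γ i F g) (𝓝[≠] (0 : ℝ)) (𝓝 y)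

/-- The composition of left-invariant fields along a word, `X̃_{i₁} ⋯ X̃_{i_k} F`. -/
def wordField (γ : ι → ℝ → G) : List ι → (G → E) → G → E
  | [], F => F
  | i :: w, F => leftField γ i (wordField γ w F)

/-- `F ∈ C^∞(G, E)`: all iterated derivatives along the global frame `(X̃ᵢ)` exist and are
continuous. -/
def IsSmooth [TopologicalSpace G] (γ : ι → ℝ → G) (F : G → E) : Prop :=
  ∀ w : List ι, Continuous (wordField γ w F) ∧ ∀ i, DiffAlong γ i (wordField γ w F)

/-- An element of the enveloping algebra `𝒰(𝔤)`, written as a real noncommutative polynomial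
`∑ c_w X_w` in the basis of `𝔤`. -/
abbrev EnvElt (ι : Type*) := List ι →₀ ℝ

/-- The left-invariant differential operator `P̃` on `E`-valued functions. -/
def invOp (γ : ι → ℝ → G) (P : EnvElt ι) (F : G → E) (g : G) : E :=
  P.sum fun w c => (c : ℂ) • wordField γ w F g

/-- The space `𝓑^m_E(G)`, for the topology of `E` given by the seminorms `p j`. -/
def symbolSpace [TopologicalSpace G] (γ : ι → ℝ → G) (p : κ → Seminorm ℂ E) (m : G → ℂ) :
    Set (G → E) :=
  {F | IsSmooth γ F ∧ ∀ (P : EnvElt ι) (j : κ), ∃ C : ℝ, ∀ g, p j (invOp γ P F g) ≤ C * ‖m g‖}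

/-- A weight: a nowhere vanishing function `m ∈ 𝓑^m_ℂ(G)`. -/
def IsWeight [TopologicalSpace G] (γ : ι → ℝ → G) (m : G → ℂ) : Prop :=
  (∀ g, m g ≠ 0) ∧ m ∈ symbolSpace γ (fun _ : Unit => normSeminorm ℂ ℂ) m

/-- `𝓓_E`: smooth compactly supported functions. -/
def testFunctions [TopologicalSpace G] (γ : ι → ℝ → G) (E : Type*) [AddCommGroup E] [Module ℂ E]
    [TopologicalSpace E] : Set (G → E) :=
  {F | IsSmooth γ F ∧ HasCompactSupport F}

/-- `f ∈ L¹(X, E)` with integral `v`, for a Fréchet space `E` with seminorms `p j`. -/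
def HasFrechetIntegral {X : Type*} [MeasurableSpace X] (μ : Measure X) (p : κ → Seminorm ℂ E)
    (f : X → E) (v : E) : Prop :=
  AEStronglyMeasurable f μ ∧ (∀ j, Integrable (fun x => p j (f x)) μ) ∧
    ∀ φ : E →L[ℂ] ℂ, φ v = ∫ x, φ (f x) ∂μ

/-! ### Phases, amplitudes and oscillatory integrals -/

/-- The function `e^{iS}`. -/
def expPhase (S : G → ℝ) (g : G) : ℂ := Complex.exp (Complex.I * (S g : ℂ))

/-- `m_P = e^{-iS} P̃ e^{iS}`. -/
def multiplier (γ : ι → ℝ → G) (S : G → ℝ) (P : EnvElt ι) (g : G) : ℂ :=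
  Complex.exp (-(Complex.I * (S g : ℂ))) * invOp γ P (expPhase S) g

/-- `P` is `S`-adapted (`μ` is a left Haar measure): `m_P` is a weight with integrable inverse. -/
def IsAdapted [TopologicalSpace G] [MeasurableSpace G] (γ : ι → ℝ → G) (μ : Measure G)
    (S : G → ℝ) (P : EnvElt ι) : Prop :=
  IsWeight γ (multiplier γ S P) ∧ Integrable (fun g => (multiplier γ S P g)⁻¹) μ

/-- `P̃` is (formally) self-adjoint; `P` has real coefficients, so that this is symmetry for the
bilinear pairing of test functions. -/
def IsSelfAdj [TopologicalSpace G] [MeasurableSpace G] (γ : ι → ℝ → G) (μ : Measure G)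
    (P : EnvElt ι) : Prop :=
  ∀ φ ∈ testFunctions γ ℂ, ∀ ψ ∈ testFunctions γ ℂ,
    ∫ g, invOp γ P φ g * ψ g ∂μ = ∫ g, φ g * invOp γ P ψ g ∂μ

/-- The data for an oscillatory integral with phase `S`: a self-adjoint `S`-adapted `P` and a weight
`m₀` with `m₀ / m_P` integrable. -/
structure IsOscData [TopologicalSpace G] [MeasurableSpace G] (γ : ι → ℝ → G) (μ : Measure G)
    (S : G → ℝ) (P : EnvElt ι) (m₀ : G → ℂ) : Prop where
  adapted : IsAdapted γ μ S P
  selfAdj : IsSelfAdj γ μ P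
  weight : IsWeight γ m₀
  integrable : Integrable (fun g => m₀ g / multiplier γ S P g) μ

/-- `J`, restricted to `𝓑^{m₀}_E`, is the oscillatory integral `∫~ e^{iS}`: the continuous linear
map `𝓑^{m₀}_E → E` that extends `A ↦ ∫ e^{iS} A` on `𝓓_E` and is given by
`J A = ∫ e^{iS} P̃(A / m_P)`. -/
structure IsOscillatoryIntegral [TopologicalSpace G] [MeasurableSpace G] (γ : ι → ℝ → G)
    (μ : Measure G) (p : κ → Seminorm ℂ E) (S : G → ℝ) (P : EnvElt ι) (m₀ : G → ℂ)
    (J : (G → E) → E) : Prop where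
  map_add : ∀ A ∈ symbolSpace γ p m₀, ∀ B ∈ symbolSpace γ p m₀, J (A + B) = J A + J B
  map_smul : ∀ c : ℂ, ∀ A ∈ symbolSpace γ p m₀, J (c • A) = c • J A
  /-- Continuity for the seminorms `sup_g p k (P̃ A g) / |m₀ g|` of `𝓑^{m₀}_E`. -/
  continuous : ∀ j : κ, ∃ (T : Finset (EnvElt ι × κ)) (C : ℝ), ∀ A ∈ symbolSpace γ p m₀,
    ∀ R : ℝ, 0 ≤ R → (∀ q ∈ T, ∀ g, p q.2 (invOp γ q.1 A g) ≤ R * ‖m₀ g‖) → p j (J A) ≤ C * R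
  extends_integral : ∀ A ∈ testFunctions γ E,
    HasFrechetIntegral μ p (fun g => expPhase S g • A g) (J A)
  formula : ∀ A ∈ symbolSpace γ p m₀,
    HasFrechetIntegral μ p
      (fun g => expPhase S g • invOp γ P (fun h => (multiplier γ S P h)⁻¹ • A h) g) (J A)

end General

/-! ### The affine group -/

/-- The affine group `𝕊`, in the coordinates `(a, ℓ) ↦ exp (a H) exp (ℓ E)`, `[H, E] = 2 E`. -/
def AffGroup : Type := ℝ × ℝ

namespace AffGroup

instance : TopologicalSpace AffGroup := inferInstanceAs (TopologicalSpace (ℝ × ℝ))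

/-- The measure is `da dℓ`, a left-invariant Haar measure. -/
instance : MeasureSpace AffGroup := inferInstanceAs (MeasureSpace (ℝ × ℝ))

/-- The coordinate `a`. -/
def a (x : AffGroup) : ℝ := Prod.fst x

/-- The coordinate `ℓ`. -/
def l (x : AffGroup) : ℝ := Prod.snd x

/-- The point with coordinates `(a, ℓ)`. -/
def mk (a l : ℝ) : AffGroup := (a, l)

@[simp] theorem a_mk (s t : ℝ) : (mk s t).a = s := rfl

@[simp] theorem l_mk (s t : ℝ) : (mk s t).l = t := rfl

@[ext] theorem ext {x y : AffGroup} (h : x.a = y.a) (h' : x.l = y.l) : x = y := Prod.ext h h'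

/-- `(a, ℓ) (a', ℓ') = (a + a', e^{-2a'} ℓ + ℓ')`. -/
instance : Group AffGroup where
  mul x y := mk (x.a + y.a) (Real.exp (-2 * y.a) * x.l + y.l)
  one := mk 0 0
  inv x := mk (-x.a) (-(Real.exp (2 * x.a) * x.l))
  mul_assoc x y z := by
    apply ext
    · exact add_assoc _ _ _
    · change Real.exp (-2 * z.a) * (Real.exp (-2 * y.a) * x.l + y.l) + z.l =
        Real.exp (-2 * (y.a + z.a)) * x.l + (Real.exp (-2 * z.a) * y.l + z.l)
      rw [mul_add (-2 : ℝ), Real.exp_add]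
      ring
  one_mul x := by
    apply ext
    · exact zero_add _
    · change Real.exp (-2 * x.a) * 0 + x.l = x.l
      simp
  mul_one x := by
    apply ext
    · exact add_zero _
    · change Real.exp (-2 * 0) * x.l + 0 = x.l
      simp
  inv_mul_cancel x := by
    apply ext
    · exact neg_add_cancel _
    · change Real.exp (-2 * x.a) * -(Real.exp (2 * x.a) * x.l) + x.l = 0
      have h : Real.exp (-2 * x.a) * Real.exp (2 * x.a) = 1 := by
        rw [← Real.exp_add]
        simp
      linear_combination (-x.l) * h

theorem mul_def (x y : AffGroup) :
    x * y = mk (x.a + y.a) (Real.exp (-2 * y.a) * x.l + y.l) := rfl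

theorem one_def : (1 : AffGroup) = mk 0 0 := rfl

/-- The basis `H, E` of the Lie algebra of `𝕊`. -/
inductive Gen
  | H
  | E

/-- The one-parameter subgroups `exp (t H) = (t, 0)` and `exp (t E) = (0, t)`. -/
def frame : Gen → ℝ → AffGroup
  | Gen.H, t => mk t 0
  | Gen.E, t => mk 0 t

/-- The corresponding one-parameter subgroups of `𝕊 × 𝕊`. -/
def frame₂ : Gen ⊕ Gen → ℝ → AffGroup × AffGroup
  | Sum.inl i, t => (frame i t, 1)
  | Sum.inr i, t => (1, frame i t)

/-! ### The canonical phase and amplitude -/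

/-- The canonical two-point function `sinh (2a₁) ℓ₂ - sinh (2a₂) ℓ₁`. -/
def Scan (x : AffGroup × AffGroup) : ℝ :=
  Real.sinh (2 * x.1.a) * x.2.l - Real.sinh (2 * x.2.a) * x.1.l

/-- The geodesic symmetry `s_x` of the symmetric surface `𝕄 = 𝕊`, applied to `y`. -/
def sym (x y : AffGroup) : AffGroup :=
  mk (2 * x.a - y.a) (2 * Real.cosh (2 * (x.a - y.a)) * x.l - y.l)

/-- The unique fixed point `t` of `s_x s_y s_z`. -/
def fixedPt (x y z : AffGroup) : AffGroup :=
  mk (x.a - y.a + z.a)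
    (Real.cosh (2 * (y.a - z.a)) * x.l - Real.cosh (2 * (z.a - x.a)) * y.l
      + Real.cosh (2 * (x.a - y.a)) * z.l)

theorem sym_sym_sym_eq_iff (x y z t : AffGroup) :
    sym x (sym y (sym z t)) = t ↔ t = fixedPt x y z := by
  have key : ∀ t : AffGroup, t.a = x.a - y.a + z.a →
      (sym x (sym y (sym z t))).l = 2 * (fixedPt x y z).l - t.l := by
    intro t ht
    simp only [sym, fixedPt, a_mk, l_mk, ht]
    rw [show 2 * (x.a - (2 * y.a - (2 * z.a - (x.a - y.a + z.a)))) = -(2 * (y.a - z.a)) by ring,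
      show 2 * (y.a - (2 * z.a - (x.a - y.a + z.a))) = -(2 * (z.a - x.a)) by ring,
      show 2 * (z.a - (x.a - y.a + z.a)) = -(2 * (x.a - y.a)) by ring]
    simp only [Real.cosh_neg]
    ring
  constructor
  · intro h
    have ha : t.a = x.a - y.a + z.a := by
      have := congrArg AffGroup.a h
      simp only [sym, a_mk] at this
      linarith
    apply ext ha
    have := congrArg AffGroup.l h
    rw [key t ha] at this
    linarith
  · rintro rfl
    apply ext
    · simp only [sym, fixedPt, a_mk]
      ring
    · rw [key _ rfl]
      ring

/-- The diffeomorphism `Φ(x, y, z) = (t, s_z t, s_y s_z t)` of `𝕄 × 𝕄 × 𝕄`. -/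
def Phi (x : Fin 3 → AffGroup) : Fin 3 → AffGroup :=
  let t := fixedPt (x 0) (x 1) (x 2)
  ![t, sym (x 2) t, sym (x 1) (sym (x 2) t)]

/-- `Φ` in the coordinates `(a₀, a₁, a₂, ℓ₀, ℓ₁, ℓ₂)`. -/
def PhiCoord (c : Fin 3 ⊕ Fin 3 → ℝ) : Fin 3 ⊕ Fin 3 → ℝ :=
  let y := Phi fun i => mk (c (Sum.inl i)) (c (Sum.inr i))
  Sum.elim (fun i => (y i).a) (fun i => (y i).l)

/-- The Jacobian determinant of `Φ`. -/
def JacPhi (x : Fin 3 → AffGroup) : ℝ :=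
  let c : Fin 3 ⊕ Fin 3 → ℝ := Sum.elim (fun i => (x i).a) (fun i => (x i).l)
  (Matrix.of fun i j => deriv (fun t => PhiCoord (Function.update c j t) i) (c j)).det

/-- The Jacobian in closed form. -/
theorem JacPhi_eq (x : Fin 3 → AffGroup) :
    JacPhi x = 16 * Real.cosh (2 * ((x 0).a - (x 1).a)) * Real.cosh (2 * ((x 1).a - (x 2).a)) *
      Real.cosh (2 * ((x 2).a - (x 0).a)) := by
  set c : Fin 3 ⊕ Fin 3 → ℝ := Sum.elim (fun i => (x i).a) (fun i => (x i).l) with hc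
  set C01 := Real.cosh (2 * ((x 0).a - (x 1).a)) with h01
  set C12 := Real.cosh (2 * ((x 1).a - (x 2).a)) with h12
  set C20 := Real.cosh (2 * ((x 2).a - (x 0).a)) with h20
  have hlin : ∀ (k : ℝ) (f : ℝ → ℝ) (s : ℝ), (∀ t, f t = k * t + f 0) → deriv f s = k := by
    intro k f s h
    have : f = fun t => k * t + f 0 := funext h
    rw [this]
    simp
  have hM : (Matrix.of fun i j => deriv (fun t => PhiCoord (Function.update c j t) i) (c j)) =
      Matrix.fromBlocks (!![1, -1, 1; -1, 1, 1; 1, 1, -1] : Matrix (Fin 3) (Fin 3) ℝ) 0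
        (Matrix.of fun i j =>
          deriv (fun t => PhiCoord (Function.update c (Sum.inl j) t) (Sum.inr i)) (c (Sum.inl j)))
        !![C12, -C20, C01; -C12, C20, C01; C12, C20, -C01] := by
    ext i j
    rcases i with i | i <;> rcases j with j | j
    · fin_cases i <;> fin_cases j <;>
      · apply hlin
        intro t
        simp [PhiCoord, Phi, fixedPt, sym]
        try ring
    · simp only [Matrix.of_apply, Matrix.fromBlocks_apply₁₂, Matrix.zero_apply]
      fin_cases i <;> simp [PhiCoord, Phi, fixedPt, sym]
    · rfl
    · have e2 : ∀ A B D : ℝ, 2 * (B - (2 * D - (A - B + D))) = -(2 * (D - A)) := by intros; ring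
      fin_cases i <;> fin_cases j <;>
      · apply hlin
        intro t
        simp [PhiCoord, Phi, fixedPt, sym, hc, e2, h01, h12, h20, -neg_sub]
        try ring
  have hJ : JacPhi x =
      (Matrix.of fun i j => deriv (fun t => PhiCoord (Function.update c j t) i) (c j)).det := rfl
  rw [hJ, hM, Matrix.det_fromBlocks_zero₁₂, Matrix.det_fin_three, Matrix.det_fin_three]
  simp
  ring

/-- `A_can(x₁, x₂) = |Jac_Φ(e, x₁, x₂)|^{1/2}`. -/
def Acan (x : AffGroup × AffGroup) : ℝ := Real.sqrt |JacPhi ![1, x.1, x.2]|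

/-! ### The function `𝚯` -/

/-- `Θ` is smooth with `|Θ^{(r)}(t)| ≤ C_r (1 + |t|)^{N - r}` for some `N` and all `r`. -/
def IsSymbolType (Θ : ℝ → ℂ) : Prop :=
  ContDiff ℝ ∞ Θ ∧ ∃ N : ℝ, ∀ r : ℕ, ∃ C : ℝ, ∀ t : ℝ,
    ‖iteratedDeriv r Θ t‖ ≤ C * (1 + |t|) ^ (N - r)

/-- The twisting map `t ↦ sinh (2θt) / (2θ)`. -/
def twist (θ t : ℝ) : ℝ := Real.sinh (2 * θ * t) / (2 * θ)

/-- `Ξ`, defined by `Ξ(θt) = 1 / Θ(sinh (2θt) / (2θ))`. -/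
def Xi (θ : ℝ) (Θ : ℝ → ℂ) (u : ℝ) : ℂ := (Θ (twist θ (u / θ)))⁻¹

/-- `𝚯(x₁, x₂) = Ξ(a₁) Ξ(-a₂) / Ξ(a₁ - a₂)`. -/
def boldTheta (θ : ℝ) (Θ : ℝ → ℂ) (x : AffGroup × AffGroup) : ℂ :=
  Xi θ Θ x.1.a * Xi θ Θ (-x.2.a) / Xi θ Θ (x.1.a - x.2.a)

/-! ### Actions on Fréchet algebras -/

/-- The space `𝒜_∞` of smooth vectors of an action `α` of `𝕊`. -/
def smoothVectors {A : Type*} [AddCommGroup A] [Module ℂ A] [TopologicalSpace A]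
    (α : AffGroup →* Module.End ℂ A) : Set A :=
  {v | IsSmooth frame fun g => α g v}

/-- The integrand `𝚯 A_can μ(α(a) ⊗ α(b))`. -/
def integrand {A : Type*} [NonUnitalRing A] [Module ℂ A]
    (α : AffGroup →* Module.End ℂ A) (θ : ℝ) (Θ : ℝ → ℂ) (v w : A) (x : AffGroup × AffGroup) : A :=
  (boldTheta θ Θ x * (Acan x : ℂ)) • (α x.1 v * α x.2 w)

end AffGroup

end

/-!
# Oscillatory integrals for the star product of the affine group

Write `S = S_can / θ` and let `Hᵢ, Eᵢ` (`i = 1, 2`) be the left-invariant fields of `𝕊 × 𝕊`.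

*Existence of admissible data.* With `X = (H₁ - H₂) S` and `Y = (H₁ + H₂) S`, both linear in
`(ℓ₁, ℓ₂)` for fixed `(a₁, a₂)`, one has `θ E₁ S = -sinh (2 a₂)` and `θ E₂ S = sinh (2 a₁)`, so
conjugation by `e^{iS}` turns `1 - θ² E₁²` and `1 - θ² E₂²` into `cosh² (2 a₂)` and `cosh² (2 a₁)`, up
to operators that lower the degree in `(ℓ₁, ℓ₂)`. Let `R` be the symmetric product of order eight of
these two operators, with symbol `κ = cosh⁴ (2 a₁) cosh⁴ (2 a₂)`. The operator
`T = -(H₁ - H₂)² - (H₁ + H₂ - 2) R (H₁ + H₂ - 2)` is formally self-adjoint; the shift by `2` makes up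
for the divergence of `H₁ + H₂`. Its conjugate has the principal symbol `X² + Z²` with `Z² = κ Y²`
(`Filt.opT_sub`), and the factor `κ` is what makes the span of `X` and `Z` stable under `H₁` and `H₂`
with bounded coefficients (`field_inl_H_symX`, `field_inl_H_symZ`). Hence the multiplier of
`T ^ N + c R ^ n`, for suitable `c` and `n`, is a weight comparable to `(|X| + |Z| + τ ^ K) ^ (2 N)`,
where `τ = 4 cosh (2 a₁) cosh (2 a₂)` (`exists_isWeight_multiplier`). As `ℓ₁` and `ℓ₂` are bounded in
terms of `X`, `Y` and `τ`, this grows faster than any given power of the coordinates and of `τ`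
(`exists_isAdapted`), while the amplitude `𝚯 A_can` is a symbol for some power of `τ`
(`exists_amplitude_mem`).

*Independence of the data.* For admissible data with operator `P` and multiplier `m_P`, the integral
`∫ e^{iS} P̃(F / m_P)` is, after pairing with a continuous functional, the limit of the integrals of
`e^{iS} χₙ F` for rescaled cutoff functions `χₙ` (`IsOscData.tendsto_integral_cutoff`): each of these
equals `∫ e^{iS} P̃(χₙ F / m_P)` by self-adjointness, and dominated convergence applies. The limit
does not mention the data.

*Smoothness of the value.* The vector-valued function `P̃(F / m_P)` is a sum of terms
`f(x₁, x₂) α_{x₁}(v) α_{x₂}(w)` with smooth vectors `v, w` and scalar functions `f` that decay as fast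
as `P` was chosen to allow. Since `α_g` of such a term is its left translate, the derivative of the
integral along the action is computed with right-invariant fields; written in left-invariant fields
these have coefficients bounded by `rho`, so a derivative costs one moment of `f`
(`exists_hasField_momentSpace`). By independence of the data, a single vector is represented by such
integrals with any number of moments, hence it is smooth (`mem_smoothVectors_of_forall_mem`).
-/

set_option linter.unusedSectionVars false

noncomputable section

/-! ### Calculus along a left-invariant frame -/

section Calculus

variable {G ι E κ : Type*} [Group G] [AddCommGroup E] [Module ℂ E] [TopologicalSpace E]
variable {γ : ι → ℝ → G} {i : ι}

/-- `F'` is the derivative of `F` along the left-invariant field `X̃ᵢ`. -/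
def HasField (γ : ι → ℝ → G) (i : ι) (F F' : G → E) : Prop :=
  ∀ g, Tendsto (diffQuot γ i F g) (𝓝[≠] (0 : ℝ)) (𝓝 (F' g))

theorem HasField.leftField_eq [T2Space E] {F F' : G → E} (h : HasField γ i F F') :
    leftField γ i F = F' :=
  funext fun g => (h g).limUnder_eq

theorem HasField.diffAlong {F F' : G → E} (h : HasField γ i F F') : DiffAlong γ i F :=
  fun g => ⟨F' g, h g⟩

theorem DiffAlong.hasField {F : G → E} (h : DiffAlong γ i F) :
    HasField γ i F (leftField γ i F) :=
  fun g => tendsto_nhds_limUnder (h g)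

theorem HasField.add [ContinuousAdd E] {F F' K K' : G → E} (h : HasField γ i F F')
    (k : HasField γ i K K') : HasField γ i (F + K) (F' + K') := by
  intro g
  refine ((h g).add (k g)).congr fun t => ?_
  simp only [diffQuot, Pi.add_apply, ← smul_add]
  congr 1
  abel

theorem HasField.const_smul [ContinuousConstSMul ℂ E] {F F' : G → E} (c : ℂ)
    (h : HasField γ i F F') : HasField γ i (c • F) (c • F') := by
  intro g
  refine ((h g).const_smul c).congr fun t => ?_
  simp only [diffQuot, Pi.smul_apply, ← smul_sub, smul_comm c]

theorem HasField.zero : HasField γ i (0 : G → E) 0 := by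
  intro g
  refine tendsto_const_nhds.congr fun t => ?_
  simp [diffQuot]

theorem HasField.const (c : E) : HasField γ i (fun _ : G => c) 0 := by
  intro g
  refine tendsto_const_nhds.congr fun t => ?_
  simp [diffQuot]

/-- A function is continuous along a direction in which it is differentiable. -/
theorem HasField.tendsto_mul [IsTopologicalAddGroup E] [ContinuousSMul ℂ E] {F F' : G → E}
    (h : HasField γ i F F') (g : G) :
    Tendsto (fun t => F (g * γ i t)) (𝓝[≠] (0 : ℝ)) (𝓝 (F g)) := by
  have h0 : Tendsto (fun t : ℝ => (t : ℂ)) (𝓝[≠] (0 : ℝ)) (𝓝 0) := by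
    have : Tendsto (fun t : ℝ => (t : ℂ)) (𝓝 (0 : ℝ)) (𝓝 ((0 : ℝ) : ℂ)) :=
      Complex.continuous_ofReal.tendsto 0
    simpa using this.mono_left nhdsWithin_le_nhds
  have := (h0.smul (h g)).add_const (F g)
  rw [zero_smul, zero_add] at this
  refine this.congr' ?_
  filter_upwards [self_mem_nhdsWithin] with t ht
  have ht' : (t : ℂ) ≠ 0 := by exact_mod_cast ht
  simp only [diffQuot, smul_smul, Complex.ofReal_inv, mul_inv_cancel₀ ht', one_smul]
  abel

theorem HasField.smul [IsTopologicalAddGroup E] [ContinuousSMul ℂ E] {f f' : G → ℂ}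
    {F F' : G → E} (h : HasField γ i f f') (k : HasField γ i F F') :
    HasField γ i (f • F) (f' • F + f • F') := by
  intro g
  refine (((h g).smul_const (F g)).add ((h.tendsto_mul g).smul (k g))).congr fun t => ?_
  simp only [diffQuot, Pi.smul_apply', smul_eq_mul, smul_comm (f (g * γ i t)), mul_smul, sub_smul,
    smul_sub]
  abel

theorem HasField.mul {f f' h h' : G → ℂ} (hf : HasField γ i f f') (hh : HasField γ i h h') :
    HasField γ i (f * h) (f' * h + f * h') :=
  hf.smul hh

/-- For a one-parameter subgroup, differentiability along `X̃ᵢ` is differentiability of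
`t ↦ F (g exp (t Xᵢ))` at `t = 0`. -/
theorem hasField_iff_hasDerivAt (hγ : γ i 0 = 1) {f f' : G → ℂ} :
    HasField γ i f f' ↔ ∀ g, HasDerivAt (fun t => f (g * γ i t)) (f' g) 0 := by
  refine forall_congr' fun g => ?_
  rw [hasDerivAt_iff_tendsto_slope_zero]
  simp only [zero_add, hγ, mul_one, Complex.real_smul]
  rfl

theorem HasField.inv (hγ : γ i 0 = 1) {f f' : G → ℂ} (h : HasField γ i f f')
    (hf : ∀ g, f g ≠ 0) : HasField γ i f⁻¹ (-f' * (f⁻¹ * f⁻¹)) := by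
  rw [hasField_iff_hasDerivAt hγ] at h ⊢
  intro g
  have := (h g).inv (by simpa [hγ] using hf g)
  refine this.congr_deriv ?_
  simp [hγ, div_eq_mul_inv, sq]

theorem HasField.map {E' : Type*} [AddCommGroup E'] [Module ℂ E'] [TopologicalSpace E']
    (φ : E →L[ℂ] E') {F F' : G → E} (h : HasField γ i F F') :
    HasField γ i (fun g => φ (F g)) (fun g => φ (F' g)) := by
  intro g
  refine ((φ.continuous.tendsto _).comp (h g)).congr fun t => ?_
  simp [diffQuot]

theorem wordField_append (w w' : List ι) (F : G → E) :
    wordField γ (w ++ w') F = wordField γ w (wordField γ w' F) := by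
  induction w with
  | nil => rfl
  | cons i w ih => simp only [List.cons_append, wordField, ih]

theorem invOp_apply (P : EnvElt ι) (F : G → E) (g : G) :
    invOp γ P F g = ∑ w ∈ P.support, ((P w : ℝ) : ℂ) • wordField γ w F g := rfl

theorem invOp_single (w : List ι) (c : ℝ) (F : G → E) :
    invOp γ (Finsupp.single w c) F = (c : ℂ) • wordField γ w F := by
  funext g
  simp [invOp]

theorem invOp_add (P Q : EnvElt ι) (F : G → E) :
    invOp γ (P + Q) F = invOp γ P F + invOp γ Q F := by
  funext g
  classical
  simp only [invOp, Pi.add_apply]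
  rw [Finsupp.sum_add_index'] <;> simp [add_smul]

/-- Iterated fields of a family of functions stay in a set of families that is closed under the
frame. -/
theorem exists_wordField_eq_of_closed [T2Space E] {N : Type*} (𝒦 : Set (N → G → E))
    (hd : ∀ F ∈ 𝒦, ∀ i, ∃ F' ∈ 𝒦, ∀ n, HasField γ i (F n) (F' n)) (w : List ι) :
    ∀ F ∈ 𝒦, ∃ F' ∈ 𝒦, ∀ n, wordField γ w (F n) = F' n := by
  intro F hF
  induction w with
  | nil => exact ⟨F, hF, fun n => rfl⟩
  | cons i w ih =>
    obtain ⟨F', hF', h⟩ := ih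
    obtain ⟨F'', hF'', h'⟩ := hd F' hF' i
    exact ⟨F'', hF'', fun n => by simp only [wordField, h n, (h' n).leftField_eq]⟩

theorem wordField_mem_of_closed [T2Space E] (𝒦 : Set (G → E))
    (hd : ∀ F ∈ 𝒦, ∀ i, ∃ F' ∈ 𝒦, HasField γ i F F') (w : List ι) {F : G → E} (hF : F ∈ 𝒦) :
    wordField γ w F ∈ 𝒦 := by
  induction w with
  | nil => exact hF
  | cons i w ih =>
    obtain ⟨F'', hF'', h'⟩ := hd _ ih i
    simpa only [wordField, h'.leftField_eq] using hF''

theorem isSmooth_of_closed [TopologicalSpace G] [T2Space E] (𝒦 : Set (G → E))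
    (hc : ∀ F ∈ 𝒦, Continuous F) (hd : ∀ F ∈ 𝒦, ∀ i, ∃ F' ∈ 𝒦, HasField γ i F F')
    {F : G → E} (hF : F ∈ 𝒦) : IsSmooth γ F := by
  intro w
  have hw := wordField_mem_of_closed 𝒦 hd w hF
  refine ⟨hc _ hw, fun i => ?_⟩
  obtain ⟨F'', -, h'⟩ := hd _ hw i
  exact h'.diffAlong

theorem wordField_zero [T2Space E] (w : List ι) : wordField γ w (0 : G → E) = 0 := by
  induction w with
  | nil => rfl
  | cons i w ih => rw [wordField, ih, HasField.zero.leftField_eq]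

section Smooth

variable [TopologicalSpace G]

theorem IsSmooth.continuous {F : G → E} (h : IsSmooth γ F) : Continuous F := (h []).1

theorem IsSmooth.hasField {F : G → E} (h : IsSmooth γ F) (i : ι) :
    HasField γ i F (leftField γ i F) := ((h []).2 i).hasField

theorem IsSmooth.wordField {F : G → E} (h : IsSmooth γ F) (w : List ι) :
    IsSmooth γ (wordField γ w F) := by
  intro w'
  rw [← wordField_append]
  exact h _

theorem IsSmooth.leftField {F : G → E} (h : IsSmooth γ F) (i : ι) :
    IsSmooth γ (leftField γ i F) := h.wordField [i]

theorem isSmooth_zero [T2Space E] : IsSmooth γ (0 : G → E) := by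
  intro w
  rw [wordField_zero]
  exact ⟨continuous_zero, fun i => HasField.zero.diffAlong⟩

theorem IsSmooth.wordField_add [T2Space E] [ContinuousAdd E] {F K : G → E} (h : IsSmooth γ F)
    (k : IsSmooth γ K) (w : List ι) :
    _root_.wordField γ w (F + K) = _root_.wordField γ w F + _root_.wordField γ w K := by
  induction w with
  | nil => rfl
  | cons i w ih =>
    simp only [_root_.wordField, ih]
    exact (((h w).2 i).hasField.add ((k w).2 i).hasField).leftField_eq

theorem IsSmooth.add [T2Space E] [ContinuousAdd E] {F K : G → E} (h : IsSmooth γ F)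
    (k : IsSmooth γ K) : IsSmooth γ (F + K) := by
  intro w
  rw [h.wordField_add k]
  exact ⟨(h w).1.add (k w).1, fun i => (((h w).2 i).hasField.add ((k w).2 i).hasField).diffAlong⟩

theorem IsSmooth.wordField_const_smul [T2Space E] [ContinuousConstSMul ℂ E] {F : G → E}
    (h : IsSmooth γ F) (c : ℂ) (w : List ι) :
    _root_.wordField γ w (c • F) = c • _root_.wordField γ w F := by
  induction w with
  | nil => rfl
  | cons i w ih =>
    simp only [_root_.wordField, ih]
    exact (((h w).2 i).hasField.const_smul c).leftField_eq

theorem IsSmooth.const_smul [T2Space E] [ContinuousConstSMul ℂ E] {F : G → E}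
    (h : IsSmooth γ F) (c : ℂ) : IsSmooth γ (c • F) := by
  intro w
  rw [h.wordField_const_smul]
  exact ⟨(h w).1.const_smul c, fun i => (((h w).2 i).hasField.const_smul c).diffAlong⟩

theorem IsSmooth.sum [T2Space E] [ContinuousAdd E] {T : Type*} (s : Finset T) {F : T → G → E}
    (h : ∀ t ∈ s, IsSmooth γ (F t)) : IsSmooth γ (∑ t ∈ s, F t) := by
  classical
  induction s using Finset.induction_on with
  | empty => simpa using isSmooth_zero
  | insert a s ha ih =>
    rw [Finset.sum_insert ha]
    exact (h a (by simp)).add (ih fun t ht => h t (by simp [ht]))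

theorem IsSmooth.invOp_add [T2Space E] [ContinuousAdd E] {F K : G → E}
    (h : IsSmooth γ F) (k : IsSmooth γ K) (P : EnvElt ι) :
    invOp γ P (F + K) = invOp γ P F + invOp γ P K := by
  funext g
  simp only [invOp_apply, h.wordField_add k, Pi.add_apply, smul_add, Finset.sum_add_distrib]

theorem IsSmooth.invOp_const_smul [T2Space E] [ContinuousConstSMul ℂ E] {F : G → E}
    (h : IsSmooth γ F) (c : ℂ) (P : EnvElt ι) :
    invOp γ P (c • F) = c • invOp γ P F := by
  funext g
  simp only [invOp_apply, h.wordField_const_smul, Pi.smul_apply, Finset.smul_sum, smul_comm c]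

theorem IsSmooth.invOp [T2Space E] [ContinuousAdd E] [ContinuousConstSMul ℂ E] {F : G → E}
    (h : IsSmooth γ F) (P : EnvElt ι) : IsSmooth γ (invOp γ P F) := by
  have : _root_.invOp γ P F =
      ∑ w ∈ P.support, ((P w : ℝ) : ℂ) • _root_.wordField γ w F := by
    funext g
    simp [invOp_apply]
  rw [this]
  exact IsSmooth.sum _ fun w _ => (h.wordField w).const_smul _

theorem IsSmooth.wordField_map [T2Space E] {E' : Type*} [AddCommGroup E'] [Module ℂ E']
    [TopologicalSpace E'] [T2Space E'] (φ : E →L[ℂ] E') {F : G → E} (h : IsSmooth γ F)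
    (w : List ι) :
    _root_.wordField γ w (fun g => φ (F g)) = fun g => φ (_root_.wordField γ w F g) := by
  induction w with
  | nil => rfl
  | cons i w ih =>
    simp only [_root_.wordField, ih]
    exact (((h w).2 i).hasField.map φ).leftField_eq

theorem IsSmooth.map [T2Space E] {E' : Type*} [AddCommGroup E'] [Module ℂ E']
    [TopologicalSpace E'] [T2Space E'] (φ : E →L[ℂ] E') {F : G → E} (h : IsSmooth γ F) :
    IsSmooth γ (fun g => φ (F g)) := by
  intro w
  rw [h.wordField_map φ]
  exact ⟨φ.continuous.comp (h w).1, fun i => (((h w).2 i).hasField.map φ).diffAlong⟩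

theorem IsSmooth.invOp_map [T2Space E] {E' : Type*} [AddCommGroup E'] [Module ℂ E']
    [TopologicalSpace E'] [T2Space E'] (φ : E →L[ℂ] E') {F : G → E} (h : IsSmooth γ F)
    (P : EnvElt ι) (g : G) :
    _root_.invOp γ P (fun g => φ (F g)) g = φ (_root_.invOp γ P F g) := by
  simp only [invOp_apply, h.wordField_map φ, map_sum, map_smul]

end Smooth

theorem continuous_list_sum' {X T M : Type*} [TopologicalSpace X] [AddCommMonoid M]
    [TopologicalSpace M] [ContinuousAdd M] (l : List T) {F : T → X → M}
    (h : ∀ t, Continuous (F t)) : Continuous (l.map F).sum := by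
  induction l with
  | nil => exact continuous_zero
  | cons a l ih => simpa using (h a).add ih

/-! ### The Leibniz rule -/

/-- The ways to distribute the letters of a word over two factors. -/
def splits : List ι → List (List ι × List ι)
  | [] => [([], [])]
  | i :: w => (splits w).map (fun q => (i :: q.1, q.2)) ++ (splits w).map (fun q => (q.1, i :: q.2))

theorem HasField.list_sum [ContinuousAdd E] {T : Type*} (l : List T) {F F' : T → G → E}
    (h : ∀ t, HasField γ i (F t) (F' t)) :
    HasField γ i (l.map F).sum (l.map F').sum := by
  induction l with
  | nil => exact HasField.zero
  | cons a l ih => simpa using (h a).add ih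

theorem list_sum_map_add {T M : Type*} [AddCommMonoid M] (l : List T) (f h : T → M) :
    (l.map (fun t => f t + h t)).sum = (l.map f).sum + (l.map h).sum := by
  induction l with
  | nil => simp
  | cons a l ih => simp only [List.map_cons, List.sum_cons, ih]; abel

variable [TopologicalSpace G]

/-- The general Leibniz rule. -/
theorem IsSmooth.wordField_smul [T2Space E] [IsTopologicalAddGroup E] [ContinuousSMul ℂ E]
    {f : G → ℂ} {F : G → E} (h : IsSmooth γ f) (k : IsSmooth γ F) (w : List ι) :
    _root_.wordField γ w (f • F) = ((splits w).map fun q =>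
      _root_.wordField γ q.1 f • _root_.wordField γ q.2 F).sum := by
  induction w with
  | nil => simp [splits, _root_.wordField]
  | cons i w ih =>
    simp only [_root_.wordField, ih]
    rw [(HasField.list_sum (splits w) fun q =>
      ((h q.1).2 i).hasField.smul ((k q.2).2 i).hasField).leftField_eq, list_sum_map_add]
    simp only [splits, List.map_append, List.map_map, List.sum_append]
    rfl

theorem IsSmooth.smul [T2Space E] [IsTopologicalAddGroup E] [ContinuousSMul ℂ E]
    {f : G → ℂ} {F : G → E} (h : IsSmooth γ f) (k : IsSmooth γ F) : IsSmooth γ (f • F) := by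
  intro w
  rw [h.wordField_smul k]
  exact ⟨continuous_list_sum' _ fun q => (h q.1).1.smul (k q.2).1, fun i =>
    (HasField.list_sum (splits w) fun q =>
      ((h q.1).2 i).hasField.smul ((k q.2).2 i).hasField).diffAlong⟩

theorem IsSmooth.mul {f h : G → ℂ} (hf : IsSmooth γ f) (hh : IsSmooth γ h) :
    IsSmooth γ (f * h) := hf.smul hh

theorem isSmooth_const [T2Space E] (c : E) : IsSmooth γ (fun _ : G => c) := by
  refine isSmooth_of_closed {F | ∃ c : E, F = fun _ => c} ?_ ?_ ⟨c, rfl⟩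
  · rintro _ ⟨c, rfl⟩
    exact continuous_const
  · rintro _ ⟨c, rfl⟩ i
    exact ⟨_, ⟨0, rfl⟩, HasField.const c⟩

/-! ### Symbol spaces -/

variable {p : κ → Seminorm ℂ E} {m m' : G → ℂ}

theorem mem_symbolSpace_iff {F : G → E} : F ∈ symbolSpace γ p m ↔
    IsSmooth γ F ∧ ∀ (w : List ι) (j : κ), ∃ C : ℝ, ∀ g, p j (wordField γ w F g) ≤ C * ‖m g‖ := by
  refine and_congr_right fun _ => ⟨fun h w j => ?_, fun h P j => ?_⟩
  · obtain ⟨C, hC⟩ := h (Finsupp.single w 1) j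
    refine ⟨C, fun g => ?_⟩
    simpa [invOp_single] using hC g
  · choose C hC using fun w => h w j
    refine ⟨∑ w ∈ P.support, |P w| * C w, fun g => ?_⟩
    rw [invOp_apply, Finset.sum_mul]
    refine (Finset.le_sum_of_subadditive (p j) (map_zero _).le (map_add_le_add (p j)) _ _).trans
      (Finset.sum_le_sum fun w _ => ?_)
    rw [map_smul_eq_mul, Complex.norm_real, Real.norm_eq_abs, mul_assoc]
    exact mul_le_mul_of_nonneg_left (hC w g) (abs_nonneg _)

/-- A set of functions bounded by `m` and closed under the frame consists of symbols. -/
theorem mem_symbolSpace_of_closed [T2Space E] (𝒦 : Set (G → E))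
    (hc : ∀ F ∈ 𝒦, Continuous F) (hd : ∀ F ∈ 𝒦, ∀ i, ∃ F' ∈ 𝒦, HasField γ i F F')
    (hb : ∀ F ∈ 𝒦, ∀ j, ∃ C : ℝ, ∀ g, p j (F g) ≤ C * ‖m g‖)
    {F : G → E} (hF : F ∈ 𝒦) : F ∈ symbolSpace γ p m :=
  mem_symbolSpace_iff.2 ⟨isSmooth_of_closed 𝒦 hc hd hF, fun w j =>
    hb _ (wordField_mem_of_closed 𝒦 hd w hF) j⟩

theorem symbolSpace.mono {F : G → E} (hF : F ∈ symbolSpace γ p m) {C : ℝ}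
    (h : ∀ g, ‖m g‖ ≤ C * ‖m' g‖) : F ∈ symbolSpace γ p m' := by
  refine ⟨hF.1, fun P j => ?_⟩
  obtain ⟨D, hD⟩ := hF.2 P j
  refine ⟨|D| * C, fun g => (hD g).trans ?_⟩
  calc D * ‖m g‖ ≤ |D| * ‖m g‖ := mul_le_mul_of_nonneg_right (le_abs_self D) (norm_nonneg _)
    _ ≤ |D| * (C * ‖m' g‖) := mul_le_mul_of_nonneg_left (h g) (abs_nonneg _)
    _ = _ := by ring

theorem symbolSpace.zero [T2Space E] : (0 : G → E) ∈ symbolSpace γ p m := by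
  refine mem_symbolSpace_iff.2 ⟨isSmooth_zero, fun w j => ⟨0, fun g => ?_⟩⟩
  simp [wordField_zero]

theorem symbolSpace.add [T2Space E] [ContinuousAdd E] {F K : G → E}
    (hF : F ∈ symbolSpace γ p m) (hK : K ∈ symbolSpace γ p m) : F + K ∈ symbolSpace γ p m := by
  refine ⟨hF.1.add hK.1, fun P j => ?_⟩
  obtain ⟨C, hC⟩ := hF.2 P j
  obtain ⟨D, hD⟩ := hK.2 P j
  refine ⟨C + D, fun g => ?_⟩
  rw [hF.1.invOp_add hK.1, Pi.add_apply, add_mul]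
  exact (map_add_le_add _ _ _).trans (add_le_add (hC g) (hD g))

theorem symbolSpace.const_smul [T2Space E] [ContinuousConstSMul ℂ E] {F : G → E}
    (hF : F ∈ symbolSpace γ p m) (c : ℂ) : c • F ∈ symbolSpace γ p m := by
  refine ⟨hF.1.const_smul c, fun P j => ?_⟩
  obtain ⟨C, hC⟩ := hF.2 P j
  refine ⟨‖c‖ * C, fun g => ?_⟩
  rw [hF.1.invOp_const_smul, Pi.smul_apply, map_smul_eq_mul, mul_assoc]
  exact mul_le_mul_of_nonneg_left (hC g) (norm_nonneg _)

theorem symbolSpace.wordField {F : G → E} (hF : F ∈ symbolSpace γ p m) (w : List ι) :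
    wordField γ w F ∈ symbolSpace γ p m := by
  rw [mem_symbolSpace_iff] at hF ⊢
  refine ⟨hF.1.wordField w, fun w' j => ?_⟩
  rw [← wordField_append]
  exact hF.2 _ j

theorem symbolSpace.leftField {F : G → E} (hF : F ∈ symbolSpace γ p m) (i : ι) :
    leftField γ i F ∈ symbolSpace γ p m := symbolSpace.wordField hF [i]

/-- Pointwise bound for the Leibniz rule. -/
theorem exists_seminorm_wordField_smul_le [T2Space E] [IsTopologicalAddGroup E]
    [ContinuousSMul ℂ E] (q : Seminorm ℂ E) {f : G → ℂ} {F : G → E} (h : IsSmooth γ f)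
    (k : IsSmooth γ F) (w : List ι) (g : G) :
    q (_root_.wordField γ w (f • F) g) ≤ ((splits w).map fun s =>
      ‖_root_.wordField γ s.1 f g‖ * q (_root_.wordField γ s.2 F g)).sum := by
  rw [h.wordField_smul k]
  induction splits w with
  | nil => simp
  | cons a l ih =>
    simp only [List.map_cons, List.sum_cons, Pi.add_apply]
    refine (map_add_le_add q _ _).trans (add_le_add ?_ ih)
    rw [Pi.smul_apply', map_smul_eq_mul]

/-- Scalar symbols. -/
abbrev scalarSymbols (γ : ι → ℝ → G) (m : G → ℂ) : Set (G → ℂ) :=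
  symbolSpace γ (fun _ : Unit => normSeminorm ℂ ℂ) m

theorem mem_scalarSymbols_iff {f : G → ℂ} : f ∈ scalarSymbols γ m ↔
    IsSmooth γ f ∧ ∀ w : List ι, ∃ C : ℝ, ∀ g, ‖wordField γ w f g‖ ≤ C * ‖m g‖ := by
  rw [mem_symbolSpace_iff]
  exact and_congr_right fun _ => ⟨fun h w => h w (), fun h w _ => h w⟩

theorem scalarSymbols.norm_le {f : G → ℂ} (hf : f ∈ scalarSymbols γ m) :
    ∃ C : ℝ, 0 ≤ C ∧ ∀ g, ‖f g‖ ≤ C * ‖m g‖ := by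
  obtain ⟨C, hC⟩ := (mem_scalarSymbols_iff.1 hf).2 []
  exact ⟨|C|, abs_nonneg C, fun g => (hC g).trans
    (mul_le_mul_of_nonneg_right (le_abs_self C) (norm_nonneg _))⟩

theorem list_sum_const_mul_le {T : Type*} (l : List T) (a b : T → ℝ) (c : ℝ)
    (h : ∀ t, a t ≤ b t * c) : (l.map a).sum ≤ (l.map b).sum * c := by
  induction l with
  | nil => simp
  | cons t l ih =>
    simp only [List.map_cons, List.sum_cons, add_mul]
    exact add_le_add (h t) ih

theorem scalarSymbols.smul [T2Space E] [IsTopologicalAddGroup E] [ContinuousSMul ℂ E]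
    {f : G → ℂ} {F : G → E} (hf : f ∈ scalarSymbols γ m) (hF : F ∈ symbolSpace γ p m') :
    f • F ∈ symbolSpace γ p (m * m') := by
  rw [mem_scalarSymbols_iff] at hf
  rw [mem_symbolSpace_iff] at hF ⊢
  refine ⟨hf.1.smul hF.1, fun w j => ?_⟩
  choose C hC using hf.2
  choose D hD using fun w => hF.2 w j
  refine ⟨((splits w).map fun s => C s.1 * D s.2).sum, fun g =>
    (exists_seminorm_wordField_smul_le (p j) hf.1 hF.1 w g).trans
      (list_sum_const_mul_le _ _ _ _ fun s => ?_)⟩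
  calc _ ≤ (C s.1 * ‖m g‖) * (D s.2 * ‖m' g‖) :=
        mul_le_mul (hC _ g) (hD _ g) (apply_nonneg _ _) ((norm_nonneg _).trans (hC _ g))
    _ = _ := by rw [Pi.mul_apply, norm_mul]; ring

theorem scalarSymbols.mul {f h : G → ℂ} (hf : f ∈ scalarSymbols γ m)
    (hh : h ∈ scalarSymbols γ m') : f * h ∈ scalarSymbols γ (m * m') := scalarSymbols.smul hf hh

theorem scalarSymbols.const (c : ℂ) : (fun _ => c) ∈ scalarSymbols γ (1 : G → ℂ) := by
  refine mem_symbolSpace_of_closed {F | ∃ c : ℂ, F = fun _ => c} ?_ ?_ ?_ ⟨c, rfl⟩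
  · rintro _ ⟨c, rfl⟩
    exact continuous_const
  · rintro _ ⟨c, rfl⟩ i
    exact ⟨_, ⟨0, rfl⟩, HasField.const c⟩
  · rintro _ ⟨c, rfl⟩ _
    exact ⟨‖c‖, fun g => by simp⟩

theorem scalarSymbols.one : (1 : G → ℂ) ∈ scalarSymbols γ (1 : G → ℂ) := scalarSymbols.const 1

theorem scalarSymbols.pow {f : G → ℂ} (hf : f ∈ scalarSymbols γ m) (n : ℕ) :
    f ^ n ∈ scalarSymbols γ (m ^ n) := by
  induction n with
  | zero => simpa using scalarSymbols.one
  | succ n ih => simpa [pow_succ] using scalarSymbols.mul ih hf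

/-- The inverse of a weight is a symbol: the functions `f * m⁻¹ ^ (n + 1)` with `f` a symbol for
`m ^ n` are bounded by `m⁻¹` and closed under the frame. -/
theorem IsWeight.inv_mem (hγ : ∀ i, γ i 0 = 1) (hm : IsWeight γ m) :
    m⁻¹ ∈ scalarSymbols γ m⁻¹ := by
  refine mem_symbolSpace_of_closed
    {F | ∃ (n : ℕ) (f : G → ℂ), f ∈ scalarSymbols γ (m ^ n) ∧ F = f * m⁻¹ ^ (n + 1)} ?_ ?_ ?_
    ⟨0, 1, by simpa using scalarSymbols.one, by simp⟩
  · rintro _ ⟨n, f, hf, rfl⟩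
    exact hf.1.continuous.mul ((hm.2.1.continuous.inv₀ hm.1).pow _)
  · rintro _ ⟨n, f, hf, rfl⟩ i
    have hinv := (hm.2.1.hasField i).inv (hγ i) hm.1
    have hpow : ∀ k : ℕ, HasField γ i (m⁻¹ ^ (k + 1))
        (-((k + 1 : ℕ) : ℂ) • (_root_.leftField γ i m * m⁻¹ ^ (k + 2))) := by
      intro k
      induction k with
      | zero =>
        convert hinv using 1
        · simp
        · funext g
          simp [pow_succ]
      | succ k ih =>
        rw [pow_succ m⁻¹ (k + 1)]
        convert ih.mul hinv using 1
        funext g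
        simp [smul_eq_mul]
        ring
    refine ⟨(_root_.leftField γ i f * m + (-((n + 1 : ℕ) : ℂ)) • (f * _root_.leftField γ i m)) *
      m⁻¹ ^ (n + 2), ⟨n + 1, _, ?_, rfl⟩, ?_⟩
    · have h1 := scalarSymbols.mul (symbolSpace.leftField hf i) hm.2
      have h2 := symbolSpace.const_smul
        (scalarSymbols.mul hf (symbolSpace.leftField hm.2 i)) (-((n + 1 : ℕ) : ℂ))
      rw [← pow_succ] at h1 h2
      exact symbolSpace.add h1 h2
    · convert (hf.1.hasField i).mul (hpow n) using 1
      funext g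
      have h1 : m g * (m g)⁻¹ = 1 := mul_inv_cancel₀ (hm.1 g)
      simp only [Pi.mul_apply, Pi.add_apply, Pi.smul_apply, Pi.pow_apply, Pi.inv_apply, smul_eq_mul]
      linear_combination (_root_.leftField γ i f g * (m g)⁻¹ ^ (n + 1)) * h1
  · rintro _ ⟨n, f, hf, rfl⟩ _
    obtain ⟨C, -, hC⟩ := scalarSymbols.norm_le hf
    refine ⟨C, fun g => ?_⟩
    have h0 : 0 < ‖m g‖ := norm_pos_iff.2 (hm.1 g)
    have := hC g
    simp only [coe_normSeminorm, Pi.mul_apply, Pi.pow_apply, Pi.inv_apply, norm_mul, norm_pow,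
      norm_inv] at this ⊢
    calc _ ≤ (C * ‖m g‖ ^ n) * ‖m g‖⁻¹ ^ (n + 1) := by gcongr
      _ = C * ‖m g‖⁻¹ * (‖m g‖ * ‖m g‖⁻¹) ^ n := by ring
      _ = _ := by rw [mul_inv_cancel₀ h0.ne', one_pow, mul_one]

theorem IsWeight.inv (hγ : ∀ i, γ i 0 = 1) (hm : IsWeight γ m) : IsWeight γ m⁻¹ :=
  ⟨fun g => inv_ne_zero (hm.1 g), hm.inv_mem hγ⟩

theorem IsWeight.mul (hm : IsWeight γ m) (hm' : IsWeight γ m') : IsWeight γ (m * m') :=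
  ⟨fun g => mul_ne_zero (hm.1 g) (hm'.1 g), scalarSymbols.mul hm.2 hm'.2⟩

theorem IsWeight.pow (hm : IsWeight γ m) (n : ℕ) : IsWeight γ (m ^ n) :=
  ⟨fun g => pow_ne_zero _ (hm.1 g), scalarSymbols.pow hm.2 n⟩

theorem symbolSpace.map [T2Space E] (hp : WithSeminorms p) [Nonempty κ] (φ : E →L[ℂ] ℂ)
    {F : G → E} (hF : F ∈ symbolSpace γ p m) : (fun g => φ (F g)) ∈ scalarSymbols γ m := by
  rw [mem_symbolSpace_iff] at hF
  refine mem_scalarSymbols_iff.2 ⟨hF.1.map φ, fun w => ?_⟩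
  obtain ⟨s, C, -, hC⟩ := Seminorm.bound_of_continuous hp
    ((normSeminorm ℂ ℂ).comp φ.toLinearMap) (continuous_norm.comp φ.continuous)
  choose D hD using hF.2 w
  refine ⟨C * ∑ j ∈ s, D j, fun g => ?_⟩
  rw [hF.1.wordField_map φ]
  refine (hC _).trans ?_
  have h1 : (s.sup p) (_root_.wordField γ w F g) ≤ ∑ j ∈ s, p j (_root_.wordField γ w F g) := by
    exact Seminorm.finset_sup_apply_le (Finset.sum_nonneg fun j _ => apply_nonneg _ _)
      fun j hj => Finset.single_le_sum (f := fun j => p j (_root_.wordField γ w F g))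
        (fun j _ => apply_nonneg _ _) hj
  change (C : ℝ) * (s.sup p) (_root_.wordField γ w F g) ≤ _
  rw [mul_assoc, Finset.sum_mul]
  exact mul_le_mul_of_nonneg_left (h1.trans (Finset.sum_le_sum fun j _ => hD j g)) C.2

/-! ### Locality -/

/-- The curves `t ↦ g exp (t Xᵢ)` start at `g` and are continuous there. -/
def FrameContinuous (γ : ι → ℝ → G) : Prop :=
  ∀ i g, Tendsto (fun t => g * γ i t) (𝓝 (0 : ℝ)) (𝓝 g)

theorem wordField_eqOn (hγ : FrameContinuous γ) {U : Set G} (hU : IsOpen U) {F K : G → E}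
    (h : Set.EqOn F K U) (w : List ι) : Set.EqOn (wordField γ w F) (wordField γ w K) U := by
  induction w with
  | nil => exact h
  | cons i w ih =>
    intro g hg
    have h1 : diffQuot γ i (wordField γ w F) g =ᶠ[𝓝[≠] 0] diffQuot γ i (wordField γ w K) g := by
      filter_upwards [nhdsWithin_le_nhds ((hγ i g).eventually (hU.mem_nhds hg))] with t ht
      simp only [diffQuot, ih ht, ih hg]
    simp only [wordField, leftField, limUnder, Filter.map_congr h1]

theorem invOp_eqOn (hγ : FrameContinuous γ) {U : Set G} (hU : IsOpen U) {F K : G → E}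
    (h : Set.EqOn F K U) (P : EnvElt ι) : Set.EqOn (invOp γ P F) (invOp γ P K) U := by
  intro g hg
  simp only [invOp_apply, wordField_eqOn hγ hU h _ hg]

theorem wordField_eq_zero_of_notMem_tsupport [T2Space E] (hγ : FrameContinuous γ) {F : G → E}
    (w : List ι) {g : G} (hg : g ∉ tsupport F) : wordField γ w F g = 0 := by
  have := wordField_eqOn hγ (isClosed_tsupport F).isOpen_compl (F := F) (K := 0)
    (fun x hx => image_eq_zero_of_notMem_tsupport hx) w hg
  simpa [wordField_zero] using this

theorem tsupport_wordField_subset [T2Space E] (hγ : FrameContinuous γ) (F : G → E)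
    (w : List ι) : tsupport (wordField γ w F) ⊆ tsupport F := by
  refine closure_minimal (fun g hg => ?_) (isClosed_tsupport F)
  by_contra h
  exact hg (wordField_eq_zero_of_notMem_tsupport hγ w h)

theorem tsupport_invOp_subset [T2Space E] (hγ : FrameContinuous γ) (F : G → E)
    (P : EnvElt ι) : tsupport (invOp γ P F) ⊆ tsupport F := by
  refine closure_minimal (fun g hg => ?_) (isClosed_tsupport F)
  by_contra h
  refine hg ?_
  simp [invOp_apply, wordField_eq_zero_of_notMem_tsupport hγ _ h]

theorem testFunctions.wordField [T2Space E]
    (hγ : FrameContinuous γ) {F : G → E} (hF : F ∈ testFunctions γ E) (w : List ι) :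
    wordField γ w F ∈ testFunctions γ E :=
  ⟨hF.1.wordField w, hF.2.of_isClosed_subset (isClosed_tsupport _) (tsupport_wordField_subset hγ F w)⟩

/-- Test functions are symbols for every continuous nowhere vanishing `m`. -/
theorem testFunctions.mem_symbolSpace [T2Space E] (hγ : FrameContinuous γ)
    (hp : ∀ j, Continuous (p j)) {F : G → E} (hF : F ∈ testFunctions γ E) (hm : Continuous m)
    (hm0 : ∀ g, m g ≠ 0) : F ∈ symbolSpace γ p m := by
  refine mem_symbolSpace_iff.2 ⟨hF.1, fun w j => ?_⟩
  have hw := testFunctions.wordField hγ hF w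
  have hcont : Continuous fun g => p j (_root_.wordField γ w F g) / ‖m g‖ :=
    ((hp j).comp hw.1.continuous).div hm.norm fun g => norm_ne_zero_iff.2 (hm0 g)
  have hcs : HasCompactSupport fun g => p j (_root_.wordField γ w F g) / ‖m g‖ := by
    refine hw.2.mono fun g hg => ?_
    contrapose! hg
    simp only [Function.mem_support, not_not] at hg ⊢
    simp [hg]
  obtain ⟨C, hC⟩ := hcs.exists_bound_of_continuous hcont
  refine ⟨C, fun g => ?_⟩
  have := (le_abs_self _).trans (hC g)
  rwa [div_le_iff₀ (norm_pos_iff.2 (hm0 g))] at this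

theorem IsSmooth.smul_testFunctions [T2Space E] [IsTopologicalAddGroup E] [ContinuousSMul ℂ E]
    {f : G → ℂ} {F : G → E} (h : IsSmooth γ f) (hF : F ∈ testFunctions γ E) :
    f • F ∈ testFunctions γ E :=
  ⟨h.smul hF.1, hF.2.smul_left⟩

theorem testFunctions.smul_isSmooth [T2Space E] [IsTopologicalAddGroup E] [ContinuousSMul ℂ E]
    {f : G → ℂ} {F : G → E} (hf : f ∈ testFunctions γ ℂ) (hF : IsSmooth γ F) :
    f • F ∈ testFunctions γ E :=
  ⟨hf.1.smul hF, hf.2.smul_right⟩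

end Calculus

/-! ### Integration of continuous functions with values in a Fréchet space -/

section FrechetIntegral

section Algebraic

variable {E : Type*} [AddCommGroup E] [Module ℂ E]

/-- The theorem of Hahn and Banach for a single seminorm. -/
theorem Seminorm.exists_dual_eq (q : Seminorm ℂ E) (x : E) :
    ∃ φ : E →ₗ[ℂ] ℂ, (∀ y, ‖φ y‖ ≤ q y) ∧ φ x = (q x : ℂ) := by
  let _ : SeminormedAddCommGroup E := q.toSeminormedAddCommGroup
  let _ : NormedSpace ℂ E := { norm_smul_le := fun a b => le_of_eq (map_smul_eq_mul q a b) }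
  obtain ⟨g, hg, hgx⟩ := exists_dual_vector'' ℂ x
  refine ⟨g.toLinearMap, fun y => ?_, hgx⟩
  have := g.le_opNorm y
  calc ‖g y‖ ≤ ‖g‖ * ‖y‖ := this
    _ ≤ 1 * ‖y‖ := mul_le_mul_of_nonneg_right hg (norm_nonneg _)
    _ = q y := one_mul _

/-- The Bochner integral in the completion for one seminorm is approximated by vectors of the
space itself, uniformly over the functionals bounded by that seminorm. -/
theorem Seminorm.exists_approx_integral {X : Type*} [TopologicalSpace X]
    [SecondCountableTopology X] [MeasurableSpace X] [OpensMeasurableSpace X] (μ : Measure X)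
    (q : Seminorm ℂ E) {f : X → E} (hf : ∀ x₀, Tendsto (fun x => q (f x - f x₀)) (𝓝 x₀) (𝓝 0))
    (hint : Integrable (fun x => q (f x)) μ) {ε : ℝ} (hε : 0 < ε) :
    ∃ v : E, ∀ φ : E →ₗ[ℂ] ℂ, (∀ y, ‖φ y‖ ≤ q y) → ‖φ v - ∫ x, φ (f x) ∂μ‖ ≤ ε := by
  let _ : SeminormedAddCommGroup E := q.toSeminormedAddCommGroup
  let _ : NormedSpace ℂ E := { norm_smul_le := fun a b => le_of_eq (map_smul_eq_mul q a b) }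
  let e : E →L[ℂ] UniformSpace.Completion E := UniformSpace.Completion.toComplL
  have he : ∀ y, ‖e y‖ = q y := fun y => UniformSpace.Completion.norm_coe y
  have hdense : DenseRange e := UniformSpace.Completion.denseRange_coe
  have hcont : Continuous fun x => e (f x) := by
    refine continuous_iff_continuousAt.2 fun x₀ => ?_
    refine tendsto_iff_norm_sub_tendsto_zero.2 ((hf x₀).congr fun x => ?_)
    rw [← map_sub, he]
  have hI : Integrable (fun x => e (f x)) μ :=
    hint.mono' hcont.aestronglyMeasurable (Eventually.of_forall fun x => (he _).le)
  obtain ⟨v, hv⟩ := hdense.exists_dist_lt (∫ x, e (f x) ∂μ) hε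
  refine ⟨v, fun φ hφ => ?_⟩
  have hb : ∀ y, ‖φ y‖ ≤ 1 * ‖e.toLinearMap y‖ := fun y => by
    rw [one_mul]; exact (hφ y).trans_eq (he y).symm
  have hext : ∀ y, φ.extendOfNorm e.toLinearMap (e y) = φ y :=
    LinearMap.extendOfNorm_eq (e := e.toLinearMap) hdense ⟨1, hb⟩
  have hle := LinearMap.norm_extendOfNorm_apply_le (f := φ) (e := e.toLinearMap) hdense 1 hb
  have h1 : ∫ x, φ (f x) ∂μ = φ.extendOfNorm e.toLinearMap (∫ x, e (f x) ∂μ) := by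
    rw [← ContinuousLinearMap.integral_comp_comm _ hI]
    simp only [hext]
  rw [h1, ← hext, ← map_sub]
  refine (hle _).trans ?_
  rw [one_mul, ← dist_eq_norm, dist_comm]
  exact hv.le

end Algebraic

variable {E : Type*} [AddCommGroup E] [Module ℂ E] {κ : Type*} {p : κ → Seminorm ℂ E}

theorem Seminorm.finset_sup_le_sum_apply (s : Finset κ) (x : E) :
    (s.sup p) x ≤ ∑ j ∈ s, p j x :=
  Seminorm.finset_sup_apply_le (Finset.sum_nonneg fun j _ => apply_nonneg _ _)
    fun j hj => Finset.single_le_sum (f := fun j => p j x) (fun j _ => apply_nonneg _ _) hj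

variable [TopologicalSpace E]

theorem WithSeminorms.exists_dual_eq [Nonempty κ] [IsTopologicalAddGroup E]
    (hp : WithSeminorms p) (s : Finset κ) (x : E) :
    ∃ φ : E →L[ℂ] ℂ, (∀ y, ‖φ y‖ ≤ (s.sup p) y) ∧ φ x = ((s.sup p) x : ℂ) := by
  obtain ⟨φ, hφ, hx⟩ := Seminorm.exists_dual_eq (s.sup p) x
  refine ⟨⟨φ, Seminorm.cont_withSeminorms_normedSpace ℂ hp φ ⟨s, 1, fun y => ?_⟩⟩, hφ, hx⟩
  simpa using hφ y

theorem WithSeminorms.eq_of_forall_dual [Nonempty κ] [IsTopologicalAddGroup E] [T2Space E]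
    (hp : WithSeminorms p) {x y : E} (h : ∀ φ : E →L[ℂ] ℂ, φ x = φ y) : x = y := by
  by_contra hne
  obtain ⟨j, hj⟩ := hp.separating_of_T1 (x - y) (sub_ne_zero.2 hne)
  obtain ⟨φ, -, hφ⟩ := hp.exists_dual_eq {j} (x - y)
  rw [map_sub, h φ, sub_self] at hφ
  rw [Finset.sup_singleton] at hφ
  exact hj (by exact_mod_cast hφ.symm)

theorem WithSeminorms.exists_bound_dual [Nonempty κ] (hp : WithSeminorms p) (φ : E →L[ℂ] ℂ) :
    ∃ (s : Finset κ) (C : ℝ), 0 < C ∧ ∀ x, ‖φ x‖ ≤ C * (s.sup p) x := by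
  obtain ⟨s, C, hC0, hC⟩ := Seminorm.bound_of_continuous hp
    ((normSeminorm ℂ ℂ).comp φ.toLinearMap) (continuous_norm.comp φ.continuous)
  exact ⟨s, C, by positivity, fun x => hC x⟩

section Properties

variable {X : Type*} [MeasurableSpace X] {μ : Measure X} [Nonempty κ] [IsTopologicalAddGroup E]

theorem HasFrechetIntegral.seminorm_le (hp : WithSeminorms p) {f : X → E} {v : E}
    (h : HasFrechetIntegral μ p f v) (j : κ) : p j v ≤ ∫ x, p j (f x) ∂μ := by
  obtain ⟨φ, hφ, hv⟩ := hp.exists_dual_eq {j} v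
  rw [Finset.sup_singleton] at hφ hv
  have : ‖φ v‖ = p j v := by
    rw [hv, Complex.norm_real, Real.norm_of_nonneg (apply_nonneg _ _)]
  rw [← this, h.2.2 φ]
  refine (norm_integral_le_integral_norm _).trans ?_
  refine integral_mono_of_nonneg (Eventually.of_forall fun x => norm_nonneg _) (h.2.1 j)
    (Eventually.of_forall fun x => hφ _)

theorem HasFrechetIntegral.unique [T2Space E] (hp : WithSeminorms p) {f : X → E} {v v' : E}
    (h : HasFrechetIntegral μ p f v) (h' : HasFrechetIntegral μ p f v') : v = v' :=
  hp.eq_of_forall_dual fun φ => by rw [h.2.2, h'.2.2]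

theorem WithSeminorms.integrable_dual (hp : WithSeminorms p) {f : X → E}
    (hm : AEStronglyMeasurable f μ) (hi : ∀ j, Integrable (fun x => p j (f x)) μ)
    (φ : E →L[ℂ] ℂ) : Integrable (fun x => φ (f x)) μ := by
  obtain ⟨s, C, hC0, hC⟩ := hp.exists_bound_dual φ
  refine Integrable.mono' ((integrable_finsetSum s fun j _ => hi j).const_mul C)
    (φ.continuous.comp_aestronglyMeasurable hm) (Eventually.of_forall fun x => ?_)
  refine (hC _).trans (mul_le_mul_of_nonneg_left ?_ hC0.le)
  exact Seminorm.finset_sup_le_sum_apply s (f x)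

theorem HasFrechetIntegral.add (hp : WithSeminorms p) {f f' : X → E} {v v' : E}
    (h : HasFrechetIntegral μ p f v) (h' : HasFrechetIntegral μ p f' v') :
    HasFrechetIntegral μ p (f + f') (v + v') := by
  refine ⟨h.1.add h'.1, fun j => ?_, fun φ => ?_⟩
  · refine Integrable.mono' ((h.2.1 j).add (h'.2.1 j))
      ((hp.continuous_seminorm j).comp_aestronglyMeasurable (h.1.add h'.1))
      (Eventually.of_forall fun x => ?_)
    rw [Real.norm_of_nonneg (apply_nonneg _ _)]
    exact map_add_le_add _ _ _
  · simp only [Pi.add_apply, map_add]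
    rw [integral_add (hp.integrable_dual h.1 h.2.1 φ) (hp.integrable_dual h'.1 h'.2.1 φ), h.2.2,
      h'.2.2]

theorem HasFrechetIntegral.const_smul (hp : WithSeminorms p) {f : X → E} {v : E}
    (h : HasFrechetIntegral μ p f v) (c : ℂ) : HasFrechetIntegral μ p (c • f) (c • v) := by
  haveI := hp.continuousSMul
  refine ⟨h.1.const_smul c, fun j => ?_, fun φ => ?_⟩
  · simpa only [Pi.smul_apply, map_smul_eq_mul] using (h.2.1 j).const_mul ‖c‖
  · simp only [Pi.smul_apply, map_smul, h.2.2, smul_eq_mul, integral_const_mul]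

end Properties

/-- A continuous function with values in a Fréchet space all of whose seminorms are integrable has
an integral: the approximate integrals for the increasing seminorms `max_{j ≤ n} p j` form a Cauchy
sequence, and its limit has the required pairing with every continuous functional. -/
theorem exists_hasFrechetIntegral {E : Type*} [AddCommGroup E] [Module ℂ E] [UniformSpace E]
    [IsUniformAddGroup E] [CompleteSpace E] {p : ℕ → Seminorm ℂ E}
    (hp : WithSeminorms p) {X : Type*} [TopologicalSpace X]
    [SecondCountableTopology X] [MeasurableSpace X] [OpensMeasurableSpace X] (μ : Measure X)
    {f : X → E} (hf : Continuous f) (hint : ∀ j, Integrable (fun x => p j (f x)) μ) :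
    ∃ v, HasFrechetIntegral μ p f v := by
  have : (uniformity E).IsCountablyGenerated := by
    haveI := hp.firstCountableTopology
    exact IsUniformAddGroup.uniformity_countably_generated
  let q : ℕ → Seminorm ℂ E := fun n => (Finset.range (n + 1)).sup p
  have hqc : ∀ n, Continuous (q n) := fun n =>
    Seminorm.continuous_finsetSup fun j _ => hp.continuous_seminorm j
  have hqmono : Monotone q := fun n m hnm =>
    Finset.sup_mono (Finset.range_mono (Nat.add_le_add_right hnm 1))
  have hpq : ∀ j, p j ≤ q j := fun j => Finset.le_sup (f := p) (by simp)
  have hqf : ∀ n x₀, Tendsto (fun x => q n (f x - f x₀)) (𝓝 x₀) (𝓝 0) := fun n x₀ => by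
    have : Continuous fun x => q n (f x - f x₀) := (hqc n).comp (hf.sub continuous_const)
    simpa using this.tendsto x₀
  have hqi : ∀ n, Integrable (fun x => q n (f x)) μ := fun n => by
    refine Integrable.mono' (integrable_finsetSum (Finset.range (n + 1)) fun j _ => hint j)
      ((hqc n).comp hf).aestronglyMeasurable (Eventually.of_forall fun x => ?_)
    rw [Real.norm_of_nonneg (apply_nonneg _ _)]
    exact Seminorm.finset_sup_le_sum_apply _ _
  choose v hv using fun n => Seminorm.exists_approx_integral μ (q n) (hqf n) (hqi n)
    (ε := (1 / 2 : ℝ) ^ n) (by positivity)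
  have hdiff : ∀ n m, n ≤ m → q n (v m - v n) ≤ 2 * (1 / 2 : ℝ) ^ n := by
    intro n m hnm
    obtain ⟨φ, hφ, hx⟩ := Seminorm.exists_dual_eq (q n) (v m - v n)
    have h1 := hv n φ hφ
    have h2 := hv m φ fun y => (hφ y).trans (hqmono hnm y)
    have h3 : q n (v m - v n) = ‖φ (v m - v n)‖ := by
      rw [hx, Complex.norm_real, Real.norm_of_nonneg (apply_nonneg _ _)]
    have h4 : (1 / 2 : ℝ) ^ m ≤ (1 / 2 : ℝ) ^ n :=
      pow_le_pow_of_le_one (by norm_num) (by norm_num) hnm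
    rw [h3, map_sub, ← sub_sub_sub_cancel_right _ _ (∫ x, φ (f x) ∂μ)]
    refine (norm_sub_le _ _).trans ?_
    linarith
  have hpow : Tendsto (fun n : ℕ => (1 / 2 : ℝ) ^ n) atTop (𝓝 0) :=
    tendsto_pow_atTop_nhds_zero_of_lt_one (by norm_num) (by norm_num)
  have hcauchy : CauchySeq v := by
    rw [cauchySeq_iff_tendsto, uniformity_eq_comap_nhds_zero, tendsto_comap_iff,
      hp.tendsto_nhds]
    intro j ε hε
    have hev : ∀ᶠ n in atTop, 4 * (1 / 2 : ℝ) ^ n < ε := by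
      have := hpow.const_mul 4
      rw [mul_zero] at this
      exact this.eventually (gt_mem_nhds hε)
    obtain ⟨N, hN⟩ := (hev.and (eventually_ge_atTop j)).exists
    filter_upwards [eventually_ge_atTop (N, N)] with n hn
    have hj : p j ≤ q N := (hpq j).trans (hqmono hN.2)
    have e : ((fun x : E × E => x.2 - x.1) ∘ Prod.map v v) n - 0 =
        (v n.2 - v N) - (v n.1 - v N) := by simp
    rw [e]
    refine (hj _).trans_lt ((map_sub_le_add (q N) _ _).trans_lt ?_)
    linarith [hdiff N n.2 hn.2, hdiff N n.1 hn.1, hN.1]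
  obtain ⟨w, hw⟩ := cauchySeq_tendsto_of_complete hcauchy
  refine ⟨w, hf.aestronglyMeasurable, hint, fun φ => ?_⟩
  obtain ⟨s, C, hC0, hC⟩ := hp.exists_bound_dual φ
  obtain ⟨N, hN⟩ : ∃ N, s ⊆ Finset.range (N + 1) :=
    ⟨s.sup id, fun j hj => Finset.mem_range.2 (Nat.lt_succ_of_le (Finset.le_sup (f := id) hj))⟩
  have hsN : s.sup p ≤ q N := Finset.sup_mono hN
  have hlim : Tendsto (fun n => φ (v n)) atTop (𝓝 (∫ x, φ (f x) ∂μ)) := by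
    have hz : Tendsto (fun n : ℕ => C * (1 / 2 : ℝ) ^ n) atTop (𝓝 0) := by
      simpa using hpow.const_mul C
    refine tendsto_iff_norm_sub_tendsto_zero.2 (squeeze_zero' (Eventually.of_forall fun n =>
      norm_nonneg _) ?_ hz)
    filter_upwards [eventually_ge_atTop N] with n hn
    have hCC : (C : ℂ) ≠ 0 := by exact_mod_cast hC0.ne'
    have := hv n ((C : ℂ)⁻¹ • φ.toLinearMap) fun y => by
      rw [LinearMap.smul_apply, norm_smul, norm_inv, Complex.norm_real,
        Real.norm_of_nonneg hC0.le, inv_mul_le_iff₀ hC0]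
      exact (hC y).trans (mul_le_mul_of_nonneg_left ((hsN.trans (hqmono hn)) y) hC0.le)
    simp only [LinearMap.smul_apply, ContinuousLinearMap.coe_coe, smul_eq_mul,
      integral_const_mul] at this
    rwa [← mul_sub, norm_mul, norm_inv, Complex.norm_real, Real.norm_of_nonneg hC0.le,
      inv_mul_le_iff₀ hC0] at this
  exact tendsto_nhds_unique ((φ.continuous.tendsto w).comp hw) hlim

end FrechetIntegral

/-! ### Oscillatory integrals on a group with cutoff functions -/

section Oscillatory

variable {G ι : Type*} [Group G] [TopologicalSpace G] {γ : ι → ℝ → G}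

/-- Test functions with uniformly bounded derivatives along the frame which are eventually equal
to `1` on every compact set. -/
structure IsCutoffSeq (γ : ι → ℝ → G) (χ : ℕ → G → ℂ) : Prop where
  mem_testFunctions : ∀ n, χ n ∈ testFunctions γ ℂ
  bound : ∀ w : List ι, ∃ C : ℝ, ∀ n g, ‖wordField γ w (χ n) g‖ ≤ C
  eventually_one : ∀ K : Set G, IsCompact K →
    ∀ᶠ n in atTop, ∃ U : Set G, IsOpen U ∧ K ⊆ U ∧ Set.EqOn (χ n) 1 U

theorem list_sum_map_le_sum_mul {T : Type*} (l : List T) (x y : T → ℝ) (r : ℝ)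
    (h : ∀ t ∈ l, x t ≤ y t * r) : (l.map x).sum ≤ (l.map y).sum * r := by
  induction l with
  | nil => simp
  | cons t l ih =>
    simp only [List.map_cons, List.sum_cons, add_mul]
    exact add_le_add (h t (by simp)) (ih fun s hs => h s (by simp [hs]))

/-- The Leibniz bound for `P̃(f F)` at one point. -/
theorem seminorm_invOp_smul_le {E : Type*} [AddCommGroup E] [Module ℂ E] [TopologicalSpace E]
    [T2Space E] [IsTopologicalAddGroup E] [ContinuousSMul ℂ E] (q : Seminorm ℂ E) {f : G → ℂ}
    {F : G → E} (h : IsSmooth γ f) (k : IsSmooth γ F) (P : EnvElt ι) (g : G)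
    {c d : List ι → ℝ} {x y : ℝ} (hc : ∀ w, ‖wordField γ w f g‖ ≤ c w * x)
    (hd : ∀ w ∈ P.support, ∀ s ∈ splits w, q (wordField γ s.2 F g) ≤ d s.2 * y) :
    q (invOp γ P (f • F) g) ≤
      (∑ w ∈ P.support, |P w| * ((splits w).map fun s => c s.1 * d s.2).sum) * (x * y) := by
  rw [invOp_apply, Finset.sum_mul]
  refine (Finset.le_sum_of_subadditive q (map_zero _).le (map_add_le_add q) _ _).trans
    (Finset.sum_le_sum fun w hw => ?_)
  rw [map_smul_eq_mul, Complex.norm_real, Real.norm_eq_abs, mul_assoc]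
  refine mul_le_mul_of_nonneg_left ((exists_seminorm_wordField_smul_le q h k w g).trans
    (list_sum_map_le_sum_mul _ _ _ _ fun s hs => ?_)) (abs_nonneg _)
  calc _ ≤ (c s.1 * x) * (d s.2 * y) :=
        mul_le_mul (hc _) (hd w hw s hs) (apply_nonneg _ _) ((norm_nonneg _).trans (hc _))
    _ = _ := by ring

theorem norm_expPhase (S : G → ℝ) (g : G) : ‖expPhase S g‖ = 1 := by
  rw [expPhase, mul_comm]
  exact Complex.norm_exp_ofReal_mul_I _

theorem invOp_expPhase (S : G → ℝ) (P : EnvElt ι) (g : G) :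
    invOp γ P (expPhase S) g = multiplier γ S P g * expPhase S g := by
  rw [multiplier, mul_right_comm, expPhase, ← Complex.exp_add]
  simp

variable [MeasurableSpace G] {μ : Measure G} {S : G → ℝ} {P : EnvElt ι} {m₀ : G → ℂ}

theorem IsOscData.integrable_norm (h : IsOscData γ μ S P m₀) :
    Integrable (fun g => ‖((multiplier γ S P)⁻¹ * m₀) g‖) μ := by
  refine h.integrable.norm.congr (Eventually.of_forall fun g => ?_)
  simp only [Pi.mul_apply, Pi.inv_apply, div_eq_mul_inv, mul_comm]

/-- Integration by parts: on test functions the regularized integral is the plain one. -/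
theorem IsOscData.integral_invOp_eq (hγc : FrameContinuous γ) (hγ : ∀ i, γ i 0 = 1)
    {χ : ℕ → G → ℂ} (hχ : IsCutoffSeq γ χ) (hS : IsSmooth γ (expPhase S))
    (h : IsOscData γ μ S P m₀) {ψ : G → ℂ} (hψ : ψ ∈ testFunctions γ ℂ) :
    ∫ g, expPhase S g * invOp γ P ((multiplier γ S P)⁻¹ • ψ) g ∂μ =
      ∫ g, expPhase S g * ψ g ∂μ := by
  have hm := h.adapted.1
  have hψ' : (multiplier γ S P)⁻¹ • ψ ∈ testFunctions γ ℂ :=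
    (hm.inv hγ).2.1.smul_testFunctions hψ
  obtain ⟨n, U, hU, hKU, hone⟩ := (hχ.eventually_one _ hψ.2).exists
  have hη := testFunctions.smul_isSmooth (hχ.mem_testFunctions n) hS
  have hsub : tsupport (invOp γ P ((multiplier γ S P)⁻¹ • ψ)) ⊆ tsupport ψ :=
    (tsupport_invOp_subset hγc _ P).trans (tsupport_mul_subset_right (f := (multiplier γ S P)⁻¹) (g := ψ))
  have hEq : Set.EqOn (χ n • expPhase S) (expPhase S) U := fun g hg => by
    simp [hone hg]
  have key := h.selfAdj _ hη _ hψ'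
  have e1 : ∀ g, invOp γ P (χ n • expPhase S) g * ((multiplier γ S P)⁻¹ • ψ) g =
      expPhase S g * ψ g := by
    intro g
    by_cases hg : g ∈ tsupport ψ
    · rw [invOp_eqOn hγc hU hEq P (hKU hg), invOp_expPhase]
      change multiplier γ S P g * expPhase S g * ((multiplier γ S P g)⁻¹ * ψ g) = _
      have h1 := mul_inv_cancel₀ (hm.1 g)
      linear_combination (expPhase S g * ψ g) * h1
    · rw [image_eq_zero_of_notMem_tsupport hg, mul_zero]
      change _ * ((multiplier γ S P g)⁻¹ * ψ g) = 0
      rw [image_eq_zero_of_notMem_tsupport hg, mul_zero, mul_zero]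
  have e2 : ∀ g, (χ n • expPhase S) g * invOp γ P ((multiplier γ S P)⁻¹ • ψ) g =
      expPhase S g * invOp γ P ((multiplier γ S P)⁻¹ • ψ) g := by
    intro g
    by_cases hg : g ∈ tsupport ψ
    · rw [hEq (hKU hg)]
    · rw [image_eq_zero_of_notMem_tsupport fun hh => hg (hsub hh)]
      simp
  simp only [e1, e2] at key
  exact key.symm

section Limit

variable [OpensMeasurableSpace G] [SecondCountableTopology G]

/-- The regularized integral of a scalar symbol is the limit of cut-off integrals; the limit
involves neither `P` nor `m₀`. -/
theorem IsOscData.tendsto_integral_cutoff (hγc : FrameContinuous γ) (hγ : ∀ i, γ i 0 = 1)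
    {χ : ℕ → G → ℂ} (hχ : IsCutoffSeq γ χ) (hS : IsSmooth γ (expPhase S))
    (h : IsOscData γ μ S P m₀) {B : G → ℂ} (hB : B ∈ scalarSymbols γ m₀) :
    Tendsto (fun n => ∫ g, expPhase S g * (χ n • B) g ∂μ) atTop
      (𝓝 (∫ g, expPhase S g * invOp γ P ((multiplier γ S P)⁻¹ • B) g ∂μ)) := by
  set D := (multiplier γ S P)⁻¹ • B with hD
  have hDs : D ∈ scalarSymbols γ ((multiplier γ S P)⁻¹ * m₀) :=
    scalarSymbols.smul (h.adapted.1.inv_mem hγ) hB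
  have e : ∀ n, ∫ g, expPhase S g * (χ n • B) g ∂μ =
      ∫ g, expPhase S g * invOp γ P (χ n • D) g ∂μ := by
    intro n
    rw [← h.integral_invOp_eq hγc hγ hχ hS
      (testFunctions.smul_isSmooth (hχ.mem_testFunctions n) hB.1), hD, smul_comm]
  simp only [e]
  choose c hc using hχ.bound
  choose d hd using (mem_scalarSymbols_iff.1 hDs).2
  have hsm : ∀ n, IsSmooth γ (χ n • D) := fun n => (hχ.mem_testFunctions n).1.smul hDs.1
  refine tendsto_integral_of_dominated_convergence
    (fun g => (∑ w ∈ P.support, |P w| * ((splits w).map fun s => c s.1 * d s.2).sum) *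
      (1 * ‖((multiplier γ S P)⁻¹ * m₀) g‖)) (fun n => ?_) ?_ (fun n => ?_) ?_
  · exact (hS.continuous.mul ((hsm n).invOp P).continuous).aestronglyMeasurable
  · simp only [one_mul]
    exact h.integrable_norm.const_mul _
  · refine Eventually.of_forall fun g => ?_
    rw [norm_mul, norm_expPhase, one_mul]
    exact seminorm_invOp_smul_le (normSeminorm ℂ ℂ) (hχ.mem_testFunctions n).1 hDs.1 P g
      (fun w => by simpa using hc w n g) fun w _ s _ => hd _ g
  · refine Eventually.of_forall fun g => tendsto_const_nhds.congr' ?_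
    filter_upwards [hχ.eventually_one {g} isCompact_singleton] with n hn
    obtain ⟨U, hU, hgU, hone⟩ := hn
    rw [invOp_eqOn hγc hU (F := χ n • D) (K := D) (fun x hx => by simp [hone hx]) P
      (hgU rfl)]

end Limit

section Existence

variable [OpensMeasurableSpace G] [SecondCountableTopology G] [IsFiniteMeasureOnCompacts μ]
variable {E : Type*} [AddCommGroup E] [Module ℂ E] [UniformSpace E]
  [IsUniformAddGroup E] [CompleteSpace E] [T2Space E] {p : ℕ → Seminorm ℂ E}

theorem integrable_seminorm_of_hasCompactSupport (hp : WithSeminorms p) {F : G → E}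
    (hc : Continuous F) (hF : HasCompactSupport F) (j : ℕ) :
    Integrable (fun g => p j (F g)) μ :=
  ((hp.continuous_seminorm j).comp hc).integrable_of_hasCompactSupport
    (hF.comp_left (map_zero (p j)))

theorem IsOscData.mem_symbolSpace_inv_smul (hp : WithSeminorms p) (h : IsOscData γ μ S P m₀)
    (hγ : ∀ i, γ i 0 = 1) {A : G → E}
    (hA : A ∈ symbolSpace γ p m₀) :
    (multiplier γ S P)⁻¹ • A ∈ symbolSpace γ p ((multiplier γ S P)⁻¹ * m₀) := by
  have := hp.continuousSMul
  exact scalarSymbols.smul (h.adapted.1.inv_mem hγ) hA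

theorem IsOscData.exists_integral (hp : WithSeminorms p) (h : IsOscData γ μ S P m₀)
    (hγ : ∀ i, γ i 0 = 1) (hS : IsSmooth γ (expPhase S))
    {A : G → E} (hA : A ∈ symbolSpace γ p m₀) :
    ∃ v, HasFrechetIntegral μ p
      (fun g => expPhase S g • invOp γ P ((multiplier γ S P)⁻¹ • A) g) v := by
  have := hp.continuousSMul
  have hB := IsOscData.mem_symbolSpace_inv_smul hp h hγ hA
  have hc : Continuous fun g => expPhase S g • invOp γ P ((multiplier γ S P)⁻¹ • A) g :=
    hS.continuous.smul (hB.1.invOp P).continuous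
  refine exists_hasFrechetIntegral hp μ hc fun j => ?_
  obtain ⟨C, hC⟩ := hB.2 P j
  refine (h.integrable_norm.const_mul C).mono'
    ((hp.continuous_seminorm j).comp hc).aestronglyMeasurable (Eventually.of_forall fun g => ?_)
  rw [Real.norm_of_nonneg (apply_nonneg _ _), map_smul_eq_mul, norm_expPhase, one_mul]
  exact hC g

/-- Pairing an oscillatory integral with a functional gives a limit of cut-off integrals. -/
theorem IsOscData.tendsto_dual (hp : WithSeminorms p) (h : IsOscData γ μ S P m₀)
    (hγc : FrameContinuous γ) (hγ : ∀ i, γ i 0 = 1)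
    {χ : ℕ → G → ℂ} (hχ : IsCutoffSeq γ χ) (hS : IsSmooth γ (expPhase S))
    {A : G → E} (hA : A ∈ symbolSpace γ p m₀) {v : E}
    (hv : HasFrechetIntegral μ p
      (fun g => expPhase S g • invOp γ P ((multiplier γ S P)⁻¹ • A) g) v) (φ : E →L[ℂ] ℂ) :
    Tendsto (fun n => ∫ g, expPhase S g * (χ n • fun g => φ (A g)) g ∂μ) atTop (𝓝 (φ v)) := by
  have := hp.continuousSMul
  have hB := IsOscData.mem_symbolSpace_inv_smul hp h hγ hA
  have := h.tendsto_integral_cutoff hγc hγ hχ hS (symbolSpace.map hp φ hA)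
  rw [hv.2.2 φ]
  convert this using 4 with g
  rw [map_smul, smul_eq_mul, ← hB.1.invOp_map φ]
  congr 2
  funext g
  simp

/-- The value of an oscillatory integral does not depend on the data. -/
theorem IsOscData.integral_unique (hp : WithSeminorms p) (h : IsOscData γ μ S P m₀)
    (hγc : FrameContinuous γ) (hγ : ∀ i, γ i 0 = 1)
    {χ : ℕ → G → ℂ} (hχ : IsCutoffSeq γ χ) (hS : IsSmooth γ (expPhase S))
    {P' : EnvElt ι} {m₀' : G → ℂ} (h' : IsOscData γ μ S P' m₀')
    {A : G → E} (hA : A ∈ symbolSpace γ p m₀) (hA' : A ∈ symbolSpace γ p m₀') {v v' : E}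
    (hv : HasFrechetIntegral μ p
      (fun g => expPhase S g • invOp γ P ((multiplier γ S P)⁻¹ • A) g) v)
    (hv' : HasFrechetIntegral μ p
      (fun g => expPhase S g • invOp γ P' ((multiplier γ S P')⁻¹ • A) g) v') : v = v' :=
  hp.eq_of_forall_dual fun φ => tendsto_nhds_unique
    (IsOscData.tendsto_dual hp h hγc hγ hχ hS hA hv φ)
    (IsOscData.tendsto_dual hp h' hγc hγ hχ hS hA' hv' φ)

/-- The oscillatory integral for admissible data exists. -/
theorem IsOscData.exists_isOscillatoryIntegral (hp : WithSeminorms p) (h : IsOscData γ μ S P m₀)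
    (hγc : FrameContinuous γ) (hγ : ∀ i, γ i 0 = 1)
    {χ : ℕ → G → ℂ} (hχ : IsCutoffSeq γ χ) (hS : IsSmooth γ (expPhase S)) :
    ∃ J : (G → E) → E, IsOscillatoryIntegral γ μ p S P m₀ J := by
  classical
  have := hp.continuousSMul
  choose! J hJ using fun (A : G → E) (hA : A ∈ symbolSpace γ p m₀) =>
    IsOscData.exists_integral hp h hγ hS hA
  have hsm : ∀ {A : G → E}, A ∈ symbolSpace γ p m₀ → IsSmooth γ ((multiplier γ S P)⁻¹ • A) :=
    fun hA => (IsOscData.mem_symbolSpace_inv_smul hp h hγ hA).1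
  refine ⟨J, ?_, ?_, ?_, ?_, fun A hA => hJ A hA⟩
  · intro A hA B hB
    refine (hJ _ (symbolSpace.add hA hB)).unique hp ?_
    convert (hJ A hA).add hp (hJ B hB) using 1
    funext g
    rw [smul_add, (hsm hA).invOp_add (hsm hB), Pi.add_apply, Pi.add_apply, smul_add]
  · intro c A hA
    refine (hJ _ (symbolSpace.const_smul hA c)).unique hp ?_
    convert (hJ A hA).const_smul hp c using 1
    funext g
    rw [smul_comm, (hsm hA).invOp_const_smul, Pi.smul_apply, Pi.smul_apply, smul_comm]
  · intro j
    choose c hc using (mem_scalarSymbols_iff.1 (h.adapted.1.inv_mem hγ)).2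
    set M := ∑ w ∈ P.support, |P w| * ((splits w).map fun s => c s.1 * (1 : ℝ)).sum
    refine ⟨P.support.biUnion fun w =>
      ((splits w).map fun s => (Finsupp.single s.2 (1 : ℝ), j)).toFinset,
      M * ∫ g, ‖((multiplier γ S P)⁻¹ * m₀) g‖ ∂μ, fun A hA R _ hR => ?_⟩
    refine ((hJ A hA).seminorm_le hp j).trans ?_
    have hb : ∀ g, p j (expPhase S g • invOp γ P ((multiplier γ S P)⁻¹ • A) g) ≤
        M * R * ‖((multiplier γ S P)⁻¹ * m₀) g‖ := by
      intro g
      rw [map_smul_eq_mul, norm_expPhase, one_mul]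
      refine (seminorm_invOp_smul_le (p j) (h.adapted.1.inv_mem hγ).1 hA.1 P g
        (c := c) (d := fun _ => 1) (x := ‖(multiplier γ S P)⁻¹ g‖) (y := R * ‖m₀ g‖)
        (fun w => hc w g) fun w hw s hs => ?_).trans_eq ?_
      · have := hR (Finsupp.single s.2 (1 : ℝ), j) (Finset.mem_biUnion.2 ⟨w, hw, by
          simp only [List.mem_toFinset, List.mem_map]
          exact ⟨s, hs, rfl⟩⟩) g
        simpa [invOp_single] using this
      · rw [Pi.mul_apply, norm_mul]
        ring
    refine (integral_mono_of_nonneg (Eventually.of_forall fun g => apply_nonneg _ _)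
      (h.integrable_norm.const_mul (M * R)) (Eventually.of_forall hb)).trans_eq ?_
    rw [integral_const_mul]
    ring
  · intro A hA
    have hAs := testFunctions.mem_symbolSpace hγc hp.continuous_seminorm hA
      h.weight.2.1.continuous h.weight.1
    have hc : Continuous fun g => expPhase S g • A g := hS.continuous.smul hA.1.continuous
    have hcs : HasCompactSupport fun g => expPhase S g • A g := hA.2.smul_left
    have hJA := hJ A hAs
    refine ⟨?_, integrable_seminorm_of_hasCompactSupport hp hc hcs, fun φ => ?_⟩
    · have : (uniformity E).IsCountablyGenerated := by
        have := hp.firstCountableTopology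
        exact IsUniformAddGroup.uniformity_countably_generated
      exact hc.aestronglyMeasurable
    · have hφ : (fun g => φ (A g)) ∈ testFunctions γ ℂ :=
        ⟨hA.1.map φ, hA.2.comp_left (map_zero φ)⟩
      have := h.integral_invOp_eq hγc hγ hχ hS hφ
      rw [hJA.2.2 φ]
      simp only [map_smul, smul_eq_mul]
      rw [← this]
      refine integral_congr_ae (Eventually.of_forall fun g => ?_)
      simp only [← (hsm hAs).invOp_map φ]
      congr 2
      funext g
      simp

end Existence

end Oscillatory

/-! ### The affine group: topology, measure and frame -/

namespace AffGroup

instance : SecondCountableTopology AffGroup := inferInstanceAs (SecondCountableTopology (ℝ × ℝ))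

instance : T2Space AffGroup := inferInstanceAs (T2Space (ℝ × ℝ))

instance : BorelSpace AffGroup := inferInstanceAs (BorelSpace (ℝ × ℝ))

instance : SigmaFinite (volume : Measure AffGroup) :=
  inferInstanceAs (SigmaFinite (volume : Measure (ℝ × ℝ)))

instance : IsFiniteMeasureOnCompacts (volume : Measure (AffGroup × AffGroup)) :=
  inferInstanceAs (IsFiniteMeasureOnCompacts (volume : Measure ((ℝ × ℝ) × (ℝ × ℝ))))

theorem continuous_a : Continuous a := (continuous_fst : Continuous (Prod.fst : ℝ × ℝ → ℝ))

theorem continuous_l : Continuous l := (continuous_snd : Continuous (Prod.snd : ℝ × ℝ → ℝ))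

theorem continuous_mk {X : Type*} [TopologicalSpace X] {f h : X → ℝ} (hf : Continuous f)
    (hh : Continuous h) : Continuous fun x => mk (f x) (h x) :=
  (hf.prodMk hh : Continuous fun x => ((f x, h x) : ℝ × ℝ))

instance : ContinuousMul AffGroup where
  continuous_mul := by
    have ha := continuous_a
    have hl := continuous_l
    simp only [mul_def]
    exact continuous_mk (by fun_prop) (by fun_prop)

theorem frame_zero (i : Gen) : frame i 0 = 1 := by cases i <;> rfl

theorem frame_add (i : Gen) (s t : ℝ) : frame i (s + t) = frame i s * frame i t := by
  cases i <;> ext <;> simp [frame, mul_def]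

theorem continuous_frame (i : Gen) : Continuous (frame i) := by
  cases i
  · exact continuous_mk continuous_id continuous_const
  · exact continuous_mk continuous_const continuous_id

theorem frame₂_zero (i : Gen ⊕ Gen) : frame₂ i 0 = 1 := by
  rcases i with i | i <;> simp [frame₂, frame_zero]

theorem frame₂_add (i : Gen ⊕ Gen) (s t : ℝ) : frame₂ i (s + t) = frame₂ i s * frame₂ i t := by
  rcases i with i | i <;> simp [frame₂, frame_add]

theorem continuous_frame₂ (i : Gen ⊕ Gen) : Continuous (frame₂ i) := by
  rcases i with i | i
  · exact (continuous_frame i).prodMk continuous_const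
  · exact continuous_const.prodMk (continuous_frame i)

theorem frameContinuous_frame₂ : FrameContinuous frame₂ := by
  intro i g
  have : Continuous fun t => g * frame₂ i t := continuous_const.mul (continuous_frame₂ i)
  simpa [frame₂_zero] using this.tendsto 0

/-- Differentiability along the frame holds along the whole integral curve. -/
theorem _root_.HasField.hasDerivAt_mul {F F' : AffGroup × AffGroup → ℂ} {i : Gen ⊕ Gen}
    (h : HasField frame₂ i F F') (g : AffGroup × AffGroup) (t : ℝ) :
    HasDerivAt (fun s => F (g * frame₂ i s)) (F' (g * frame₂ i t)) t := by
  have h0 := (hasField_iff_hasDerivAt (frame₂_zero i)).1 h (g * frame₂ i t)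
  have := HasDerivAt.comp_sub_const (x := t) (a := t)
    (f := fun s => F (g * frame₂ i t * frame₂ i s)) (by simpa using h0)
  have e : ∀ s, g * frame₂ i t * frame₂ i (s - t) = g * frame₂ i s := fun s => by
    rw [mul_assoc, ← frame₂_add, add_sub_cancel]
  simpa only [e] using this

/-- The coordinates `(a₁, ℓ₁, a₂, ℓ₂)` on `𝕊 × 𝕊`. -/
def coordHomeo : AffGroup × AffGroup ≃ₜ (ℝ × ℝ) × (ℝ × ℝ) := Homeomorph.refl ((ℝ × ℝ) × (ℝ × ℝ))

theorem coordHomeo_apply (x : AffGroup × AffGroup) :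
    coordHomeo x = ((x.1.a, x.1.l), (x.2.a, x.2.l)) := rfl

/-! ### Cutoff functions -/

/-- `ε` times the left-invariant field `X̃ᵢ` at the point `x`, as a function of `ε` and `y = ε x`. -/
def scaledField : Gen ⊕ Gen → ℝ × ((ℝ × ℝ) × (ℝ × ℝ)) → ℝ × ((ℝ × ℝ) × (ℝ × ℝ))
  | Sum.inl Gen.H => fun v => (0, ((v.1, -2 * v.2.1.2), (0, 0)))
  | Sum.inl Gen.E => fun v => (0, ((0, v.1), (0, 0)))
  | Sum.inr Gen.H => fun v => (0, ((0, 0), (v.1, -2 * v.2.2.2)))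
  | Sum.inr Gen.E => fun v => (0, ((0, 0), (0, v.1)))

theorem contDiff_scaledField (i : Gen ⊕ Gen) : ContDiff ℝ ∞ (scaledField i) := by
  rcases i with (i | i) <;> cases i <;> simp only [scaledField] <;> fun_prop

theorem hasField_scaled {f : ℝ × ((ℝ × ℝ) × (ℝ × ℝ)) → ℂ} (hf : ContDiff ℝ ∞ f) (ε : ℝ)
    (i : Gen ⊕ Gen) :
    HasField frame₂ i (fun x => f (ε, ε • coordHomeo x))
      (fun x => fderiv ℝ f (ε, ε • coordHomeo x) (scaledField i (ε, ε • coordHomeo x))) := by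
  rw [hasField_iff_hasDerivAt (frame₂_zero i)]
  intro x
  have hd : DifferentiableAt ℝ f (ε, ε • coordHomeo (x * frame₂ i 0)) :=
    (hf.differentiable (by simp)).differentiableAt
  have hpath : HasDerivAt (fun t => ((ε, ε • coordHomeo (x * frame₂ i t)) :
      ℝ × ((ℝ × ℝ) × (ℝ × ℝ)))) (scaledField i (ε, ε • coordHomeo x)) 0 := by
    have hexp : ∀ c : ℝ, HasDerivAt (fun t : ℝ => ε * (Real.exp (-2 * t) * c))
        (-2 * (ε * c)) 0 := by
      intro c
      have h1 : HasDerivAt (fun t : ℝ => Real.exp (-2 * t)) (-2) 0 := by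
        have := ((hasDerivAt_id (0 : ℝ)).const_mul (-2)).exp
        simpa using this
      exact ((h1.mul_const c).const_mul ε).congr_deriv (by ring)
    have hlin : ∀ c : ℝ, HasDerivAt (fun t : ℝ => ε * (c + t)) ε 0 := by
      intro c
      exact (((hasDerivAt_id (0 : ℝ)).const_add c).const_mul ε).congr_deriv (by simp)
    rcases i with (i | i) <;> cases i <;>
      simp only [coordHomeo_apply, frame₂, frame, scaledField, Prod.fst_mul, Prod.snd_mul, mul_one,
        mul_def, a_mk, l_mk, Prod.smul_mk, smul_eq_mul, add_zero, mul_zero, Real.exp_zero, one_mul]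
    · exact (hasDerivAt_const _ _).prodMk (((hlin _).prodMk (hexp _)).prodMk (hasDerivAt_const _ _))
    · exact (hasDerivAt_const _ _).prodMk
        (((hasDerivAt_const _ _).prodMk (hlin _)).prodMk (hasDerivAt_const _ _))
    · exact (hasDerivAt_const _ _).prodMk ((hasDerivAt_const _ _).prodMk ((hlin _).prodMk (hexp _)))
    · exact (hasDerivAt_const _ _).prodMk
        ((hasDerivAt_const _ _).prodMk ((hasDerivAt_const _ _).prodMk (hlin _)))
  have := hd.hasFDerivAt.comp_hasDerivAt (0 : ℝ) hpath
  simpa [frame₂_zero, Function.comp_def] using this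

/-- The affine group has cutoff functions: rescalings `x ↦ f (ε, ε x)` of a bump function, whose
derivatives along the frame are functions of the same form. -/
theorem exists_isCutoffSeq : ∃ χ : ℕ → AffGroup × AffGroup → ℂ, IsCutoffSeq frame₂ χ := by
  let bump : ContDiffBump (0 : ℝ × ((ℝ × ℝ) × (ℝ × ℝ))) := ⟨1, 2, one_pos, one_lt_two⟩
  let ε : ℕ → ℝ := fun n => 1 / ((n : ℝ) + 1)
  have hε : ∀ n, 0 < ε n := fun n => by positivity
  have hε0 : Tendsto ε atTop (𝓝 0) := tendsto_one_div_add_atTop_nhds_zero_nat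
  let 𝒦 : Set (ℕ → AffGroup × AffGroup → ℂ) := {F | ∃ f : ℝ × ((ℝ × ℝ) × (ℝ × ℝ)) → ℂ,
    ContDiff ℝ ∞ f ∧ HasCompactSupport f ∧ F = fun n x => f (ε n, ε n • coordHomeo x)}
  have hd : ∀ F ∈ 𝒦, ∀ i, ∃ F' ∈ 𝒦, ∀ n, HasField frame₂ i (F n) (F' n) := by
    rintro _ ⟨f, hf, hfc, rfl⟩ i
    refine ⟨_, ⟨fun v => fderiv ℝ f v (scaledField i v), ?_, ?_, rfl⟩,
      fun n => hasField_scaled hf (ε n) i⟩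
    · exact (hf.fderiv_right (m := ∞) (by simp)).clm_apply (contDiff_scaledField i)
    · refine (hfc.fderiv (𝕜 := ℝ)).mono fun v hv => ?_
      contrapose! hv
      simp only [Function.mem_support, not_not] at hv ⊢
      simp [hv]
  have hb : ∀ F ∈ 𝒦, ∃ C : ℝ, ∀ n g, ‖F n g‖ ≤ C := by
    rintro _ ⟨f, hf, hfc, rfl⟩
    obtain ⟨C, hC⟩ := hfc.exists_bound_of_continuous hf.continuous
    exact ⟨C, fun n g => hC _⟩
  let f₀ : ℝ × ((ℝ × ℝ) × (ℝ × ℝ)) → ℂ := fun v => (bump v : ℂ)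
  have hf₀ : ContDiff ℝ ∞ f₀ := Complex.ofRealCLM.contDiff.comp bump.contDiff
  have hf₀c : HasCompactSupport f₀ := bump.hasCompactSupport.comp_left Complex.ofReal_zero
  have hmem : (fun n x => f₀ (ε n, ε n • coordHomeo x)) ∈ 𝒦 := ⟨f₀, hf₀, hf₀c, rfl⟩
  refine ⟨fun n x => f₀ (ε n, ε n • coordHomeo x), fun n => ⟨?_, ?_⟩, fun w => ?_,
    fun K hK => ?_⟩
  · refine isSmooth_of_closed {F | ∃ Φ ∈ 𝒦, F = Φ n} ?_ ?_ ⟨_, hmem, rfl⟩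
    · rintro _ ⟨_, ⟨f, hf, -, rfl⟩, rfl⟩
      exact hf.continuous.comp (continuous_const.prodMk ((continuous_const_smul _).comp coordHomeo.continuous))
    · rintro _ ⟨Φ, hΦ, rfl⟩ i
      obtain ⟨Φ', hΦ', h⟩ := hd Φ hΦ i
      exact ⟨_, ⟨Φ', hΦ', rfl⟩, h n⟩
  · have hemb : IsClosedEmbedding fun x : AffGroup × AffGroup =>
        ((ε n, ε n • coordHomeo x) : ℝ × ((ℝ × ℝ) × (ℝ × ℝ))) := by
      have h1 : IsClosedEmbedding fun y : (ℝ × ℝ) × (ℝ × ℝ) => ε n • y :=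
        (Homeomorph.smulOfNeZero (ε n) (hε n).ne').isClosedEmbedding
      have h2 : IsClosedEmbedding fun y : (ℝ × ℝ) × (ℝ × ℝ) => ((ε n, y) : ℝ × _) :=
        Function.LeftInverse.isClosedEmbedding (f := Prod.snd) (fun _ => rfl) continuous_snd
          (continuous_const.prodMk continuous_id)
      exact (h2.comp h1).comp coordHomeo.isClosedEmbedding
    exact hf₀c.comp_isClosedEmbedding hemb
  · obtain ⟨F', hF', h⟩ := exists_wordField_eq_of_closed 𝒦 hd w _ hmem
    obtain ⟨C, hC⟩ := hb F' hF'
    exact ⟨C, fun n g => by rw [h n]; exact hC n g⟩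
  · obtain ⟨R, hR⟩ := (hK.image coordHomeo.continuous).isBounded.exists_norm_le
    have hlt : ∀ᶠ n in atTop, ε n < 1 / (|R| + 1) := hε0.eventually (gt_mem_nhds (by positivity))
    filter_upwards [hlt] with n hn
    refine ⟨{x | ‖coordHomeo x‖ < |R| + 1}, isOpen_lt coordHomeo.continuous.norm continuous_const,
      fun x hx => ?_, fun x hx => ?_⟩
    · have := hR _ ⟨x, hx, rfl⟩
      exact (this.trans (le_abs_self R)).trans_lt (lt_add_one _)
    · have h1 : ε n * (|R| + 1) < 1 := by rwa [lt_div_iff₀ (by positivity)] at hn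
      have h2 : (ε n, ε n • coordHomeo x) ∈ Metric.closedBall
          (0 : ℝ × ((ℝ × ℝ) × (ℝ × ℝ))) 1 := by
        rw [mem_closedBall_zero_iff, Prod.norm_mk, norm_smul, Real.norm_of_nonneg (hε n).le]
        have h3 : ε n * ‖coordHomeo x‖ ≤ ε n * (|R| + 1) :=
          mul_le_mul_of_nonneg_left (le_of_lt hx) (hε n).le
        have h4 : ε n * 1 ≤ ε n * (|R| + 1) :=
          mul_le_mul_of_nonneg_left (by linarith [abs_nonneg R]) (hε n).le
        exact max_le (by linarith) (by linarith)
      simp only [f₀, bump.one_of_mem_closedBall h2, Complex.ofReal_one, Pi.one_apply]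

/-! ### Integration by parts -/

/-- The modular factor of right translation by `exp (t Xᵢ)`. -/
def modular : Gen → ℝ → ℝ
  | Gen.H, t => Real.exp (2 * t)
  | Gen.E, _ => 1

theorem map_mul_frame (i : Gen) (t : ℝ) :
    (volume : Measure AffGroup).map (· * frame i t) = ENNReal.ofReal (modular i t) • volume := by
  have key : ∀ c d s : ℝ, 0 < d →
      (volume : Measure (ℝ × ℝ)).map (Prod.map (· + c) (fun l => d * l + s)) =
      ENNReal.ofReal d⁻¹ • volume := by
    intro c d s hd
    have e : (fun l : ℝ => d * l + s) = (· + s) ∘ (d * ·) := rfl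
    rw [Measure.volume_eq_prod, ← Measure.map_prod_map _ _ (by fun_prop) (by fun_prop), e,
      ← Measure.map_map (by fun_prop) (by fun_prop), Real.map_volume_mul_left hd.ne',
      Measure.map_smul, map_add_right_eq_self, map_add_right_eq_self, Measure.prod_smul_right,
      abs_of_pos (inv_pos.2 hd)]
  cases i
  · have := key t (Real.exp (-2 * t)) 0 (Real.exp_pos _)
    rw [← Real.exp_neg, show -(-2 * t) = 2 * t by ring] at this
    exact this
  · have := key 0 (Real.exp (-2 * 0)) t (Real.exp_pos _)
    rw [← Real.exp_neg, show -(-2 * (0 : ℝ)) = 0 by ring, Real.exp_zero] at this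
    exact this

/-- The derivative at `0` of the modular factor. -/
def divergence : Gen ⊕ Gen → ℂ
  | Sum.inl Gen.H => 2
  | Sum.inl Gen.E => 0
  | Sum.inr Gen.H => 2
  | Sum.inr Gen.E => 0

theorem map_mul_frame₂ (i : Gen ⊕ Gen) (t : ℝ) :
    (volume : Measure (AffGroup × AffGroup)).map (· * frame₂ i t) =
      ENNReal.ofReal (modular (i.elim id id) t) • volume := by
  have hm : ∀ i, Measurable (· * frame i t) := fun i => (continuous_mul_const (frame i t)).measurable
  rcases i with i | i
  · have e : (fun x : AffGroup × AffGroup => x * frame₂ (Sum.inl i) t) =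
        Prod.map (· * frame i t) id := by
      funext x
      simp [frame₂, Prod.ext_iff]
    rw [e, Measure.volume_eq_prod, ← Measure.map_prod_map _ _ (hm i) measurable_id, map_mul_frame,
      Measure.map_id, Measure.prod_smul_left]
    rfl
  · have e : (fun x : AffGroup × AffGroup => x * frame₂ (Sum.inr i) t) =
        Prod.map id (· * frame i t) := by
      funext x
      simp [frame₂, Prod.ext_iff]
    rw [e, Measure.volume_eq_prod, ← Measure.map_prod_map _ _ measurable_id (hm i), map_mul_frame,
      Measure.map_id, Measure.prod_smul_right]
    rfl

theorem integral_mul_frame₂ (i : Gen ⊕ Gen) (t : ℝ) {F : AffGroup × AffGroup → ℂ}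
    (hF : Continuous F) :
    ∫ x, F (x * frame₂ i t) = (modular (i.elim id id) t : ℂ) * ∫ x, F x := by
  have h := integral_map (μ := (volume : Measure (AffGroup × AffGroup)))
    (φ := fun x => x * frame₂ i t) (continuous_mul_const (frame₂ i t)).measurable.aemeasurable
    (f := F) hF.aestronglyMeasurable
  rw [map_mul_frame₂, integral_smul_measure] at h
  rw [← h, ENNReal.toReal_ofReal, Complex.real_smul]
  cases (i.elim id id) <;> simp only [modular] <;> positivity

theorem hasDerivAt_modular (i : Gen ⊕ Gen) :
    HasDerivAt (fun t => (modular (i.elim id id) t : ℂ)) (divergence i) 0 := by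
  have h : HasDerivAt (fun t : ℝ => ((Real.exp (2 * t) : ℝ) : ℂ)) 2 0 := by
    have := (((hasDerivAt_id (0 : ℝ)).const_mul 2).exp).ofReal_comp
    simpa using this
  rcases i with (i | i) <;> cases i
  · exact h
  · simpa [modular] using! hasDerivAt_const (0 : ℝ) (1 : ℂ)
  · exact h
  · simpa [modular] using! hasDerivAt_const (0 : ℝ) (1 : ℂ)

/-- The divergence theorem for the left-invariant fields and the left Haar measure: the derivative
at `t = 0` of `∫ F (x exp (t Xᵢ)) = modular t * ∫ F`. -/
theorem integral_leftField {F : AffGroup × AffGroup → ℂ} (hF : F ∈ testFunctions frame₂ ℂ)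
    (i : Gen ⊕ Gen) : ∫ x, leftField frame₂ i F x = divergence i * ∫ x, F x := by
  have hF' := testFunctions.wordField frameContinuous_frame₂ hF [i]
  change leftField frame₂ i F ∈ _ at hF'
  obtain ⟨C, hC⟩ := hF'.2.exists_bound_of_continuous hF'.1.continuous
  have hC0 : 0 ≤ C := (norm_nonneg _).trans (hC 1)
  let K : Set (AffGroup × AffGroup) :=
    (fun q : (AffGroup × AffGroup) × ℝ => q.1 * frame₂ i (-q.2)) ''
      (tsupport (leftField frame₂ i F) ×ˢ Metric.closedBall 0 1)
  have hK : IsCompact K := by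
    refine (hF'.2.isCompact.prod (isCompact_closedBall 0 1)).image ?_
    exact continuous_fst.mul ((continuous_frame₂ i).comp continuous_snd.neg)
  have hcont : ∀ t, Continuous fun x => F (x * frame₂ i t) := fun t =>
    hF.1.continuous.comp (continuous_mul_const _)
  have h := hasDerivAt_integral_of_dominated_loc_of_deriv_le (μ := volume)
    (F := fun t x => F (x * frame₂ i t)) (F' := fun t x => leftField frame₂ i F (x * frame₂ i t))
    (x₀ := (0 : ℝ)) (s := Metric.ball 0 1) (bound := K.indicator fun _ => C)
    (Metric.ball_mem_nhds _ one_pos)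
    (Eventually.of_forall fun t => (hcont t).aestronglyMeasurable)
    (by simpa [frame₂_zero] using hF.1.continuous.integrable_of_hasCompactSupport hF.2)
    (hF'.1.continuous.comp (continuous_mul_const _)).aestronglyMeasurable
    (Eventually.of_forall fun x t ht => ?_) ?_
    (Eventually.of_forall fun x t _ => (hF.1.hasField i).hasDerivAt_mul x t)
  · have h2 := h.2
    simp only [frame₂_zero, mul_one, integral_mul_frame₂ i _ hF.1.continuous] at h2
    exact h2.unique ((hasDerivAt_modular i).mul_const _)
  · by_cases hx : x ∈ K
    · rw [Set.indicator_of_mem hx]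
      exact hC _
    · rw [Set.indicator_of_notMem hx, norm_le_zero_iff]
      refine image_eq_zero_of_notMem_tsupport fun hx' => hx ⟨(x * frame₂ i t, t), ⟨hx', Metric.ball_subset_closedBall ht⟩, ?_⟩
      simp only [mul_assoc, ← frame₂_add, add_neg_cancel, frame₂_zero, mul_one]
  · exact (integrable_indicator_iff hK.measurableSet).2 (integrableOn_const hK.measure_lt_top.ne)

/-! ### The algebra of smooth functions and invariant operators on it -/

/-- The algebra of smooth complex functions on `𝕊 × 𝕊`. -/
def smoothFns : Subalgebra ℂ (AffGroup × AffGroup → ℂ) where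
  carrier := {f | IsSmooth frame₂ f}
  mul_mem' hf hg := hf.mul hg
  add_mem' hf hg := hf.add hg
  algebraMap_mem' c := isSmooth_const c

/-- Smooth complex functions on `𝕊 × 𝕊`. -/
def SmoothFn : Type := smoothFns

namespace SmoothFn

instance : CommRing SmoothFn := inferInstanceAs (CommRing smoothFns)

instance : Algebra ℂ SmoothFn := inferInstanceAs (Algebra ℂ smoothFns)

@[ext] theorem ext {f g : SmoothFn} (h : ∀ x, f.1 x = g.1 x) : f = g := Subtype.ext (funext h)

@[simp] theorem add_apply (f g : SmoothFn) (x : AffGroup × AffGroup) :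
    (f + g).1 x = f.1 x + g.1 x := rfl

@[simp] theorem sub_apply (f g : SmoothFn) (x : AffGroup × AffGroup) :
    (f - g).1 x = f.1 x - g.1 x := rfl

@[simp] theorem mul_apply (f g : SmoothFn) (x : AffGroup × AffGroup) :
    (f * g).1 x = f.1 x * g.1 x := rfl

@[simp] theorem smul_apply (c : ℂ) (f : SmoothFn) (x : AffGroup × AffGroup) :
    (c • f).1 x = c * f.1 x := rfl

@[simp] theorem neg_apply (f : SmoothFn) (x : AffGroup × AffGroup) : (-f).1 x = -f.1 x := rfl

@[simp] theorem zero_apply (x : AffGroup × AffGroup) : (0 : SmoothFn).1 x = 0 := rfl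

@[simp] theorem one_apply (x : AffGroup × AffGroup) : (1 : SmoothFn).1 x = 1 := rfl

@[simp] theorem pow_apply (f : SmoothFn) (n : ℕ) (x : AffGroup × AffGroup) :
    (f ^ n).1 x = f.1 x ^ n := by
  induction n with
  | zero => simp
  | succ n ih => simp [pow_succ, ih]

end SmoothFn

/-- The left-invariant field `X̃ᵢ` as a linear operator on smooth functions. -/
def field (i : Gen ⊕ Gen) : Module.End ℂ SmoothFn where
  toFun f := ⟨leftField frame₂ i f.1, f.2.leftField i⟩
  map_add' f g := SmoothFn.ext fun x =>
    congrFun ((f.2.hasField i).add (g.2.hasField i)).leftField_eq x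
  map_smul' c f := SmoothFn.ext fun x => congrFun ((f.2.hasField i).const_smul c).leftField_eq x

theorem coe_field (i : Gen ⊕ Gen) (f : SmoothFn) : (field i f).1 = leftField frame₂ i f.1 := rfl

theorem field_mul (i : Gen ⊕ Gen) (f g : SmoothFn) :
    field i (f * g) = field i f * g + f * field i g :=
  SmoothFn.ext fun x => congrFun ((f.2.hasField i).mul (g.2.hasField i)).leftField_eq x

theorem field_eq {i : Gen ⊕ Gen} {f g : SmoothFn} (h : HasField frame₂ i f.1 g.1) :
    field i f = g :=
  SmoothFn.ext fun x => congrFun h.leftField_eq x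

theorem hasField_field (i : Gen ⊕ Gen) (f : SmoothFn) : HasField frame₂ i f.1 (field i f).1 :=
  f.2.hasField i

/-- The operator `D` on smooth functions is `P̃` for some `P ∈ 𝒰(𝔤)`. -/
def IsInvOp (D : Module.End ℂ SmoothFn) : Prop :=
  ∃ P : EnvElt (Gen ⊕ Gen), ∀ f : SmoothFn,
    invOp frame₂ P f.1 = (D f).1

theorem isInvOp_one : IsInvOp 1 :=
  ⟨Finsupp.single [] 1, fun f => by simp [invOp_single, wordField]⟩

theorem isInvOp_field (i : Gen ⊕ Gen) : IsInvOp (field i) :=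
  ⟨Finsupp.single [i] 1, fun f => by simp [invOp_single, wordField, coe_field]⟩

theorem IsInvOp.add {D D' : Module.End ℂ SmoothFn} (h : IsInvOp D) (h' : IsInvOp D') :
    IsInvOp (D + D') := by
  obtain ⟨P, hP⟩ := h
  obtain ⟨P', hP'⟩ := h'
  exact ⟨P + P', fun f => by rw [invOp_add, hP, hP']; rfl⟩

theorem IsInvOp.smul {D : Module.End ℂ SmoothFn} (h : IsInvOp D) (c : ℝ) :
    IsInvOp ((c : ℂ) • D) := by
  obtain ⟨P, hP⟩ := h
  refine ⟨c • P, fun f => ?_⟩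
  have : (((c : ℂ) • D) f).1 = (c : ℂ) • (D f).1 := rfl
  rw [this, ← hP]
  funext g
  simp only [invOp, Pi.smul_apply]
  rw [Finsupp.sum_smul_index' (by simp), Finsupp.smul_sum]
  simp [mul_assoc]

theorem IsInvOp.mul {D D' : Module.End ℂ SmoothFn} (h : IsInvOp D) (h' : IsInvOp D') :
    IsInvOp (D * D') := by
  obtain ⟨P, hP⟩ := h
  obtain ⟨P', hP'⟩ := h'
  suffices ∃ Q : EnvElt (Gen ⊕ Gen), ∀ f : SmoothFn,
      invOp frame₂ Q f.1 =
        invOp frame₂ P (invOp frame₂ P' f.1) by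
    obtain ⟨Q, hQ⟩ := this
    exact ⟨Q, fun f => by rw [hQ, hP', hP]; rfl⟩
  clear hP hP'
  induction P using Finsupp.induction_linear with
  | zero => exact ⟨0, fun f => by funext g; simp [invOp]⟩
  | add P₁ P₂ h₁ h₂ =>
    obtain ⟨Q₁, h₁⟩ := h₁
    obtain ⟨Q₂, h₂⟩ := h₂
    exact ⟨Q₁ + Q₂, fun f => by rw [invOp_add, invOp_add, h₁, h₂]⟩
  | single w c =>
    induction P' using Finsupp.induction_linear with
    | zero =>
      refine ⟨0, fun f => ?_⟩
      have e : ∀ F : AffGroup × AffGroup → ℂ, invOp frame₂ 0 F = 0 := fun F => by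
        funext g; simp [invOp]
      rw [e f.1]
      rw [invOp_single, wordField_zero, smul_zero]
    | add P₁ P₂ h₁ h₂ =>
      obtain ⟨Q₁, h₁⟩ := h₁
      obtain ⟨Q₂, h₂⟩ := h₂
      refine ⟨Q₁ + Q₂, fun f => ?_⟩
      rw [invOp_add, invOp_add, h₁, h₂, (f.2.invOp P₁).invOp_add (f.2.invOp P₂)]
    | single w' c' =>
      refine ⟨Finsupp.single (w ++ w') (c * c'), fun f => ?_⟩
      rw [invOp_single, invOp_single, invOp_single, (f.2.wordField w').wordField_const_smul,
        wordField_append, smul_smul, Complex.ofReal_mul]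

theorem IsInvOp.pow {D : Module.End ℂ SmoothFn} (h : IsInvOp D) (n : ℕ) : IsInvOp (D ^ n) := by
  induction n with
  | zero => exact isInvOp_one
  | succ n ih => rw [pow_succ]; exact ih.mul h

theorem IsInvOp.neg {D : Module.End ℂ SmoothFn} (h : IsInvOp D) : IsInvOp (-D) := by
  have e : (((-1 : ℝ) : ℂ) • D) = -D := by ext; simp
  exact e ▸ h.smul (-1)

theorem IsInvOp.sub {D D' : Module.End ℂ SmoothFn} (h : IsInvOp D) (h' : IsInvOp D') :
    IsInvOp (D - D') := by
  rw [sub_eq_add_neg]; exact h.add h'.neg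

/-- `D` and `D'` preserve compact supports and are transposes of each other for the bilinear pairing
`∫ φ ψ`. -/
structure IsTranspose (D D' : Module.End ℂ SmoothFn) : Prop where
  left : ∀ f : SmoothFn, HasCompactSupport f.1 →
    HasCompactSupport (D f).1
  right : ∀ f : SmoothFn, HasCompactSupport f.1 →
    HasCompactSupport (D' f).1
  eq : ∀ f g : SmoothFn, HasCompactSupport f.1 →
    HasCompactSupport g.1 →
    ∫ x, (D f).1 x * g.1 x =
      ∫ x, f.1 x * (D' g).1 x

theorem integrable_mul_of_hasCompactSupport (f g : SmoothFn)
    (hf : HasCompactSupport f.1) :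
    Integrable (fun x => f.1 x * g.1 x)
      volume :=
  (f.2.continuous.mul g.2.continuous).integrable_of_hasCompactSupport hf.mul_right

theorem IsTranspose.mul {D₁ D₁' D₂ D₂' : Module.End ℂ SmoothFn} (h₁ : IsTranspose D₁ D₁')
    (h₂ : IsTranspose D₂ D₂') : IsTranspose (D₁ * D₂) (D₂' * D₁') :=
  ⟨fun f hf => h₁.left _ (h₂.left f hf), fun f hf => h₂.right _ (h₁.right f hf),
    fun f g hf hg => (h₁.eq (D₂ f) g (h₂.left f hf) hg).trans (h₂.eq f (D₁' g) hf (h₁.right g hg))⟩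

theorem IsTranspose.add {D₁ D₁' D₂ D₂' : Module.End ℂ SmoothFn} (h₁ : IsTranspose D₁ D₁')
    (h₂ : IsTranspose D₂ D₂') : IsTranspose (D₁ + D₂) (D₁' + D₂') := by
  refine ⟨fun f hf => (h₁.left f hf).add (h₂.left f hf),
    fun f hf => (h₁.right f hf).add (h₂.right f hf), fun f g hf hg => ?_⟩
  have e1 := integral_add (integrable_mul_of_hasCompactSupport (D₁ f) g (h₁.left f hf))
    (integrable_mul_of_hasCompactSupport (D₂ f) g (h₂.left f hf))
  have e2 := integral_add (integrable_mul_of_hasCompactSupport f (D₁' g) hf)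
    (integrable_mul_of_hasCompactSupport f (D₂' g) hf)
  rw [h₁.eq f g hf hg, h₂.eq f g hf hg, ← e2] at e1
  simp only [← add_mul, ← mul_add] at e1
  exact e1

theorem IsTranspose.smul {D D' : Module.End ℂ SmoothFn} (h : IsTranspose D D') (c : ℂ) :
    IsTranspose (c • D) (c • D') := by
  refine ⟨fun f hf => (h.left f hf).smul_left (f := fun _ => c),
    fun f hf => (h.right f hf).smul_left (f := fun _ => c), fun f g hf hg => ?_⟩
  have e := congrArg (c * ·) (h.eq f g hf hg)
  simp only [← integral_const_mul] at e
  refine (integral_congr_ae (Eventually.of_forall fun x => ?_)).trans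
    (e.trans (integral_congr_ae (Eventually.of_forall fun x => ?_)))
  · exact mul_assoc c _ _
  · exact mul_left_comm c _ _

theorem isTranspose_one : IsTranspose 1 1 :=
  ⟨fun _ h => h, fun _ h => h, fun _ _ _ _ => rfl⟩

theorem IsTranspose.neg {D D' : Module.End ℂ SmoothFn} (h : IsTranspose D D') :
    IsTranspose (-D) (-D') := by
  have e : ∀ D : Module.End ℂ SmoothFn, ((-1 : ℂ) • D) = -D := fun D => by ext; simp
  simpa only [e] using h.smul (-1)

theorem IsTranspose.sub {D₁ D₁' D₂ D₂' : Module.End ℂ SmoothFn} (h₁ : IsTranspose D₁ D₁')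
    (h₂ : IsTranspose D₂ D₂') : IsTranspose (D₁ - D₂) (D₁' - D₂') := by
  rw [sub_eq_add_neg, sub_eq_add_neg]; exact h₁.add h₂.neg

theorem IsTranspose.pow {D : Module.End ℂ SmoothFn} (h : IsTranspose D D) (n : ℕ) :
    IsTranspose (D ^ n) (D ^ n) := by
  induction n with
  | zero => exact isTranspose_one
  | succ n ih =>
    have := ih.mul h
    rwa [← pow_succ, ← pow_succ'] at this

theorem hasCompactSupport_field (i : Gen ⊕ Gen) (f : SmoothFn)
    (hf : HasCompactSupport f.1) :
    HasCompactSupport (field i f).1 := by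
  exact (testFunctions.wordField frameContinuous_frame₂ (⟨f.2, hf⟩ : f.1 ∈ testFunctions frame₂ ℂ) [i]).2

/-- Integration by parts. The divergence appears because left Haar measure is not invariant under
right translations. -/
theorem isTranspose_field (i : Gen ⊕ Gen) :
    IsTranspose (field i) (divergence i • 1 - field i) := by
  have hr : ∀ f : SmoothFn, HasCompactSupport f.1 →
      HasCompactSupport ((divergence i • 1 - field i : Module.End ℂ SmoothFn) f).1 := fun f hf =>
    (hf.smul_left (f := fun _ => divergence i)).sub (hasCompactSupport_field i f hf)
  refine ⟨hasCompactSupport_field i, hr, fun f g hf hg => ?_⟩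
  have h := integral_leftField (F := (f * g : SmoothFn).1) ⟨(f * g).2, hf.mul_right⟩ i
  rw [← coe_field, field_mul] at h
  have e : ∀ x, (field i f * g + f * field i g : SmoothFn).1 x =
      (field i f).1 x * g.1 x + f.1 x * (field i g).1 x := fun x => rfl
  simp only [e] at h
  rw [integral_add (integrable_mul_of_hasCompactSupport _ g (hasCompactSupport_field i f hf))
    (integrable_mul_of_hasCompactSupport f _ hf)] at h
  have e2 : ∀ x, f.1 x * ((divergence i • 1 - field i : Module.End ℂ SmoothFn) g).1 x =
      divergence i * (f * g : SmoothFn).1 x - f.1 x * (field i g).1 x := fun x => by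
    have e3 : ((divergence i • 1 - field i : Module.End ℂ SmoothFn) g).1 x =
      divergence i * g.1 x - (field i g).1 x := rfl
    have e4 : (f * g : SmoothFn).1 x = f.1 x * g.1 x := rfl
    rw [e3, e4]
    ring
  have e5 := integral_sub ((integrable_mul_of_hasCompactSupport f g hf).const_mul (divergence i))
    (integrable_mul_of_hasCompactSupport f (field i g) hf)
  rw [integral_const_mul] at e5
  refine Eq.trans ?_ (e5.symm.trans (integral_congr_ae (Eventually.of_forall fun x => (e2 x).symm)))
  exact (eq_sub_of_add_eq h)

theorem IsTranspose.isSelfAdj {D : Module.End ℂ SmoothFn} (h : IsTranspose D D)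
    {P : EnvElt (Gen ⊕ Gen)} (hP : ∀ f : SmoothFn,
      invOp frame₂ P f.1 = (D f).1) :
    IsSelfAdj frame₂ volume P := by
  intro φ hφ ψ hψ
  rw [show invOp frame₂ P φ = _ from hP ⟨φ, hφ.1⟩, show invOp frame₂ P ψ = _ from hP ⟨ψ, hψ.1⟩]
  exact h.eq ⟨φ, hφ.1⟩ ⟨ψ, hψ.1⟩ hφ.2 hψ.2

/-! ### The operators `T` and `R` -/

theorem end_neg_mul_neg (D D' : Module.End ℂ SmoothFn) : -D * -D' = D * D' := by
  ext; simp

/-- The operator `H₁ - H₂`, for a family `D` of operators in place of the left-invariant fields. -/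
def opX (D : Gen ⊕ Gen → Module.End ℂ SmoothFn) : Module.End ℂ SmoothFn :=
  D (Sum.inl Gen.H) - D (Sum.inr Gen.H)

/-- The operator `H₁ + H₂ - 2`. For the left-invariant fields it is skew-symmetric: the shift
compensates the divergence of `H₁ + H₂`. -/
def opY (D : Gen ⊕ Gen → Module.End ℂ SmoothFn) : Module.End ℂ SmoothFn :=
  D (Sum.inl Gen.H) + D (Sum.inr Gen.H) - ((2 : ℝ) : ℂ) • 1

/-- The operator `1 - θ² Eᵢ²`, for `E₁` or `E₂`. -/
def opE (D : Gen ⊕ Gen → Module.End ℂ SmoothFn) (θ : ℝ) (i : Gen ⊕ Gen) : Module.End ℂ SmoothFn :=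
  1 - ((θ ^ 2 : ℝ) : ℂ) • (D i * D i)

/-- The operator `(1 - θ² E₁²) (1 - θ² E₂²)² (1 - θ² E₁²)`. -/
def opR (D : Gen ⊕ Gen → Module.End ℂ SmoothFn) (θ : ℝ) : Module.End ℂ SmoothFn :=
  opE D θ (Sum.inl Gen.E) * opE D θ (Sum.inr Gen.E) *
    (opE D θ (Sum.inr Gen.E) * opE D θ (Sum.inl Gen.E))

/-- The operator `-(H₁ - H₂)² - (H₁ + H₂ - 2) R (H₁ + H₂ - 2)`. -/
def opT (D : Gen ⊕ Gen → Module.End ℂ SmoothFn) (θ : ℝ) : Module.End ℂ SmoothFn :=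
  -(opX D * opX D) - opY D * (opR D θ * opY D)

theorem isInvOp_opE (θ : ℝ) (i : Gen ⊕ Gen) : IsInvOp (opE field θ i) :=
  isInvOp_one.sub (((isInvOp_field i).mul (isInvOp_field i)).smul _)

theorem isInvOp_opR (θ : ℝ) : IsInvOp (opR field θ) :=
  ((isInvOp_opE θ _).mul (isInvOp_opE θ _)).mul ((isInvOp_opE θ _).mul (isInvOp_opE θ _))

theorem isInvOp_opT (θ : ℝ) : IsInvOp (opT field θ) := by
  have hX : IsInvOp (opX field) := (isInvOp_field _).sub (isInvOp_field _)
  have hY : IsInvOp (opY field) := ((isInvOp_field _).add (isInvOp_field _)).sub (isInvOp_one.smul 2)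
  exact (hX.mul hX).neg.sub (hY.mul ((isInvOp_opR θ).mul hY))

theorem isTranspose_opE (θ : ℝ) {i : Gen ⊕ Gen} (hi : divergence i = 0) :
    IsTranspose (opE field θ i) (opE field θ i) := by
  have h := isTranspose_field i
  rw [hi, zero_smul, zero_sub] at h
  have h2 := h.mul h
  rw [end_neg_mul_neg] at h2
  exact isTranspose_one.sub (h2.smul _)

theorem isTranspose_opR (θ : ℝ) : IsTranspose (opR field θ) (opR field θ) := by
  have h1 : IsTranspose (opE field θ (Sum.inl Gen.E)) _ := isTranspose_opE θ rfl
  have h2 : IsTranspose (opE field θ (Sum.inr Gen.E)) _ := isTranspose_opE θ rfl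
  exact (h1.mul h2).mul (h2.mul h1)

theorem isTranspose_opT (θ : ℝ) : IsTranspose (opT field θ) (opT field θ) := by
  have h1 : IsTranspose (field (Sum.inl Gen.H)) _ := isTranspose_field _
  have h2 : IsTranspose (field (Sum.inr Gen.H)) _ := isTranspose_field _
  have e1 : divergence (Sum.inl Gen.H) = 2 := rfl
  have e2 : divergence (Sum.inr Gen.H) = 2 := rfl
  rw [e1] at h1
  rw [e2] at h2
  have hX : IsTranspose (opX field) (-opX field) := by
    have e : -opX field = (2 : ℂ) • 1 - field (Sum.inl Gen.H) - ((2 : ℂ) • 1 - field (Sum.inr Gen.H)) := by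
      rw [opX]; abel
    rw [e]
    exact h1.sub h2
  have hY : IsTranspose (opY field) (-opY field) := by
    have e : -opY field = (2 : ℂ) • 1 - field (Sum.inl Gen.H) + ((2 : ℂ) • 1 - field (Sum.inr Gen.H)) -
        ((2 : ℝ) : ℂ) • 1 := by
      rw [opY, Complex.ofReal_ofNat]; abel
    rw [e]
    exact (h1.add h2).sub (isTranspose_one.smul ((2 : ℝ) : ℂ))
  have hXX : IsTranspose (opX field * opX field) (-opX field * -opX field) := hX.mul hX
  have hYY : IsTranspose (opY field * (opR field θ * opY field)) (-opY field * opR field θ * -opY field) :=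
    hY.mul ((isTranspose_opR θ).mul hY)
  have e : -opY field * opR field θ * -opY field = opY field * (opR field θ * opY field) := by
    ext; simp
  rw [e] at hYY
  rw [end_neg_mul_neg] at hXX
  exact hXX.neg.sub hYY

/-! ### Elementary symbols on `𝕊 × 𝕊` -/

/-- A function that is smooth in the coordinates is smooth along the frame. -/
theorem isSmooth_of_contDiff {f : (ℝ × ℝ) × (ℝ × ℝ) → ℂ} (hf : ContDiff ℝ ∞ f) :
    IsSmooth frame₂ (fun x => f (coordHomeo x)) := by
  refine isSmooth_of_closed {F | ∃ f : ℝ × ((ℝ × ℝ) × (ℝ × ℝ)) → ℂ, ContDiff ℝ ∞ f ∧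
    F = fun x => f (1, (1 : ℝ) • coordHomeo x)} ?_ ?_ ⟨fun v => f v.2, hf.comp contDiff_snd, ?_⟩
  · rintro _ ⟨f, hf, rfl⟩
    have := hf.continuous
    have := coordHomeo.continuous
    fun_prop
  · rintro _ ⟨f, hf, rfl⟩ i
    refine ⟨_, ⟨fun v => fderiv ℝ f v (scaledField i v), ?_, rfl⟩, hasField_scaled hf 1 i⟩
    exact (hf.fderiv_right (by simp)).clm_apply (contDiff_scaledField i)
  · simp

/-- The smooth function given by a smooth real function of the coordinates. -/
def ofCoord (f : (ℝ × ℝ) × (ℝ × ℝ) → ℝ) (hf : ContDiff ℝ ∞ f) : SmoothFn :=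
  ⟨fun x => (f (coordHomeo x) : ℂ),
    isSmooth_of_contDiff (f := fun y => (f y : ℂ)) (Complex.ofRealCLM.contDiff.comp hf)⟩

theorem field_eq_of_hasDerivAt {i : Gen ⊕ Gen} {f g : SmoothFn}
    (h : ∀ x, HasDerivAt (fun t => f.1 (x * frame₂ i t)) (g.1 x) 0) : field i f = g :=
  field_eq ((hasField_iff_hasDerivAt (frame₂_zero i)).2 h)

/-- The function `e^{s a₁ + t a₂}`. -/
def expo (s t : ℝ) : SmoothFn := ofCoord (fun y => Real.exp (s * y.1.1 + t * y.2.1)) (by fun_prop)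

theorem expo_apply (s t : ℝ) (x : AffGroup × AffGroup) :
    (expo s t).1 x = (Real.exp (s * x.1.a + t * x.2.a) : ℂ) := rfl

/-- The coordinate `ℓ₁`. -/
def coordL₁ : SmoothFn := ofCoord (fun y => y.1.2) (by fun_prop)

/-- The coordinate `ℓ₂`. -/
def coordL₂ : SmoothFn := ofCoord (fun y => y.2.2) (by fun_prop)

theorem coordL₁_apply (x : AffGroup × AffGroup) : coordL₁.1 x = (x.1.l : ℂ) := rfl

theorem coordL₂_apply (x : AffGroup × AffGroup) : coordL₂.1 x = (x.2.l : ℂ) := rfl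

theorem mul_frame₂_inl_H (x : AffGroup × AffGroup) (t : ℝ) :
    x * frame₂ (Sum.inl Gen.H) t = (mk (x.1.a + t) (Real.exp (-2 * t) * x.1.l), x.2) := by
  refine Prod.ext ?_ (mul_one x.2)
  simp [frame₂, frame, mul_def]

theorem mul_frame₂_inr_H (x : AffGroup × AffGroup) (t : ℝ) :
    x * frame₂ (Sum.inr Gen.H) t = (x.1, mk (x.2.a + t) (Real.exp (-2 * t) * x.2.l)) := by
  refine Prod.ext (mul_one x.1) ?_
  simp [frame₂, frame, mul_def]

theorem mul_frame₂_inl_E (x : AffGroup × AffGroup) (t : ℝ) :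
    x * frame₂ (Sum.inl Gen.E) t = (mk x.1.a (x.1.l + t), x.2) := by
  refine Prod.ext ?_ (mul_one x.2)
  simp [frame₂, frame, mul_def]

theorem mul_frame₂_inr_E (x : AffGroup × AffGroup) (t : ℝ) :
    x * frame₂ (Sum.inr Gen.E) t = (x.1, mk x.2.a (x.2.l + t)) := by
  refine Prod.ext (mul_one x.1) ?_
  simp [frame₂, frame, mul_def]

theorem field_inl_H_expo (s t : ℝ) : field (Sum.inl Gen.H) (expo s t) = (s : ℂ) • expo s t := by
  refine field_eq_of_hasDerivAt fun x => ?_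
  simp only [mul_frame₂_inl_H, expo_apply, SmoothFn.smul_apply, a_mk]
  have := (((((hasDerivAt_id (0 : ℝ)).const_add x.1.a).const_mul s).add_const
    (t * x.2.a)).exp).ofReal_comp
  simpa [mul_comm] using this

theorem field_inr_H_expo (s t : ℝ) : field (Sum.inr Gen.H) (expo s t) = (t : ℂ) • expo s t := by
  refine field_eq_of_hasDerivAt fun x => ?_
  simp only [mul_frame₂_inr_H, expo_apply, SmoothFn.smul_apply, a_mk]
  have := (((((hasDerivAt_id (0 : ℝ)).const_add x.2.a).const_mul t).const_add
    (s * x.1.a)).exp).ofReal_comp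
  simpa [mul_comm] using this

theorem field_inl_H_coordL₁ : field (Sum.inl Gen.H) coordL₁ = (-2 : ℂ) • coordL₁ := by
  refine field_eq_of_hasDerivAt fun x => ?_
  simp only [mul_frame₂_inl_H, coordL₁_apply, SmoothFn.smul_apply, l_mk]
  have := ((((hasDerivAt_id (0 : ℝ)).const_mul (-2)).exp).mul_const x.1.l).ofReal_comp
  simpa using this

theorem field_inr_H_coordL₂ : field (Sum.inr Gen.H) coordL₂ = (-2 : ℂ) • coordL₂ := by
  refine field_eq_of_hasDerivAt fun x => ?_
  simp only [mul_frame₂_inr_H, coordL₂_apply, SmoothFn.smul_apply, l_mk]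
  have := ((((hasDerivAt_id (0 : ℝ)).const_mul (-2)).exp).mul_const x.2.l).ofReal_comp
  simpa using this

theorem field_inr_coordL₁ (i : Gen) : field (Sum.inr i) coordL₁ = 0 := by
  refine field_eq_of_hasDerivAt fun x => ?_
  cases i <;> simpa only [mul_frame₂_inr_H, mul_frame₂_inr_E, coordL₁_apply] using!
    hasDerivAt_const (0 : ℝ) (x.1.l : ℂ)

theorem field_inl_coordL₂ (i : Gen) : field (Sum.inl i) coordL₂ = 0 := by
  refine field_eq_of_hasDerivAt fun x => ?_
  cases i <;> simpa only [mul_frame₂_inl_H, mul_frame₂_inl_E, coordL₂_apply] using!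
    hasDerivAt_const (0 : ℝ) (x.2.l : ℂ)

theorem field_inl_E_coordL₁ : field (Sum.inl Gen.E) coordL₁ = 1 := by
  refine field_eq_of_hasDerivAt fun x => ?_
  simp only [mul_frame₂_inl_E, coordL₁_apply, SmoothFn.one_apply, l_mk]
  simpa using ((hasDerivAt_id (0 : ℝ)).const_add x.1.l).ofReal_comp

theorem field_inr_E_coordL₂ : field (Sum.inr Gen.E) coordL₂ = 1 := by
  refine field_eq_of_hasDerivAt fun x => ?_
  simp only [mul_frame₂_inr_E, coordL₂_apply, SmoothFn.one_apply, l_mk]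
  simpa using ((hasDerivAt_id (0 : ℝ)).const_add x.2.l).ofReal_comp

/-! ### Functions of `(a₁, a₂)` -/

/-- `f` depends on `a₁` and `a₂` only. -/
def IsRadial (f : SmoothFn) : Prop :=
  ∀ x y : AffGroup × AffGroup, x.1.a = y.1.a → x.2.a = y.2.a → f.1 x = f.1 y

theorem IsRadial.add {f g : SmoothFn} (hf : IsRadial f) (hg : IsRadial g) : IsRadial (f + g) :=
  fun x y h h' => by simp [hf x y h h', hg x y h h']

theorem IsRadial.mul {f g : SmoothFn} (hf : IsRadial f) (hg : IsRadial g) : IsRadial (f * g) :=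
  fun x y h h' => by simp [hf x y h h', hg x y h h']

theorem IsRadial.smul {f : SmoothFn} (hf : IsRadial f) (c : ℂ) : IsRadial (c • f) :=
  fun x y h h' => by simp [hf x y h h']

theorem isRadial_expo (s t : ℝ) : IsRadial (expo s t) :=
  fun x y h h' => by simp [expo_apply, h, h']

theorem IsRadial.field {f : SmoothFn} (hf : IsRadial f) (i : Gen ⊕ Gen) : IsRadial (field i f) := by
  intro x y h h'
  have : diffQuot frame₂ i f.1 x = diffQuot frame₂ i f.1 y := by
    funext t
    rw [diffQuot, diffQuot, hf x y h h']
    congr 2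
    apply hf <;> rcases i with (i | i) <;> cases i <;>
      simp [mul_frame₂_inl_H, mul_frame₂_inl_E, mul_frame₂_inr_H, mul_frame₂_inr_E, h, h']
  rw [coe_field, leftField, leftField, this]

theorem IsRadial.field_inl_E {f : SmoothFn} (hf : IsRadial f) :
    AffGroup.field (Sum.inl Gen.E) f = 0 := by
  refine field_eq_of_hasDerivAt fun x => ?_
  have : (fun t => f.1 (x * frame₂ (Sum.inl Gen.E) t)) = fun _ => f.1 x := by
    funext t
    exact hf _ _ (by simp [mul_frame₂_inl_E]) (by simp [mul_frame₂_inl_E])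
  rw [this]
  exact hasDerivAt_const _ _

theorem IsRadial.field_inr_E {f : SmoothFn} (hf : IsRadial f) :
    AffGroup.field (Sum.inr Gen.E) f = 0 := by
  refine field_eq_of_hasDerivAt fun x => ?_
  have : (fun t => f.1 (x * frame₂ (Sum.inr Gen.E) t)) = fun _ => f.1 x := by
    funext t
    exact hf _ _ (by simp [mul_frame₂_inr_E]) (by simp [mul_frame₂_inr_E])
  rw [this]
  exact hasDerivAt_const _ _

theorem mem_scalarSymbols_of_closed (𝒦 : Set SmoothFn) {m : AffGroup × AffGroup → ℂ}
    (hd : ∀ f ∈ 𝒦, ∀ i, field i f ∈ 𝒦) (hb : ∀ f ∈ 𝒦, ∃ C : ℝ, ∀ x, ‖f.1 x‖ ≤ C * ‖m x‖)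
    {f : SmoothFn} (hf : f ∈ 𝒦) : f.1 ∈ scalarSymbols frame₂ m := by
  refine mem_symbolSpace_of_closed {F | ∃ f ∈ 𝒦, F = f.1} ?_ ?_ ?_ ⟨f, hf, rfl⟩
  · rintro _ ⟨f, -, rfl⟩
    exact f.2.continuous
  · rintro _ ⟨f, hf, rfl⟩ i
    exact ⟨_, ⟨_, hd f hf i, rfl⟩, hasField_field i f⟩
  · rintro _ ⟨f, hf, rfl⟩ j
    exact hb f hf

theorem expo_mem (s t : ℝ) : (expo s t).1 ∈ scalarSymbols frame₂ (expo s t).1 := by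
  refine mem_scalarSymbols_of_closed {f | ∃ c : ℂ, f = c • expo s t} ?_ ?_ ⟨1, by simp⟩
  · rintro _ ⟨c, rfl⟩ i
    rw [map_smul]
    rcases i with (i | i) <;> cases i
    · exact ⟨c * s, by rw [field_inl_H_expo, smul_smul]⟩
    · exact ⟨0, by rw [(isRadial_expo s t).field_inl_E]; simp⟩
    · exact ⟨c * t, by rw [field_inr_H_expo, smul_smul]⟩
    · exact ⟨0, by rw [(isRadial_expo s t).field_inr_E]; simp⟩
  · rintro _ ⟨c, rfl⟩
    exact ⟨‖c‖, fun x => (norm_mul _ _).le⟩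

/-- The function `2 cosh (s a₁ + t a₂)`. -/
def twoCosh (s t : ℝ) : SmoothFn := expo s t + expo (-s) (-t)

theorem twoCosh_apply (s t : ℝ) (x : AffGroup × AffGroup) :
    (twoCosh s t).1 x = ((2 * Real.cosh (s * x.1.a + t * x.2.a) : ℝ) : ℂ) := by
  have e : -s * x.1.a + -t * x.2.a = -(s * x.1.a + t * x.2.a) := by ring
  rw [twoCosh, SmoothFn.add_apply, expo_apply, expo_apply, e, Real.cosh_eq]
  push_cast
  ring

theorem norm_twoCosh (s t : ℝ) (x : AffGroup × AffGroup) :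
    ‖(twoCosh s t).1 x‖ = 2 * Real.cosh (s * x.1.a + t * x.2.a) := by
  rw [twoCosh_apply, Complex.norm_real, Real.norm_of_nonneg]
  have := Real.cosh_pos (s * x.1.a + t * x.2.a)
  positivity

theorem norm_expo (s t : ℝ) (x : AffGroup × AffGroup) :
    ‖(expo s t).1 x‖ = Real.exp (s * x.1.a + t * x.2.a) := by
  rw [expo_apply, Complex.norm_real, Real.norm_of_nonneg (Real.exp_pos _).le]

theorem exp_le_two_cosh (y : ℝ) : Real.exp y ≤ 2 * Real.cosh y := by
  rw [Real.cosh_eq]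
  linarith [Real.exp_pos (-y)]

theorem norm_expo_le (s t : ℝ) (x : AffGroup × AffGroup) :
    ‖(expo s t).1 x‖ ≤ ‖(twoCosh s t).1 x‖ := by
  rw [norm_expo, norm_twoCosh]
  exact exp_le_two_cosh _

theorem norm_expo_neg_le (s t : ℝ) (x : AffGroup × AffGroup) :
    ‖(expo (-s) (-t)).1 x‖ ≤ ‖(twoCosh s t).1 x‖ := by
  rw [norm_expo, norm_twoCosh, ← Real.cosh_neg]
  refine (exp_le_two_cosh _).trans (le_of_eq ?_)
  ring_nf

theorem isRadial_twoCosh (s t : ℝ) : IsRadial (twoCosh s t) :=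
  (isRadial_expo _ _).add (isRadial_expo _ _)

theorem isWeight_twoCosh (s t : ℝ) : IsWeight frame₂ (twoCosh s t).1 := by
  refine ⟨fun x => ?_, symbolSpace.add (symbolSpace.mono (expo_mem s t) (C := 1) fun x => ?_)
    (symbolSpace.mono (expo_mem (-s) (-t)) (C := 1) fun x => ?_)⟩
  · rw [← norm_pos_iff, norm_twoCosh]
    have := Real.cosh_pos (s * x.1.a + t * x.2.a)
    positivity
  · rw [one_mul]; exact norm_expo_le s t x
  · rw [one_mul]; exact norm_expo_neg_le s t x

/-- The inverse of a smooth weight. -/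
def invFn (f : SmoothFn) (hf : IsWeight frame₂ f.1) : SmoothFn :=
  ⟨f.1⁻¹, (hf.inv_mem frame₂_zero).1⟩

theorem invFn_apply (f : SmoothFn) (hf : IsWeight frame₂ f.1) (x : AffGroup × AffGroup) :
    (invFn f hf).1 x = (f.1 x)⁻¹ := rfl

theorem isRadial_invFn {f : SmoothFn} (hf : IsWeight frame₂ f.1) (h : IsRadial f) :
    IsRadial (invFn f hf) :=
  fun x y h1 h2 => by rw [invFn_apply, invFn_apply, h x y h1 h2]

/-- The function `τ = 4 cosh (2 a₁) cosh (2 a₂)`. -/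
def tau : SmoothFn := twoCosh 2 0 * twoCosh 0 2

theorem isWeight_tau : IsWeight frame₂ tau.1 :=
  IsWeight.mul (isWeight_twoCosh 2 0) (isWeight_twoCosh 0 2)

theorem norm_tau (x : AffGroup × AffGroup) :
    ‖tau.1 x‖ = (2 * Real.cosh (2 * x.1.a)) * (2 * Real.cosh (2 * x.2.a)) := by
  rw [tau, SmoothFn.mul_apply, norm_mul, norm_twoCosh, norm_twoCosh]
  simp

theorem two_cosh_le_norm_tau₁ (x : AffGroup × AffGroup) : 2 * Real.cosh (2 * x.1.a) ≤ ‖tau.1 x‖ := by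
  rw [norm_tau]
  have h1 := Real.one_le_cosh (2 * x.1.a)
  have h2 := Real.one_le_cosh (2 * x.2.a)
  nlinarith

theorem two_cosh_le_norm_tau₂ (x : AffGroup × AffGroup) : 2 * Real.cosh (2 * x.2.a) ≤ ‖tau.1 x‖ := by
  rw [norm_tau]
  have h1 := Real.one_le_cosh (2 * x.1.a)
  have h2 := Real.one_le_cosh (2 * x.2.a)
  nlinarith

theorem one_le_norm_tau (x : AffGroup × AffGroup) : 1 ≤ ‖tau.1 x‖ := by
  have h1 := Real.one_le_cosh (2 * x.1.a)
  linarith [two_cosh_le_norm_tau₁ x]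

/-- Functions of `(a₁, a₂)` of symbol type for some power of `τ`. -/
def IsCoef (f : SmoothFn) : Prop := IsRadial f ∧ ∃ k : ℕ, f.1 ∈ scalarSymbols frame₂ (tau.1 ^ k)

theorem scalarSymbols.mono_tau {f : AffGroup × AffGroup → ℂ} {k l : ℕ} (h : k ≤ l)
    (hf : f ∈ scalarSymbols frame₂ (tau.1 ^ k)) : f ∈ scalarSymbols frame₂ (tau.1 ^ l) := by
  refine symbolSpace.mono hf (C := 1) fun x => ?_
  rw [one_mul, Pi.pow_apply, Pi.pow_apply, norm_pow, norm_pow]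
  exact pow_le_pow_right₀ (one_le_norm_tau x) h

theorem IsCoef.add {f g : SmoothFn} (hf : IsCoef f) (hg : IsCoef g) : IsCoef (f + g) := by
  obtain ⟨hf, k, hk⟩ := hf
  obtain ⟨hg, l, hl⟩ := hg
  exact ⟨hf.add hg, max k l, symbolSpace.add (scalarSymbols.mono_tau (le_max_left k l) hk)
    (scalarSymbols.mono_tau (le_max_right k l) hl)⟩

theorem IsCoef.mul {f g : SmoothFn} (hf : IsCoef f) (hg : IsCoef g) : IsCoef (f * g) := by
  obtain ⟨hf, k, hk⟩ := hf
  obtain ⟨hg, l, hl⟩ := hg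
  exact ⟨hf.mul hg, k + l, by rw [pow_add]; exact scalarSymbols.mul hk hl⟩

theorem IsCoef.smul {f : SmoothFn} (hf : IsCoef f) (c : ℂ) : IsCoef (c • f) :=
  ⟨hf.1.smul c, hf.2.imp fun _ h => symbolSpace.const_smul h c⟩

theorem IsCoef.field {f : SmoothFn} (hf : IsCoef f) (i : Gen ⊕ Gen) : IsCoef (field i f) :=
  ⟨hf.1.field i, hf.2.imp fun _ h => symbolSpace.leftField h i⟩

theorem isCoef_one : IsCoef 1 :=
  ⟨fun _ _ _ _ => rfl, 0, by rw [pow_zero]; exact scalarSymbols.one⟩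

theorem IsCoef.pow {f : SmoothFn} (hf : IsCoef f) (n : ℕ) : IsCoef (f ^ n) := by
  induction n with
  | zero => simpa using isCoef_one
  | succ n ih => rw [pow_succ]; exact ih.mul hf

theorem isCoef_of_bounded {f : SmoothFn} (h : IsRadial f) {m : AffGroup × AffGroup → ℂ}
    (hf : f.1 ∈ scalarSymbols frame₂ m) {C : ℝ} (k : ℕ) (hm : ∀ x, ‖m x‖ ≤ C * ‖tau.1 x‖ ^ k) :
    IsCoef f :=
  ⟨h, k, symbolSpace.mono hf (C := C) fun x => by simpa using hm x⟩

/-! ### The phase and its derivatives -/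

/-- `sinh (2 a₁)`. -/
def sinh₁ : SmoothFn := (1 / 2 : ℂ) • (expo 2 0 - expo (-2) 0)

/-- `sinh (2 a₂)`. -/
def sinh₂ : SmoothFn := (1 / 2 : ℂ) • (expo 0 2 - expo 0 (-2))

/-- `cosh (2 a₁)`. -/
def cosh₁ : SmoothFn := (1 / 2 : ℂ) • twoCosh 2 0

/-- `cosh (2 a₂)`. -/
def cosh₂ : SmoothFn := (1 / 2 : ℂ) • twoCosh 0 2

/-- The phase `S_can / θ` as a complex function. -/
def phase (θ : ℝ) : SmoothFn := (1 / θ : ℂ) • (sinh₁ * coordL₂ - sinh₂ * coordL₁)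

/-- `(H₁ - H₂) S = (2 / θ) (e^{2 a₁} ℓ₂ + e^{2 a₂} ℓ₁)`. -/
def symX (θ : ℝ) : SmoothFn := (2 / θ : ℂ) • (expo 2 0 * coordL₂ + expo 0 2 * coordL₁)

/-- `(H₁ + H₂) S = (2 / θ) (e^{-2 a₁} ℓ₂ - e^{-2 a₂} ℓ₁)`. -/
def symY (θ : ℝ) : SmoothFn := (2 / θ : ℂ) • (expo (-2) 0 * coordL₂ - expo 0 (-2) * coordL₁)

/-- `Z = cosh² (2 a₁) cosh² (2 a₂) (H₁ + H₂) S`, the square root of the symbol of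
`-(H₁ + H₂ - 2) R (H₁ + H₂ - 2)`. -/
def symZ (θ : ℝ) : SmoothFn := cosh₁ ^ 2 * cosh₂ ^ 2 * symY θ

theorem expo_2_0 (x : AffGroup × AffGroup) : (expo 2 0).1 x = Complex.exp (2 * x.1.a) := by
  rw [expo_apply]; push_cast; ring_nf

theorem expo_m2_0 (x : AffGroup × AffGroup) :
    (expo (-2) 0).1 x = (Complex.exp (2 * x.1.a))⁻¹ := by
  rw [expo_apply, ← Complex.exp_neg]; push_cast; ring_nf

theorem expo_0_2 (x : AffGroup × AffGroup) : (expo 0 2).1 x = Complex.exp (2 * x.2.a) := by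
  rw [expo_apply]; push_cast; ring_nf

theorem expo_0_m2 (x : AffGroup × AffGroup) :
    (expo 0 (-2)).1 x = (Complex.exp (2 * x.2.a))⁻¹ := by
  rw [expo_apply, ← Complex.exp_neg]; push_cast; ring_nf

theorem expo_2_2 (x : AffGroup × AffGroup) :
    (expo 2 2).1 x = Complex.exp (2 * x.1.a) * Complex.exp (2 * x.2.a) := by
  rw [expo_apply, ← Complex.exp_add]; push_cast; ring_nf

theorem expo_2_m2 (x : AffGroup × AffGroup) :
    (expo 2 (-2)).1 x = Complex.exp (2 * x.1.a) * (Complex.exp (2 * x.2.a))⁻¹ := by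
  rw [expo_apply, ← Complex.exp_neg, ← Complex.exp_add]; push_cast; ring_nf

theorem expo_m2_2 (x : AffGroup × AffGroup) :
    (expo (-2) 2).1 x = (Complex.exp (2 * x.1.a))⁻¹ * Complex.exp (2 * x.2.a) := by
  rw [expo_apply, ← Complex.exp_neg, ← Complex.exp_add]; push_cast; ring_nf

theorem phase_apply (θ : ℝ) (x : AffGroup × AffGroup) :
    (phase θ).1 x = ((Scan x / θ : ℝ) : ℂ) := by
  simp only [phase, sinh₁, sinh₂, SmoothFn.smul_apply, SmoothFn.sub_apply, SmoothFn.mul_apply,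
    expo_2_0, expo_m2_0, expo_0_2, expo_0_m2, coordL₁_apply, coordL₂_apply, Scan, Real.sinh_eq,
    Real.exp_neg]
  push_cast
  ring

theorem field_inl_E_expo (s t : ℝ) : field (Sum.inl Gen.E) (expo s t) = 0 :=
  (isRadial_expo s t).field_inl_E

theorem field_inr_E_expo (s t : ℝ) : field (Sum.inr Gen.E) (expo s t) = 0 :=
  (isRadial_expo s t).field_inr_E

theorem field_phase_X (θ : ℝ) :
    field (Sum.inl Gen.H) (phase θ) - field (Sum.inr Gen.H) (phase θ) = symX θ := by
  ext x
  simp only [phase, sinh₁, sinh₂, symX, field_mul, map_smul, map_sub, field_inl_H_expo,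
    field_inr_H_expo, field_inl_H_coordL₁, field_inr_H_coordL₂, field_inr_coordL₁,
    field_inl_coordL₂, SmoothFn.add_apply,
    SmoothFn.smul_apply, SmoothFn.sub_apply, SmoothFn.mul_apply, SmoothFn.zero_apply]
  push_cast
  ring

theorem field_phase_Y (θ : ℝ) :
    field (Sum.inl Gen.H) (phase θ) + field (Sum.inr Gen.H) (phase θ) = symY θ := by
  ext x
  simp only [phase, sinh₁, sinh₂, symY, field_mul, map_smul, map_sub, field_inl_H_expo,
    field_inr_H_expo, field_inl_H_coordL₁, field_inr_H_coordL₂, field_inr_coordL₁,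
    field_inl_coordL₂, SmoothFn.add_apply,
    SmoothFn.smul_apply, SmoothFn.sub_apply, SmoothFn.mul_apply, SmoothFn.zero_apply]
  push_cast
  ring

theorem field_phase_inl_E (θ : ℝ) :
    field (Sum.inl Gen.E) (phase θ) = (-1 / θ : ℂ) • sinh₂ := by
  ext x
  simp only [phase, sinh₁, sinh₂, field_mul, map_smul, map_sub, field_inl_E_expo,
    field_inl_E_coordL₁, field_inl_coordL₂, SmoothFn.add_apply, SmoothFn.one_apply,
    SmoothFn.smul_apply, SmoothFn.sub_apply, SmoothFn.mul_apply, SmoothFn.zero_apply]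
  ring

theorem field_phase_inr_E (θ : ℝ) :
    field (Sum.inr Gen.E) (phase θ) = (1 / θ : ℂ) • sinh₁ := by
  ext x
  simp only [phase, sinh₁, sinh₂, field_mul, map_smul, map_sub, field_inr_E_expo,
    field_inr_E_coordL₂, field_inr_coordL₁, SmoothFn.add_apply, SmoothFn.one_apply,
    SmoothFn.smul_apply, SmoothFn.sub_apply, SmoothFn.mul_apply, SmoothFn.zero_apply]
  ring

/-- `1 / (2 cosh (2 (a₁ - a₂)))`. -/
def secD : SmoothFn := invFn (twoCosh 2 (-2)) (isWeight_twoCosh _ _)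

/-- `1 / (2 cosh (2 a₁))`. -/
def sec₁ : SmoothFn := invFn (twoCosh 2 0) (isWeight_twoCosh _ _)

/-- `1 / (2 cosh (2 a₂))`. -/
def sec₂ : SmoothFn := invFn (twoCosh 0 2) (isWeight_twoCosh _ _)

/-- `2 tanh (2 (a₁ - a₂))`. -/
def coefXX : SmoothFn := (2 : ℂ) • ((expo 2 (-2) - expo (-2) 2) * secD)

/-- The coefficient of `Z` in `H₁ X`. -/
def coefXZ : SmoothFn := (64 : ℂ) • (expo 2 2 * (secD * (sec₁ ^ 2 * sec₂ ^ 2)))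

/-- `4 tanh (2 a₁) - 2`. -/
def coefZ₁ : SmoothFn := (4 : ℂ) • ((expo 2 0 - expo (-2) 0) * sec₁) - (2 : ℂ) • 1

/-- `4 tanh (2 a₂) - 2`. -/
def coefZ₂ : SmoothFn := (4 : ℂ) • ((expo 0 2 - expo 0 (-2)) * sec₂) - (2 : ℂ) • 1

theorem twoCosh_2_0 (x : AffGroup × AffGroup) : (twoCosh 2 0).1 x =
    Complex.exp (2 * x.1.a) + (Complex.exp (2 * x.1.a))⁻¹ := by
  rw [twoCosh, SmoothFn.add_apply, neg_zero, expo_2_0, expo_m2_0]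

theorem twoCosh_0_2 (x : AffGroup × AffGroup) : (twoCosh 0 2).1 x =
    Complex.exp (2 * x.2.a) + (Complex.exp (2 * x.2.a))⁻¹ := by
  rw [twoCosh, SmoothFn.add_apply, neg_zero, expo_0_2, expo_0_m2]

theorem twoCosh_2_m2 (x : AffGroup × AffGroup) : (twoCosh 2 (-2)).1 x =
    Complex.exp (2 * x.1.a) * (Complex.exp (2 * x.2.a))⁻¹ +
      (Complex.exp (2 * x.1.a))⁻¹ * Complex.exp (2 * x.2.a) := by
  rw [twoCosh, SmoothFn.add_apply, neg_neg, expo_2_m2, expo_m2_2]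

theorem symZ_eq (θ : ℝ) : symZ θ = (1 / 16 : ℂ) • (twoCosh 2 0 ^ 2 * twoCosh 0 2 ^ 2 * symY θ) := by
  ext x
  simp only [symZ, cosh₁, cosh₂, SmoothFn.smul_apply, SmoothFn.mul_apply, SmoothFn.pow_apply]
  ring

theorem symY_eq (θ : ℝ) : symY θ = (16 : ℂ) • (sec₁ ^ 2 * sec₂ ^ 2 * symZ θ) := by
  ext x
  have h1 := (isWeight_twoCosh 2 0).1 x
  have h2 := (isWeight_twoCosh 0 2).1 x
  simp only [symZ_eq, sec₁, sec₂, invFn_apply, SmoothFn.smul_apply, SmoothFn.mul_apply,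
    SmoothFn.pow_apply]
  field_simp

/-- `H₁ X` is a combination of `X` and `Z` whose coefficients are bounded functions of `(a₁, a₂)`. -/
theorem field_inl_H_symX (θ : ℝ) :
    field (Sum.inl Gen.H) (symX θ) = coefXX * symX θ + coefXZ * symZ θ := by
  ext x
  have h1 := (isWeight_twoCosh 2 0).1 x
  have h2 := (isWeight_twoCosh 0 2).1 x
  have h3 := (isWeight_twoCosh 2 (-2)).1 x
  have hu := Complex.exp_ne_zero (2 * x.1.a)
  have hv := Complex.exp_ne_zero (2 * x.2.a)
  have e : (coefXZ * symZ θ).1 x = 4 * ((expo 2 2).1 x * secD.1 x * (symY θ).1 x) := by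
    simp only [coefXZ, symZ_eq, sec₁, sec₂, invFn_apply, SmoothFn.smul_apply, SmoothFn.mul_apply,
      SmoothFn.pow_apply]
    field_simp
    ring
  rw [SmoothFn.add_apply, e]
  simp only [symX, symY, coefXX, secD, invFn_apply, field_mul, map_smul, map_add,
    field_inl_H_expo, field_inl_H_coordL₁, field_inl_coordL₂, SmoothFn.add_apply,
    SmoothFn.smul_apply, SmoothFn.sub_apply, SmoothFn.mul_apply, SmoothFn.zero_apply,
    expo_2_0, expo_m2_0, expo_0_2, expo_0_m2, expo_2_2, expo_2_m2, expo_m2_2]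
  rw [twoCosh_2_m2] at h3 ⊢
  generalize (2 / θ : ℂ) = c
  push_cast
  field_simp at h3
  have h4 := (div_ne_zero_iff.1 h3).1
  field_simp
  ring

theorem field_inr_H_symX (θ : ℝ) :
    field (Sum.inr Gen.H) (symX θ) = -field (Sum.inl Gen.H) (symX θ) := by
  ext x
  simp only [symX, field_mul, map_smul, map_add, field_inl_H_expo, field_inl_H_coordL₁,
    field_inl_coordL₂, field_inr_H_expo, field_inr_H_coordL₂, field_inr_coordL₁,
    SmoothFn.add_apply, SmoothFn.neg_apply,
    SmoothFn.smul_apply, SmoothFn.mul_apply, SmoothFn.zero_apply]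
  push_cast
  ring

theorem field_inl_H_symZ (θ : ℝ) : field (Sum.inl Gen.H) (symZ θ) = coefZ₁ * symZ θ := by
  ext x
  have h1 := (isWeight_twoCosh 2 0).1 x
  simp only [symZ_eq, symY, coefZ₁, sec₁, invFn_apply, field_mul, pow_two, map_smul,
    map_sub, field_inl_H_expo, field_inl_H_coordL₁, field_inl_coordL₂, SmoothFn.add_apply,
    SmoothFn.smul_apply, SmoothFn.sub_apply, SmoothFn.mul_apply, SmoothFn.zero_apply,
    SmoothFn.one_apply]
  rw [twoCosh, SmoothFn.add_apply] at h1
  simp only [twoCosh, map_add, field_inl_H_expo, SmoothFn.add_apply, SmoothFn.smul_apply]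
  push_cast
  simp only [neg_zero] at h1 ⊢
  field_simp
  ring

theorem field_inr_H_symZ (θ : ℝ) : field (Sum.inr Gen.H) (symZ θ) = coefZ₂ * symZ θ := by
  ext x
  have h1 := (isWeight_twoCosh 0 2).1 x
  simp only [symZ_eq, symY, coefZ₂, sec₂, invFn_apply, field_mul, pow_two, map_smul,
    map_sub, field_inr_H_expo, field_inr_H_coordL₂, field_inr_coordL₁, SmoothFn.add_apply,
    SmoothFn.smul_apply, SmoothFn.sub_apply, SmoothFn.mul_apply, SmoothFn.zero_apply,
    SmoothFn.one_apply]
  rw [twoCosh, SmoothFn.add_apply] at h1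
  simp only [twoCosh, map_add, field_inr_H_expo, SmoothFn.add_apply, SmoothFn.smul_apply]
  push_cast
  simp only [neg_zero] at h1 ⊢
  field_simp
  ring

theorem field_inl_E_symX (θ : ℝ) : field (Sum.inl Gen.E) (symX θ) = (2 / θ : ℂ) • expo 0 2 := by
  ext x
  simp only [symX, field_mul, map_smul, map_add, field_inl_E_expo, field_inl_E_coordL₁,
    field_inl_coordL₂, SmoothFn.add_apply, SmoothFn.one_apply,
    SmoothFn.smul_apply, SmoothFn.mul_apply, SmoothFn.zero_apply]
  ring

theorem field_inr_E_symX (θ : ℝ) : field (Sum.inr Gen.E) (symX θ) = (2 / θ : ℂ) • expo 2 0 := by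
  ext x
  simp only [symX, field_mul, map_smul, map_add, field_inr_E_expo, field_inr_E_coordL₂,
    field_inr_coordL₁, SmoothFn.add_apply, SmoothFn.one_apply,
    SmoothFn.smul_apply, SmoothFn.mul_apply, SmoothFn.zero_apply]
  ring

theorem isRadial_cosh : IsRadial (cosh₁ ^ 2 * cosh₂ ^ 2) := by
  rw [pow_two, pow_two]
  have h1 := (isRadial_twoCosh 2 0).smul (1 / 2)
  have h2 := (isRadial_twoCosh 0 2).smul (1 / 2)
  exact (h1.mul h1).mul (h2.mul h2)

theorem field_inl_E_symZ (θ : ℝ) : field (Sum.inl Gen.E) (symZ θ) =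
    (-2 / θ : ℂ) • (cosh₁ ^ 2 * cosh₂ ^ 2 * expo 0 (-2)) := by
  rw [symZ, field_mul, isRadial_cosh.field_inl_E]
  ext x
  simp only [symY, field_mul, map_smul, map_sub, field_inl_E_expo, field_inl_E_coordL₁,
    field_inl_coordL₂, SmoothFn.add_apply, SmoothFn.one_apply, SmoothFn.sub_apply,
    SmoothFn.smul_apply, SmoothFn.mul_apply, SmoothFn.zero_apply]
  ring

theorem field_inr_E_symZ (θ : ℝ) : field (Sum.inr Gen.E) (symZ θ) =
    (2 / θ : ℂ) • (cosh₁ ^ 2 * cosh₂ ^ 2 * expo (-2) 0) := by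
  rw [symZ, field_mul, isRadial_cosh.field_inr_E]
  ext x
  simp only [symY, field_mul, map_smul, map_sub, field_inr_E_expo, field_inr_E_coordL₂,
    field_inr_coordL₁, SmoothFn.add_apply, SmoothFn.one_apply, SmoothFn.sub_apply,
    SmoothFn.smul_apply, SmoothFn.mul_apply, SmoothFn.zero_apply]
  ring

/-! ### The coefficients are symbols -/

theorem isCoef_expo_of_le {s t : ℝ} (h : ∀ x, ‖(expo s t).1 x‖ ≤ ‖tau.1 x‖) :
    IsCoef (expo s t) :=
  isCoef_of_bounded (isRadial_expo s t) (expo_mem s t) (C := 1) 1 fun x => by simpa using h x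

theorem norm_expo_2_0_le (x : AffGroup × AffGroup) : ‖(expo 2 0).1 x‖ ≤ ‖tau.1 x‖ := by
  refine (norm_expo_le 2 0 x).trans ?_
  rw [norm_twoCosh, zero_mul, add_zero]
  exact two_cosh_le_norm_tau₁ x

theorem norm_expo_m2_0_le (x : AffGroup × AffGroup) : ‖(expo (-2) 0).1 x‖ ≤ ‖tau.1 x‖ := by
  have := norm_expo_neg_le 2 0 x
  rw [neg_zero] at this
  refine this.trans ?_
  rw [norm_twoCosh, zero_mul, add_zero]
  exact two_cosh_le_norm_tau₁ x

theorem norm_expo_0_2_le (x : AffGroup × AffGroup) : ‖(expo 0 2).1 x‖ ≤ ‖tau.1 x‖ := by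
  refine (norm_expo_le 0 2 x).trans ?_
  rw [norm_twoCosh, zero_mul, zero_add]
  exact two_cosh_le_norm_tau₂ x

theorem norm_expo_0_m2_le (x : AffGroup × AffGroup) : ‖(expo 0 (-2)).1 x‖ ≤ ‖tau.1 x‖ := by
  have := norm_expo_neg_le 0 2 x
  rw [neg_zero] at this
  refine this.trans ?_
  rw [norm_twoCosh, zero_mul, zero_add]
  exact two_cosh_le_norm_tau₂ x

theorem isCoef_sinh₁ : IsCoef sinh₁ := by
  rw [sinh₁, sub_eq_add_neg, ← neg_one_smul ℂ (expo (-2) 0)]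
  exact ((isCoef_expo_of_le norm_expo_2_0_le).add
    ((isCoef_expo_of_le norm_expo_m2_0_le).smul _)).smul _

theorem isCoef_sinh₂ : IsCoef sinh₂ := by
  rw [sinh₂, sub_eq_add_neg, ← neg_one_smul ℂ (expo 0 (-2))]
  exact ((isCoef_expo_of_le norm_expo_0_2_le).add
    ((isCoef_expo_of_le norm_expo_0_m2_le).smul _)).smul _

theorem isCoef_cosh₁ : IsCoef cosh₁ := by
  rw [cosh₁, twoCosh, neg_zero]
  exact ((isCoef_expo_of_le norm_expo_2_0_le).add
    (isCoef_expo_of_le norm_expo_m2_0_le)).smul _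

theorem isCoef_cosh₂ : IsCoef cosh₂ := by
  rw [cosh₂, twoCosh, neg_zero]
  exact ((isCoef_expo_of_le norm_expo_0_2_le).add
    (isCoef_expo_of_le norm_expo_0_m2_le)).smul _

/-- Symbols of order zero in `(a₁, a₂)`. -/
def IsBddCoef (f : SmoothFn) : Prop := IsRadial f ∧ f.1 ∈ scalarSymbols frame₂ 1

theorem IsBddCoef.isCoef {f : SmoothFn} (h : IsBddCoef f) : IsCoef f :=
  ⟨h.1, 0, by rw [pow_zero]; exact h.2⟩

theorem IsBddCoef.field {f : SmoothFn} (hf : IsBddCoef f) (i : Gen ⊕ Gen) :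
    IsBddCoef (field i f) :=
  ⟨hf.1.field i, symbolSpace.leftField hf.2 i⟩

theorem IsBddCoef.add {f g : SmoothFn} (hf : IsBddCoef f) (hg : IsBddCoef g) :
    IsBddCoef (f + g) := ⟨hf.1.add hg.1, symbolSpace.add hf.2 hg.2⟩

theorem IsBddCoef.smul {f : SmoothFn} (hf : IsBddCoef f) (c : ℂ) :
    IsBddCoef (c • f) := ⟨hf.1.smul c, symbolSpace.const_smul hf.2 c⟩

theorem IsBddCoef.mul {f g : SmoothFn} (hf : IsBddCoef f) (hg : IsBddCoef g) :
    IsBddCoef (f * g) :=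
  ⟨hf.1.mul hg.1, by simpa only [mul_one] using! scalarSymbols.mul hf.2 hg.2⟩

theorem IsBddCoef.sub {f g : SmoothFn} (hf : IsBddCoef f) (hg : IsBddCoef g) :
    IsBddCoef (f - g) := by
  rw [sub_eq_add_neg, ← neg_one_smul ℂ g]
  exact hf.add (hg.smul _)

theorem isBddCoef_one : IsBddCoef 1 := ⟨fun _ _ _ _ => rfl, scalarSymbols.one⟩

theorem isBddCoef_mul_sec {f : SmoothFn} {m : AffGroup × AffGroup → ℂ} (h : IsRadial f)
    (hf : f.1 ∈ scalarSymbols frame₂ m) {s t : ℝ} (hm : ∀ x, ‖m x‖ ≤ ‖(twoCosh s t).1 x‖) :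
    IsBddCoef (f * invFn (twoCosh s t) (isWeight_twoCosh s t)) := by
  refine ⟨h.mul (isRadial_invFn _ (isRadial_twoCosh s t)), ?_⟩
  refine symbolSpace.mono (scalarSymbols.mul hf ((isWeight_twoCosh s t).inv_mem frame₂_zero))
    (C := 1) fun x => ?_
  have h1 := (isWeight_twoCosh s t).1 x
  rw [Pi.mul_apply, Pi.inv_apply, norm_mul, norm_inv, Pi.one_apply, norm_one, mul_one,
    mul_inv_le_iff₀ (norm_pos_iff.2 h1), one_mul]
  exact hm x

theorem one_le_norm_twoCosh (s t : ℝ) (x : AffGroup × AffGroup) : 1 ≤ ‖(twoCosh s t).1 x‖ := by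
  rw [norm_twoCosh]
  linarith [Real.one_le_cosh (s * x.1.a + t * x.2.a)]

theorem isBddCoef_sec (s t : ℝ) : IsBddCoef (invFn (twoCosh s t) (isWeight_twoCosh s t)) := by
  rw [← one_mul (invFn _ _)]
  exact isBddCoef_mul_sec (m := 1) (fun _ _ _ _ => rfl) scalarSymbols.one fun x => by
    simpa using one_le_norm_twoCosh s t x

theorem isBddCoef_expo_mul_sec (s t : ℝ) :
    IsBddCoef (expo s t * invFn (twoCosh s t) (isWeight_twoCosh s t)) :=
  isBddCoef_mul_sec (isRadial_expo s t) (expo_mem s t) (norm_expo_le s t)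

theorem isBddCoef_expo_neg_mul_sec (s t : ℝ) :
    IsBddCoef (expo (-s) (-t) * invFn (twoCosh s t) (isWeight_twoCosh s t)) :=
  isBddCoef_mul_sec (isRadial_expo _ _) (expo_mem _ _) (norm_expo_neg_le s t)

theorem isBddCoef_coefXX : IsBddCoef coefXX := by
  have h1 := isBddCoef_expo_mul_sec 2 (-2)
  have h2 := isBddCoef_expo_neg_mul_sec 2 (-2)
  rw [neg_neg] at h2
  rw [coefXX, sub_mul]
  exact (h1.sub h2).smul _

theorem isBddCoef_coefZ₁ : IsBddCoef coefZ₁ := by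
  have h1 := isBddCoef_expo_mul_sec 2 0
  have h2 := isBddCoef_expo_neg_mul_sec 2 0
  rw [neg_zero] at h2
  rw [coefZ₁, sub_mul]
  exact ((h1.sub h2).smul _).sub (isBddCoef_one.smul _)

theorem isBddCoef_coefZ₂ : IsBddCoef coefZ₂ := by
  have h1 := isBddCoef_expo_mul_sec 0 2
  have h2 := isBddCoef_expo_neg_mul_sec 0 2
  rw [neg_zero] at h2
  rw [coefZ₂, sub_mul]
  exact ((h1.sub h2).smul _).sub (isBddCoef_one.smul _)

theorem isBddCoef_coefXZ : IsBddCoef coefXZ := by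
  have e : coefXZ = (64 : ℂ) • ((expo 2 0 * sec₁) * (expo 0 2 * sec₂) * secD * sec₁ * sec₂) := by
    ext x
    simp only [coefXZ, SmoothFn.smul_apply, SmoothFn.mul_apply, SmoothFn.pow_apply, expo_2_2,
      expo_2_0, expo_0_2]
    ring
  rw [e]
  exact (((((isBddCoef_expo_mul_sec 2 0).mul (isBddCoef_expo_mul_sec 0 2)).mul
    (isBddCoef_sec _ _)).mul (isBddCoef_sec _ _)).mul (isBddCoef_sec _ _)).smul _

/-! ### Conjugation by the phase -/

/-- The function `e^{iS}`, `S = S_can / θ`. -/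
def expS (θ : ℝ) : SmoothFn := ⟨expPhase fun x => Scan x / θ, by
  have h : ContDiff ℝ ∞ fun y : (ℝ × ℝ) × (ℝ × ℝ) => Complex.exp (Complex.I *
      (((Real.sinh (2 * y.1.1) * y.2.2 - Real.sinh (2 * y.2.1) * y.1.2) / θ : ℝ) : ℂ)) := by
    refine ContDiff.cexp (contDiff_const.mul (Complex.ofRealCLM.contDiff.comp ?_))
    exact ContDiff.div_const (by fun_prop) θ
  exact isSmooth_of_contDiff h⟩

theorem expS_apply (θ : ℝ) (x : AffGroup × AffGroup) :
    (expS θ).1 x = Complex.exp (Complex.I * (phase θ).1 x) := by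
  rw [phase_apply]; rfl

theorem field_expS (θ : ℝ) (i : Gen ⊕ Gen) :
    field i (expS θ) = Complex.I • (field i (phase θ) * expS θ) := by
  refine field_eq_of_hasDerivAt fun x => ?_
  have h := (hasField_iff_hasDerivAt (frame₂_zero i)).1 (hasField_field i (phase θ)) x
  have h2 := (h.const_mul Complex.I).cexp
  simp only [frame₂_zero, mul_one] at h2
  simp only [expS_apply, SmoothFn.smul_apply, SmoothFn.mul_apply]
  convert h2 using 1
  ring

/-- The conjugate `e^{-iS} X̃ᵢ e^{iS} = X̃ᵢ + i X̃ᵢ S` of a left-invariant field. -/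
def hatField (θ : ℝ) (i : Gen ⊕ Gen) : Module.End ℂ SmoothFn :=
  field i + LinearMap.mulLeft ℂ (Complex.I • field i (phase θ))

theorem hatField_apply (θ : ℝ) (i : Gen ⊕ Gen) (f : SmoothFn) :
    hatField θ i f = field i f + Complex.I • (field i (phase θ) * f) := by
  rw [hatField, LinearMap.add_apply, LinearMap.mulLeft_apply, smul_mul_assoc]

/-- `D' = e^{-iS} D e^{iS}`. -/
def IsConj (θ : ℝ) (D D' : Module.End ℂ SmoothFn) : Prop := ∀ f, D (f * expS θ) = D' f * expS θ

theorem isConj_field (θ : ℝ) (i : Gen ⊕ Gen) : IsConj θ (field i) (hatField θ i) := by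
  intro f
  rw [field_mul, field_expS, hatField_apply]
  ext x
  simp only [SmoothFn.add_apply, SmoothFn.mul_apply, SmoothFn.smul_apply]
  ring

theorem isConj_one (θ : ℝ) : IsConj θ 1 1 := fun _ => rfl

section

variable {θ : ℝ} {D D' K K' : Module.End ℂ SmoothFn}

theorem IsConj.mul (h : IsConj θ D D') (k : IsConj θ K K') : IsConj θ (D * K) (D' * K') :=
  fun f => (congrArg D (k f)).trans (h _)

theorem IsConj.add (h : IsConj θ D D') (k : IsConj θ K K') : IsConj θ (D + K) (D' + K') := fun f => by
  rw [LinearMap.add_apply, LinearMap.add_apply, h, k, add_mul]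

theorem IsConj.smul (h : IsConj θ D D') (c : ℂ) : IsConj θ (c • D) (c • D') := fun f => by
  rw [LinearMap.smul_apply, LinearMap.smul_apply, h, smul_mul_assoc]

theorem IsConj.sub (h : IsConj θ D D') (k : IsConj θ K K') : IsConj θ (D - K) (D' - K') := fun f => by
  rw [LinearMap.sub_apply, LinearMap.sub_apply, h, k, sub_mul]

theorem IsConj.neg (h : IsConj θ D D') : IsConj θ (-D) (-D') := fun f => by
  rw [LinearMap.neg_apply, LinearMap.neg_apply, h, neg_mul]

theorem IsConj.pow (h : IsConj θ D D') (n : ℕ) : IsConj θ (D ^ n) (D' ^ n) := by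
  induction n with
  | zero => exact isConj_one θ
  | succ n ih => rw [pow_succ, pow_succ]; exact ih.mul h

end

theorem isConj_opE (θ η : ℝ) (i : Gen ⊕ Gen) :
    IsConj θ (opE field η i) (opE (hatField θ) η i) :=
  (isConj_one θ).sub (((isConj_field θ i).mul (isConj_field θ i)).smul _)

theorem isConj_opR (θ η : ℝ) : IsConj θ (opR field η) (opR (hatField θ) η) :=
  ((isConj_opE θ η _).mul (isConj_opE θ η _)).mul ((isConj_opE θ η _).mul (isConj_opE θ η _))

theorem isConj_opT (θ η : ℝ) : IsConj θ (opT field η) (opT (hatField θ) η) := by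
  have hX : IsConj θ (opX field) (opX (hatField θ)) := (isConj_field θ _).sub (isConj_field θ _)
  have hY : IsConj θ (opY field) (opY (hatField θ)) :=
    ((isConj_field θ _).add (isConj_field θ _)).sub ((isConj_one θ).smul _)
  exact (hX.mul hX).neg.sub (hY.mul ((isConj_opR θ η).mul hY))

/-- The multiplier of an invariant operator is its conjugate applied to the constant `1`. -/
theorem multiplier_eq {θ : ℝ} {P : EnvElt (Gen ⊕ Gen)} {D D' : Module.End ℂ SmoothFn}
    (hP : ∀ f : SmoothFn, invOp frame₂ P f.1 = (D f).1) (h : IsConj θ D D') :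
    multiplier frame₂ (fun x => Scan x / θ) P = (D' 1).1 := by
  funext x
  have h1 := hP (expS θ)
  have h2 := h 1
  rw [one_mul] at h2
  rw [h2] at h1
  rw [multiplier, show invOp frame₂ P (expPhase fun x => Scan x / θ) = _ from h1,
    SmoothFn.mul_apply, expS_apply, phase_apply, mul_left_comm, ← Complex.exp_add]
  simp

/-! ### The filtration by the degree in `X` and `Z` -/

/-- The functions that are polynomials in `X` and `Z` of degree less than `d`, with symbols in
`(a₁, a₂)` as coefficients. -/
inductive Filt (θ : ℝ) : ℕ → SmoothFn → Prop
  | coef {d : ℕ} {f : SmoothFn} (hf : IsCoef f) : Filt θ (d + 1) f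
  | mul_X {d : ℕ} {f : SmoothFn} (hf : Filt θ d f) : Filt θ (d + 1) (symX θ * f)
  | mul_Z {d : ℕ} {f : SmoothFn} (hf : Filt θ d f) : Filt θ (d + 1) (symZ θ * f)
  | add {d : ℕ} {f g : SmoothFn} (hf : Filt θ d f) (hg : Filt θ d g) : Filt θ d (f + g)
  | zero {d : ℕ} : Filt θ d 0

namespace Filt

variable {θ : ℝ} {d : ℕ} {f g : SmoothFn}

theorem coef_mul {c : SmoothFn} (hc : IsCoef c) (hf : Filt θ d f) : Filt θ d (c * f) := by
  induction hf with
  | coef hf => exact .coef (hc.mul hf)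
  | mul_X _ ih => rw [mul_left_comm]; exact ih.mul_X
  | mul_Z _ ih => rw [mul_left_comm]; exact ih.mul_Z
  | add _ _ ih ih' => rw [mul_add]; exact ih.add ih'
  | zero => rw [mul_zero]; exact .zero

theorem smul (hf : Filt θ d f) (c : ℂ) : Filt θ d (c • f) := by
  have := coef_mul (isCoef_one.smul c) hf
  rwa [smul_mul_assoc, one_mul] at this

theorem neg (hf : Filt θ d f) : Filt θ d (-f) := by
  rw [← neg_one_smul ℂ]
  exact hf.smul _

theorem sub (hf : Filt θ d f) (hg : Filt θ d g) : Filt θ d (f - g) := by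
  rw [sub_eq_add_neg]; exact hf.add hg.neg

theorem succ (hf : Filt θ d f) : Filt θ (d + 1) f := by
  induction hf with
  | coef hf => exact .coef hf
  | mul_X _ ih => exact ih.mul_X
  | mul_Z _ ih => exact ih.mul_Z
  | add _ _ ih ih' => exact ih.add ih'
  | zero => exact .zero

theorem eq_zero (hf : Filt θ 0 f) : f = 0 := by
  generalize hd : 0 = d at hf
  induction hf with
  | coef hf => cases hd
  | mul_X _ ih => cases hd
  | mul_Z _ ih => cases hd
  | add _ _ ih ih' => rw [ih hd, ih' hd, add_zero]
  | zero => rfl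

theorem field_inl_H (hf : Filt θ d f) : Filt θ d (field (Sum.inl Gen.H) f) := by
  induction hf with
  | coef hf => exact .coef (hf.field _)
  | mul_X hf ih =>
    rw [field_mul, field_inl_H_symX, add_mul, mul_assoc, mul_assoc]
    exact ((coef_mul isBddCoef_coefXX.isCoef hf.mul_X).add
      (coef_mul isBddCoef_coefXZ.isCoef hf.mul_Z)).add ih.mul_X
  | mul_Z hf ih =>
    rw [field_mul, field_inl_H_symZ, mul_assoc]
    exact (coef_mul isBddCoef_coefZ₁.isCoef hf.mul_Z).add ih.mul_Z
  | add _ _ ih ih' => rw [map_add]; exact ih.add ih'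
  | zero => rw [map_zero]; exact .zero

theorem field_inr_H (hf : Filt θ d f) : Filt θ d (field (Sum.inr Gen.H) f) := by
  induction hf with
  | coef hf => exact .coef (hf.field _)
  | mul_X hf ih =>
    rw [field_mul, field_inr_H_symX, field_inl_H_symX, neg_mul, add_mul, mul_assoc, mul_assoc]
    exact ((coef_mul isBddCoef_coefXX.isCoef hf.mul_X).add
      (coef_mul isBddCoef_coefXZ.isCoef hf.mul_Z)).neg.add ih.mul_X
  | mul_Z hf ih =>
    rw [field_mul, field_inr_H_symZ, mul_assoc]
    exact (coef_mul isBddCoef_coefZ₂.isCoef hf.mul_Z).add ih.mul_Z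
  | add _ _ ih ih' => rw [map_add]; exact ih.add ih'
  | zero => rw [map_zero]; exact .zero

end Filt

theorem isCoef_field_inl_E_symX (θ : ℝ) : IsCoef (field (Sum.inl Gen.E) (symX θ)) := by
  rw [field_inl_E_symX]
  exact (isCoef_expo_of_le norm_expo_0_2_le).smul _

theorem isCoef_field_inr_E_symX (θ : ℝ) : IsCoef (field (Sum.inr Gen.E) (symX θ)) := by
  rw [field_inr_E_symX]
  exact (isCoef_expo_of_le norm_expo_2_0_le).smul _

theorem isCoef_field_inl_E_symZ (θ : ℝ) : IsCoef (field (Sum.inl Gen.E) (symZ θ)) := by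
  rw [field_inl_E_symZ]
  exact (((isCoef_cosh₁.pow 2).mul (isCoef_cosh₂.pow 2)).mul
    (isCoef_expo_of_le norm_expo_0_m2_le)).smul _

theorem isCoef_field_inr_E_symZ (θ : ℝ) : IsCoef (field (Sum.inr Gen.E) (symZ θ)) := by
  rw [field_inr_E_symZ]
  exact (((isCoef_cosh₁.pow 2).mul (isCoef_cosh₂.pow 2)).mul
    (isCoef_expo_of_le norm_expo_m2_0_le)).smul _

/-- A derivation that kills the coefficients and maps `X` and `Z` to coefficients lowers the
degree. -/
theorem Filt.field_lower {θ : ℝ} {i : Gen ⊕ Gen} (h0 : ∀ f, IsCoef f → field i f = 0)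
    (hX : IsCoef (field i (symX θ))) (hZ : IsCoef (field i (symZ θ))) {d : ℕ} {f : SmoothFn}
    (hf : Filt θ d f) : Filt θ (d - 1) (field i f) := by
  induction hf with
  | coef hf => rw [h0 _ hf]; exact .zero
  | @mul_X d f hf ih =>
    rw [field_mul, Nat.add_sub_cancel]
    refine (coef_mul hX hf).add ?_
    rcases d with _ | d
    · rw [hf.eq_zero, map_zero, mul_zero]; exact .zero
    · exact ih.mul_X
  | @mul_Z d f hf ih =>
    rw [field_mul, Nat.add_sub_cancel]
    refine (coef_mul hZ hf).add ?_
    rcases d with _ | d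
    · rw [hf.eq_zero, map_zero, mul_zero]; exact .zero
    · exact ih.mul_Z
  | add _ _ ih ih' => rw [map_add]; exact ih.add ih'
  | zero => rw [map_zero]; exact .zero

/-- `A` is multiplication by the coefficient `a` up to terms of lower degree, and without such terms
on functions of `(a₁, a₂)`. -/
def HasTop (θ : ℝ) (A : Module.End ℂ SmoothFn) (a : SmoothFn) : Prop :=
  IsCoef a ∧ (∀ f, IsRadial f → A f = a * f) ∧
    ∀ d f, Filt θ (d + 1) f → Filt θ d (A f - a * f)

theorem HasTop.mul {θ : ℝ} {A B : Module.End ℂ SmoothFn} {a b : SmoothFn} (hA : HasTop θ A a)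
    (hB : HasTop θ B b) : HasTop θ (A * B) (a * b) := by
  refine ⟨hA.1.mul hB.1, fun f hf => ?_, fun d f hf => ?_⟩
  · rw [Module.End.mul_apply, hB.2.1 f hf, hA.2.1 _ (hB.1.1.mul hf), mul_assoc]
  · have h1 := hB.2.2 d f hf
    have h2 : Filt θ (d + 1) (B f) := by
      have := h1.succ.add (Filt.coef_mul hB.1 hf)
      rwa [sub_add_cancel] at this
    have := (hA.2.2 d _ h2).add (Filt.coef_mul hA.1 h1)
    rw [Module.End.mul_apply]
    convert this using 1
    ring

/-- The conjugate of `1 - θ² Eᵢ²` is `1 - θ² (Eᵢ + i Eᵢ S)²`, where `Eᵢ` lowers the degree; so its symbol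
is `1 + θ² (Eᵢ S)²`. -/
theorem hasTop_opE {θ : ℝ} {i : Gen ⊕ Gen} (h0 : ∀ f, IsRadial f → field i f = 0)
    (hX : IsCoef (field i (symX θ))) (hZ : IsCoef (field i (symZ θ))) {c : SmoothFn}
    (hc : IsCoef c) (hS : IsCoef (field i (phase θ)))
    (e : c = 1 + ((θ ^ 2 : ℝ) : ℂ) • (field i (phase θ) * field i (phase θ))) :
    HasTop θ (opE (hatField θ) θ i) c := by
  have key : ∀ f, opE (hatField θ) θ i f = c * f - ((θ ^ 2 : ℝ) : ℂ) •
      (field i (field i f) + (2 * Complex.I) • (field i (phase θ) * field i f)) := by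
    intro f
    have : opE (hatField θ) θ i f = f - ((θ ^ 2 : ℝ) : ℂ) • hatField θ i (hatField θ i f) := rfl
    rw [this, hatField_apply, hatField_apply, map_add, map_smul, field_mul, h0 _ hS.1, e]
    ext x
    simp only [SmoothFn.sub_apply, SmoothFn.smul_apply, SmoothFn.add_apply, SmoothFn.mul_apply,
      SmoothFn.zero_apply, SmoothFn.one_apply]
    linear_combination (-((θ ^ 2 : ℝ) : ℂ) * (field i (phase θ)).1 x ^ 2 * f.1 x) * Complex.I_sq
  refine ⟨hc, fun f hf => ?_, fun d f hf => ?_⟩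
  · rw [key, h0 f hf, map_zero, mul_zero, smul_zero, add_zero, smul_zero, sub_zero]
  · rw [key, sub_sub_cancel_left]
    have h1 : Filt θ d (field i f) := hf.field_lower (fun f hf => h0 f hf.1) hX hZ
    have h2 : Filt θ d (field i (field i f)) := by
      have := h1.field_lower (fun f hf => h0 f hf.1) hX hZ
      rcases d with _ | d
      · exact this
      · exact this.succ
    exact ((h2.add ((Filt.coef_mul hS h1).smul _)).smul _).neg

theorem isCoef_field_phase_inl_E (θ : ℝ) : IsCoef (field (Sum.inl Gen.E) (phase θ)) := by
  rw [field_phase_inl_E]; exact isCoef_sinh₂.smul _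

theorem isCoef_field_phase_inr_E (θ : ℝ) : IsCoef (field (Sum.inr Gen.E) (phase θ)) := by
  rw [field_phase_inr_E]; exact isCoef_sinh₁.smul _

theorem hasTop_opE₁ {θ : ℝ} (hθ : θ ≠ 0) :
    HasTop θ (opE (hatField θ) θ (Sum.inl Gen.E)) (cosh₂ ^ 2) := by
  refine hasTop_opE (fun f hf => hf.field_inl_E) (isCoef_field_inl_E_symX θ)
    (isCoef_field_inl_E_symZ θ) (isCoef_cosh₂.pow 2) (isCoef_field_phase_inl_E θ) ?_
  rw [field_phase_inl_E]
  ext x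
  have hv := Complex.exp_ne_zero (2 * x.2.a)
  have hθ' : (θ : ℂ) ≠ 0 := by exact_mod_cast hθ
  simp only [cosh₂, sinh₂, SmoothFn.sub_apply, SmoothFn.smul_apply, SmoothFn.add_apply,
    SmoothFn.mul_apply, SmoothFn.one_apply, SmoothFn.pow_apply, twoCosh_0_2, expo_0_2, expo_0_m2]
  push_cast
  field_simp
  ring

theorem hasTop_opE₂ {θ : ℝ} (hθ : θ ≠ 0) :
    HasTop θ (opE (hatField θ) θ (Sum.inr Gen.E)) (cosh₁ ^ 2) := by
  refine hasTop_opE (fun f hf => hf.field_inr_E) (isCoef_field_inr_E_symX θ)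
    (isCoef_field_inr_E_symZ θ) (isCoef_cosh₁.pow 2) (isCoef_field_phase_inr_E θ) ?_
  rw [field_phase_inr_E]
  ext x
  have hv := Complex.exp_ne_zero (2 * x.1.a)
  have hθ' : (θ : ℂ) ≠ 0 := by exact_mod_cast hθ
  simp only [cosh₁, sinh₁, SmoothFn.sub_apply, SmoothFn.smul_apply, SmoothFn.add_apply,
    SmoothFn.mul_apply, SmoothFn.one_apply, SmoothFn.pow_apply, twoCosh_2_0, expo_2_0, expo_m2_0]
  push_cast
  field_simp
  ring

theorem hasTop_opR {θ : ℝ} (hθ : θ ≠ 0) :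
    HasTop θ (opR (hatField θ) θ) ((cosh₁ * cosh₂) ^ 4) := by
  have h := ((hasTop_opE₁ hθ).mul (hasTop_opE₂ hθ)).mul ((hasTop_opE₂ hθ).mul (hasTop_opE₁ hθ))
  have e : (cosh₁ * cosh₂) ^ 4 = cosh₂ ^ 2 * cosh₁ ^ 2 * (cosh₁ ^ 2 * cosh₂ ^ 2) := by ring
  rw [e]
  exact h

theorem opR_pow_one {θ : ℝ} (hθ : θ ≠ 0) (n : ℕ) :
    (opR (hatField θ) θ ^ n) 1 = (cosh₁ * cosh₂) ^ (4 * n) := by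
  have h := hasTop_opR hθ
  have hr : ∀ n : ℕ, IsRadial ((cosh₁ * cosh₂) ^ n) := fun n =>
    ((isCoef_cosh₁.mul isCoef_cosh₂).pow n).1
  induction n with
  | zero => simp
  | succ n ih => rw [pow_succ', Module.End.mul_apply, ih, h.2.1 _ (hr _), ← pow_add]; ring_nf

theorem opX_hatField (θ : ℝ) (f : SmoothFn) : opX (hatField θ) f =
    field (Sum.inl Gen.H) f - field (Sum.inr Gen.H) f + Complex.I • (symX θ * f) := by
  rw [opX, LinearMap.sub_apply, hatField_apply, hatField_apply, ← field_phase_X, sub_mul, smul_sub]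
  abel

theorem opY_hatField (θ : ℝ) (f : SmoothFn) : opY (hatField θ) f =
    field (Sum.inl Gen.H) f + field (Sum.inr Gen.H) f - (2 : ℂ) • f +
      Complex.I • (symY θ * f) := by
  have : opY (hatField θ) f =
    hatField θ (Sum.inl Gen.H) f + hatField θ (Sum.inr Gen.H) f - ((2 : ℝ) : ℂ) • f := rfl
  rw [this, hatField_apply, hatField_apply, ← field_phase_Y, add_mul, smul_add,
    Complex.ofReal_ofNat]
  abel

theorem isCoef_sec₁ : IsCoef sec₁ := (isBddCoef_sec 2 0).isCoef

theorem isCoef_sec₂ : IsCoef sec₂ := (isBddCoef_sec 0 2).isCoef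

theorem Filt.mul_Y {θ : ℝ} {d : ℕ} {f : SmoothFn} (hf : Filt θ d f) :
    Filt θ (d + 1) (symY θ * f) := by
  rw [symY_eq, smul_mul_assoc, mul_assoc]
  exact (coef_mul ((isCoef_sec₁.pow 2).mul (isCoef_sec₂.pow 2)) hf.mul_Z).smul _

/-- The principal symbol of the conjugate of `T` is `X² + Z²`. -/
theorem Filt.opT_sub {θ : ℝ} (hθ : θ ≠ 0) {d : ℕ} {f : SmoothFn} (hf : Filt θ d f) :
    Filt θ (d + 1) (opT (hatField θ) θ f - (symX θ ^ 2 + symZ θ ^ 2) * f) := by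
  have hX : ∀ {d f}, Filt θ d f →
      Filt θ d (field (Sum.inl Gen.H) f - field (Sum.inr Gen.H) f) :=
    fun h => h.field_inl_H.sub h.field_inr_H
  have hY : ∀ {d f}, Filt θ d f →
      Filt θ d (field (Sum.inl Gen.H) f + field (Sum.inr Gen.H) f - (2 : ℂ) • f) :=
    fun h => (h.field_inl_H.add h.field_inr_H).sub (h.smul 2)
  have hYs : ∀ {d f}, Filt θ d f → Filt θ (d + 1) (opY (hatField θ) f) := fun {d f} h => by
    rw [opY_hatField]
    exact (hY h).succ.add (h.mul_Y.smul _)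
  have h1 : Filt θ (d + 1) (opX (hatField θ) (opX (hatField θ) f) + symX θ ^ 2 * f) := by
    have e : opX (hatField θ) (opX (hatField θ) f) + symX θ ^ 2 * f =
        (field (Sum.inl Gen.H) (opX (hatField θ) f) - field (Sum.inr Gen.H) (opX (hatField θ) f)) +
        Complex.I • (symX θ * (field (Sum.inl Gen.H) f - field (Sum.inr Gen.H) f)) := by
      rw [opX_hatField θ (opX (hatField θ) f)]
      conv_lhs => enter [1, 2, 2, 2]; rw [opX_hatField]
      ext x
      simp only [SmoothFn.sub_apply, SmoothFn.smul_apply, SmoothFn.add_apply, SmoothFn.mul_apply,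
        SmoothFn.pow_apply]
      linear_combination ((symX θ).1 x ^ 2 * f.1 x) * Complex.I_sq
    have h2 : Filt θ (d + 1) (opX (hatField θ) f) := by
      rw [opX_hatField]
      exact (hX hf).succ.add (hf.mul_X.smul _)
    rw [e]
    exact (hX h2).add ((hX hf).mul_X.smul _)
  have hR := hasTop_opR hθ
  set κ := (cosh₁ * cosh₂) ^ 4 with hκ
  have h2 : Filt θ (d + 1) (opY (hatField θ) (opR (hatField θ) θ (opY (hatField θ) f)) +
      symZ θ ^ 2 * f) := by
    have a1 := hYs (hR.2.2 d _ (hYs hf))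
    have a2 := hYs (Filt.coef_mul hR.1 (hY hf))
    have a3 := hY (Filt.coef_mul hR.1 (hf.mul_Y.smul Complex.I))
    convert (a1.add a2).add a3 using 1
    have e : opY (hatField θ) f = (field (Sum.inl Gen.H) f + field (Sum.inr Gen.H) f
      - (2 : ℂ) • f) + Complex.I • (symY θ * f) := opY_hatField θ f
    have e2 := opY_hatField θ (κ * (Complex.I • (symY θ * f)))
    have e3 : κ * opY (hatField θ) f = κ * (field (Sum.inl Gen.H) f + field (Sum.inr Gen.H) f
      - (2 : ℂ) • f) + κ * (Complex.I • (symY θ * f)) := by rw [e, mul_add]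
    rw [map_sub, e3, map_add, e2]
    have e4 : symZ θ ^ 2 * f + Complex.I • (symY θ * (κ * Complex.I • (symY θ * f))) = 0 := by
      ext x
      simp only [hκ, symZ, SmoothFn.smul_apply, SmoothFn.add_apply, SmoothFn.mul_apply,
        SmoothFn.pow_apply, SmoothFn.zero_apply]
      linear_combination ((cosh₁.1 x * cosh₂.1 x) ^ 4 * (symY θ).1 x ^ 2 * f.1 x) * Complex.I_sq
    rw [eq_neg_of_add_eq_zero_right e4]
    abel
  have e : opT (hatField θ) θ f = -opX (hatField θ) (opX (hatField θ) f) -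
      opY (hatField θ) (opR (hatField θ) θ (opY (hatField θ) f)) := rfl
  convert (h1.add h2).neg using 1
  rw [e]
  ring

/-- The multiplier of `T ^ N` is `(X² + Z²) ^ N` up to terms of lower degree. -/
theorem opT_pow_one_sub {θ : ℝ} (hθ : θ ≠ 0) (N : ℕ) :
    Filt θ (2 * N) ((opT (hatField θ) θ ^ N) 1 - (symX θ ^ 2 + symZ θ ^ 2) ^ N) := by
  have hQ : ∀ {d f}, Filt θ d f → Filt θ (d + 2) ((symX θ ^ 2 + symZ θ ^ 2) * f) := fun {d f} h => by
    rw [add_mul, pow_two, pow_two, mul_assoc, mul_assoc]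
    exact h.mul_X.mul_X.add h.mul_Z.mul_Z
  have hQN : ∀ N : ℕ, Filt θ (2 * N + 1) ((symX θ ^ 2 + symZ θ ^ 2) ^ N) := fun N => by
    induction N with
    | zero => exact .coef (by rw [pow_zero]; exact isCoef_one)
    | succ N ih => rw [pow_succ']; exact hQ ih
  induction N with
  | zero => rw [pow_zero, pow_zero, Module.End.one_apply, sub_self]; exact .zero
  | succ N ih =>
    have h1 := (hQN N).opT_sub hθ
    have h2 := ((ih.opT_sub hθ).succ.add (hQ ih)).add h1
    have e : 2 * (N + 1) = 2 * N + 1 + 1 := by ring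
    rw [e]
    convert h2 using 1
    rw [map_sub, pow_succ', Module.End.mul_apply, pow_succ']
    ring

/-! ### The size of the multiplier -/

/-- The function `|X| + |Z| + τ^k`. -/
def om (θ : ℝ) (k : ℕ) (x : AffGroup × AffGroup) : ℂ :=
  ((‖(symX θ).1 x‖ + ‖(symZ θ).1 x‖ + ‖tau.1 x‖ ^ k : ℝ) : ℂ)

theorem norm_om (θ : ℝ) (k : ℕ) (x : AffGroup × AffGroup) :
    ‖om θ k x‖ = ‖(symX θ).1 x‖ + ‖(symZ θ).1 x‖ + ‖tau.1 x‖ ^ k := by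
  rw [om, Complex.norm_real, Real.norm_of_nonneg (by positivity)]

theorem norm_tau_pow_le_om (θ : ℝ) {j k : ℕ} (h : j ≤ k) (x : AffGroup × AffGroup) :
    ‖tau.1 x‖ ^ j ≤ ‖om θ k x‖ := by
  rw [norm_om]
  have := pow_le_pow_right₀ (one_le_norm_tau x) h
  have h1 := norm_nonneg ((symX θ).1 x)
  have h2 := norm_nonneg ((symZ θ).1 x)
  linarith

theorem one_le_norm_om (θ : ℝ) (k : ℕ) (x : AffGroup × AffGroup) : 1 ≤ ‖om θ k x‖ := by
  simpa using norm_tau_pow_le_om θ (Nat.zero_le k) x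

theorem norm_om_mono (θ : ℝ) {j k : ℕ} (h : j ≤ k) (x : AffGroup × AffGroup) :
    ‖om θ j x‖ ≤ ‖om θ k x‖ := by
  rw [norm_om, norm_om]
  have := pow_le_pow_right₀ (one_le_norm_tau x) h
  linarith

/-- `X` and `Z` are symbols of their own size, up to a power of `τ`. -/
theorem exists_symX_symZ_mem (θ : ℝ) : ∃ k₀ : ℕ, ∀ k, k₀ ≤ k →
    (symX θ).1 ∈ scalarSymbols frame₂ (om θ k) ∧ (symZ θ).1 ∈ scalarSymbols frame₂ (om θ k) := by
  obtain ⟨r1, k1, h1⟩ := isCoef_field_inl_E_symX θ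
  obtain ⟨r2, k2, h2⟩ := isCoef_field_inr_E_symX θ
  obtain ⟨r3, k3, h3⟩ := isCoef_field_inl_E_symZ θ
  obtain ⟨r4, k4, h4⟩ := isCoef_field_inr_E_symZ θ
  refine ⟨k1 + k2 + k3 + k4, fun k hk => ?_⟩
  replace h1 := scalarSymbols.mono_tau (show k1 ≤ k by omega) h1
  replace h2 := scalarSymbols.mono_tau (show k2 ≤ k by omega) h2
  replace h3 := scalarSymbols.mono_tau (show k3 ≤ k by omega) h3
  replace h4 := scalarSymbols.mono_tau (show k4 ≤ k by omega) h4
  -- The functions `a X + b Z + c` are closed under the frame: `H₁, H₂` mix `X` and `Z` with bounded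
  -- coefficients, `E₁, E₂` map them to functions of `(a₁, a₂)`.
  let 𝒦 : Set SmoothFn := {f | ∃ a b c : SmoothFn, IsBddCoef a ∧ IsBddCoef b ∧ IsRadial c ∧
    c.1 ∈ scalarSymbols frame₂ (tau.1 ^ k) ∧ f = a * symX θ + b * symZ θ + c}
  have hmul : ∀ {a c : SmoothFn}, IsBddCoef a → c.1 ∈ scalarSymbols frame₂ (tau.1 ^ k) →
      (a * c).1 ∈ scalarSymbols frame₂ (tau.1 ^ k) := fun ha hc => by
    have := scalarSymbols.mul ha.2 hc
    rwa [one_mul] at this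
  have hd : ∀ f ∈ 𝒦, ∀ i, field i f ∈ 𝒦 := by
    rintro _ ⟨a, b, c, ha, hb, hc, hc', rfl⟩ i
    have hE : ∀ i, IsRadial (field i (symX θ)) → IsRadial (field i (symZ θ)) →
        (field i (symX θ)).1 ∈ scalarSymbols frame₂ (tau.1 ^ k) →
        (field i (symZ θ)).1 ∈ scalarSymbols frame₂ (tau.1 ^ k) →
        field i (a * symX θ + b * symZ θ + c) ∈ 𝒦 := fun i g1 g2 g3 g4 => by
      refine ⟨field i a, field i b, a * field i (symX θ) + b * field i (symZ θ) + field i c,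
        ha.field i, hb.field i, ((ha.1.mul g1).add (hb.1.mul g2)).add (hc.field i), ?_, ?_⟩
      · exact symbolSpace.add (symbolSpace.add (hmul ha g3) (hmul hb g4))
          (symbolSpace.leftField hc' i)
      · rw [map_add, map_add, field_mul, field_mul]
        ring
    rcases i with (i | i) <;> cases i
    · refine ⟨field (Sum.inl Gen.H) a + a * coefXX,
        field (Sum.inl Gen.H) b + (a * coefXZ + b * coefZ₁), field (Sum.inl Gen.H) c,
        (ha.field _).add (ha.mul isBddCoef_coefXX),
        (hb.field _).add ((ha.mul isBddCoef_coefXZ).add (hb.mul isBddCoef_coefZ₁)), hc.field _,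
        symbolSpace.leftField hc' _, ?_⟩
      rw [map_add, map_add, field_mul, field_mul, field_inl_H_symX, field_inl_H_symZ]
      ring
    · exact hE _ r1 r3 h1 h3
    · refine ⟨field (Sum.inr Gen.H) a - a * coefXX,
        field (Sum.inr Gen.H) b + (b * coefZ₂ - a * coefXZ), field (Sum.inr Gen.H) c,
        (ha.field _).sub (ha.mul isBddCoef_coefXX),
        (hb.field _).add ((hb.mul isBddCoef_coefZ₂).sub (ha.mul isBddCoef_coefXZ)), hc.field _,
        symbolSpace.leftField hc' _, ?_⟩
      rw [map_add, map_add, field_mul, field_mul, field_inr_H_symX, field_inl_H_symX,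
        field_inr_H_symZ]
      ring
    · exact hE _ r2 r4 h2 h4
  have hb : ∀ f ∈ 𝒦, ∃ C : ℝ, ∀ x, ‖f.1 x‖ ≤ C * ‖om θ k x‖ := by
    rintro _ ⟨a, b, c, ha, hb, hc, hc', rfl⟩
    obtain ⟨A, hA0, hA⟩ := scalarSymbols.norm_le ha.2
    obtain ⟨B, hB0, hB⟩ := scalarSymbols.norm_le hb.2
    obtain ⟨C, hC0, hC⟩ := scalarSymbols.norm_le hc'
    refine ⟨A + B + C, fun x => ?_⟩
    have e : (a * symX θ + b * symZ θ + c).1 x =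
      a.1 x * (symX θ).1 x + b.1 x * (symZ θ).1 x + c.1 x := rfl
    rw [e, norm_om]
    have hA := hA x
    have hB := hB x
    have hC := hC x
    rw [Pi.one_apply, norm_one, mul_one] at hA hB
    rw [Pi.pow_apply, norm_pow] at hC
    refine norm_add₃_le.trans ?_
    rw [norm_mul, norm_mul]
    have e1 := norm_nonneg ((symX θ).1 x)
    have e2 := norm_nonneg ((symZ θ).1 x)
    have e3 : 0 ≤ ‖tau.1 x‖ ^ k := by positivity
    have e4 := mul_le_mul_of_nonneg_right hA e1
    have e5 := mul_le_mul_of_nonneg_right hB e2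
    nlinarith [mul_nonneg hA0 e2, mul_nonneg hA0 e3, mul_nonneg hB0 e1, mul_nonneg hB0 e3,
      mul_nonneg hC0 e1, mul_nonneg hC0 e2]
  have hz : IsBddCoef 0 := by simpa using isBddCoef_one.smul 0
  have hz' : (0 : SmoothFn).1 ∈ scalarSymbols frame₂ (tau.1 ^ k) := symbolSpace.zero
  exact ⟨mem_scalarSymbols_of_closed 𝒦 hd hb ⟨1, 0, 0, isBddCoef_one, hz, hz.1, hz', by ring⟩,
    mem_scalarSymbols_of_closed 𝒦 hd hb ⟨0, 1, 0, hz, isBddCoef_one, hz.1, hz', by ring⟩⟩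

/-- Functions of degree less than `d` are symbols of the corresponding growth. -/
theorem Filt.exists_mem {θ : ℝ} {d : ℕ} {f : SmoothFn} (hf : Filt θ d f) :
    ∃ k : ℕ, f.1 ∈ scalarSymbols frame₂ (tau.1 ^ k * om θ 0 ^ (d - 1)) := by
  obtain ⟨k₀, hk₀⟩ := exists_symX_symZ_mem θ
  have hom : ∀ x, ‖om θ k₀ x‖ ≤ ‖tau.1 x‖ ^ k₀ * ‖om θ 0 x‖ := fun x => by
    rw [norm_om, norm_om, pow_zero]
    have h1 := one_le_pow₀ (n := k₀) (one_le_norm_tau x)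
    have h2 := norm_nonneg ((symX θ).1 x)
    have h3 := norm_nonneg ((symZ θ).1 x)
    nlinarith [mul_nonneg (sub_nonneg.2 h1) h2, mul_nonneg (sub_nonneg.2 h1) h3]
  have hmul : ∀ {d : ℕ} {f g : SmoothFn}, Filt θ d f → g.1 ∈ scalarSymbols frame₂ (om θ k₀) →
      (∃ k : ℕ, f.1 ∈ scalarSymbols frame₂ (tau.1 ^ k * om θ 0 ^ (d - 1))) →
      ∃ k : ℕ, (g * f).1 ∈ scalarSymbols frame₂ (tau.1 ^ k * om θ 0 ^ (d + 1 - 1)) := by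
    rintro d f g hf hg ⟨k, hk⟩
    refine ⟨k + k₀, ?_⟩
    rcases d with _ | d
    · rw [hf.eq_zero, mul_zero]
      exact symbolSpace.zero
    · refine symbolSpace.mono (scalarSymbols.mul hg hk) (C := 1) fun x => ?_
      simp only [Nat.add_sub_cancel, Pi.mul_apply, Pi.pow_apply, norm_mul, norm_pow, one_mul]
      calc ‖om θ k₀ x‖ * (‖tau.1 x‖ ^ k * ‖om θ 0 x‖ ^ d)
          ≤ (‖tau.1 x‖ ^ k₀ * ‖om θ 0 x‖) * (‖tau.1 x‖ ^ k * ‖om θ 0 x‖ ^ d) := by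
            gcongr; exact hom x
        _ = _ := by ring
  induction hf with
  | @coef d f hf =>
    obtain ⟨-, k, hk⟩ := hf
    refine ⟨k, symbolSpace.mono hk (C := 1) fun x => ?_⟩
    simp only [Pi.mul_apply, Pi.pow_apply, norm_mul, norm_pow, one_mul]
    exact le_mul_of_one_le_right (by positivity) (one_le_pow₀ (one_le_norm_om θ 0 x))
  | mul_X hf ih => exact hmul hf (hk₀ k₀ le_rfl).1 ih
  | mul_Z hf ih => exact hmul hf (hk₀ k₀ le_rfl).2 ih
  | @add d f g _ _ ih ih' =>
    obtain ⟨k, hk⟩ := ih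
    obtain ⟨k', hk'⟩ := ih'
    have hm : ∀ {k l : ℕ} {f : SmoothFn}, k ≤ l →
        f.1 ∈ scalarSymbols frame₂ (tau.1 ^ k * om θ 0 ^ (d - 1)) →
        f.1 ∈ scalarSymbols frame₂ (tau.1 ^ l * om θ 0 ^ (d - 1)) := fun {k l f} h hf => by
      refine symbolSpace.mono hf (C := 1) fun x => ?_
      simp only [Pi.mul_apply, Pi.pow_apply, norm_mul, norm_pow, one_mul]
      gcongr
      exact one_le_norm_tau x
    exact ⟨max k k', symbolSpace.add (hm (le_max_left k k') hk) (hm (le_max_right k k') hk')⟩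
  | zero => exact ⟨0, symbolSpace.zero⟩

/-- The elementary inequality behind the choice of the constant `lam`: the term `g` of lower degree
is absorbed by `q ^ N` where `r` is large compared to `K`, and by `lam * K ^ (2 * N)` elsewhere. -/
theorem exists_dominating_constant (N : ℕ) (hN : 0 < N) (C : ℝ) (hC : 0 ≤ C) :
    ∃ lam c : ℝ, ∀ (q r K : ℝ) (g : ℂ), 0 ≤ r → 0 ≤ K → r ^ 2 ≤ 2 * q →
      ‖g‖ ≤ C * (K * (r + K) ^ (2 * N - 1)) →
      (r + K) ^ (2 * N) ≤ c * ‖(q : ℂ) ^ N + g + (lam : ℂ) * (K : ℂ) ^ (2 * N)‖ := by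
  obtain ⟨n, hn⟩ : ∃ n, 2 * N = n + 1 := ⟨2 * N - 1, by omega⟩
  set M : ℝ := 1 + C * 2 ^ n * 2 ^ (N + 1) with hM
  have hM1 : 1 ≤ M := by
    have : 0 ≤ C * 2 ^ n * 2 ^ (N + 1) := by positivity
    linarith
  refine ⟨C * (M + 1) ^ n + 1, 2 ^ n * 2 ^ (N + 1), fun q r K g hr hK hq hg => ?_⟩
  have hn' : 2 * N - 1 = n := by omega
  rw [hn'] at hg
  rw [hn]
  have key : C * (K * (r + K) ^ n) ≤ r ^ (n + 1) / 2 ^ (N + 1) + C * (M + 1) ^ n * K ^ (n + 1) := by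
    rcases le_total (M * K) r with h | h
    · have h1 : K ≤ r / M := by rw [le_div_iff₀ (by linarith)]; linarith
      have h2 : K ≤ r := by nlinarith
      have h3 : C * (K * (r + K) ^ n) ≤ C * ((r / M) * (2 * r) ^ n) := by
        gcongr; linarith
      have h4 : C * ((r / M) * (2 * r) ^ n) ≤ r ^ (n + 1) / 2 ^ (N + 1) := by
        rw [le_div_iff₀ (by positivity), mul_pow]
        have : C * (r / M * (2 ^ n * r ^ n)) * 2 ^ (N + 1) =
          (C * 2 ^ n * 2 ^ (N + 1) / M) * r ^ (n + 1) := by ring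
        rw [this]
        have h5 : C * 2 ^ n * 2 ^ (N + 1) / M ≤ 1 := by
          rw [div_le_one (by linarith)]; linarith
        exact mul_le_of_le_one_left (by positivity) h5
      have h5 : 0 ≤ C * (M + 1) ^ n * K ^ (n + 1) := by positivity
      linarith
    · have h1 : C * (K * (r + K) ^ n) ≤ C * (K * ((M + 1) * K) ^ n) := by
        gcongr; linarith
      have h2 : C * (K * ((M + 1) * K) ^ n) = C * (M + 1) ^ n * K ^ (n + 1) := by
        rw [mul_pow]; ring
      have h3 : 0 ≤ r ^ (n + 1) / 2 ^ (N + 1) := by positivity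
      linarith
  have hqN : r ^ (n + 1) / 2 ^ N ≤ q ^ N := by
    rw [← hn, pow_mul, ← div_pow]
    exact pow_le_pow_left₀ (by positivity) (by linarith) N
  have hre : (q : ℂ) ^ N + g + ((C * (M + 1) ^ n + 1 : ℝ) : ℂ) * (K : ℂ) ^ (n + 1) =
      ((q ^ N + (C * (M + 1) ^ n + 1) * K ^ (n + 1) : ℝ) : ℂ) - (-g) := by
    push_cast; ring
  have hlow : (r ^ (n + 1) + K ^ (n + 1)) / 2 ^ (N + 1) ≤
      ‖(q : ℂ) ^ N + g + ((C * (M + 1) ^ n + 1 : ℝ) : ℂ) * (K : ℂ) ^ (n + 1)‖ := by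
    rw [hre]
    refine le_trans ?_ (norm_sub_norm_le _ _)
    rw [norm_neg, Complex.norm_real]
    refine le_trans ?_ (sub_le_sub (le_abs_self _) (hg.trans key))
    have e1 : r ^ (n + 1) / 2 ^ N = 2 * (r ^ (n + 1) / 2 ^ (N + 1)) := by
      rw [pow_succ 2 N]; field_simp
    have e2 : K ^ (n + 1) / 2 ^ (N + 1) ≤ K ^ (n + 1) :=
      div_le_self (by positivity) (one_le_pow₀ (by norm_num))
    rw [add_div]
    nlinarith
  calc (r + K) ^ (n + 1) ≤ 2 ^ n * (r ^ (n + 1) + K ^ (n + 1)) := by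
        simpa using add_pow_le hr hK (n + 1)
    _ = 2 ^ n * 2 ^ (N + 1) * ((r ^ (n + 1) + K ^ (n + 1)) / 2 ^ (N + 1)) := by field_simp
    _ ≤ _ := by gcongr

theorem exists_real_symX (θ : ℝ) (x : AffGroup × AffGroup) : ∃ r : ℝ, (symX θ).1 x = r :=
  ⟨2 / θ * (Real.exp (2 * x.1.a + 0 * x.2.a) * x.2.l + Real.exp (0 * x.1.a + 2 * x.2.a) * x.1.l), by
    rw [symX, SmoothFn.smul_apply, SmoothFn.add_apply, SmoothFn.mul_apply, SmoothFn.mul_apply,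
      expo_apply, expo_apply, coordL₁_apply, coordL₂_apply]
    push_cast; rfl⟩

theorem exists_real_symY (θ : ℝ) (x : AffGroup × AffGroup) : ∃ r : ℝ, (symY θ).1 x = r :=
  ⟨2 / θ * (Real.exp (-2 * x.1.a + 0 * x.2.a) * x.2.l -
    Real.exp (0 * x.1.a + -2 * x.2.a) * x.1.l), by
    rw [symY, SmoothFn.smul_apply, SmoothFn.sub_apply, SmoothFn.mul_apply, SmoothFn.mul_apply,
      expo_apply, expo_apply, coordL₁_apply, coordL₂_apply]
    push_cast; rfl⟩

theorem cosh₁_apply (x : AffGroup × AffGroup) : cosh₁.1 x = (Real.cosh (2 * x.1.a) : ℂ) := by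
  rw [cosh₁, SmoothFn.smul_apply, twoCosh_apply, zero_mul, add_zero]
  push_cast; ring

theorem cosh₂_apply (x : AffGroup × AffGroup) : cosh₂.1 x = (Real.cosh (2 * x.2.a) : ℂ) := by
  rw [cosh₂, SmoothFn.smul_apply, twoCosh_apply, zero_mul, zero_add]
  push_cast; ring

theorem exists_real_symZ (θ : ℝ) (x : AffGroup × AffGroup) : ∃ r : ℝ, (symZ θ).1 x = r := by
  obtain ⟨r, hr⟩ := exists_real_symY θ x
  refine ⟨Real.cosh (2 * x.1.a) ^ 2 * Real.cosh (2 * x.2.a) ^ 2 * r, ?_⟩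
  rw [symZ, SmoothFn.mul_apply, SmoothFn.mul_apply, SmoothFn.pow_apply, SmoothFn.pow_apply, hr,
    cosh₁_apply, cosh₂_apply]
  push_cast; rfl

theorem norm_symY_le (θ : ℝ) (x : AffGroup × AffGroup) : ‖(symY θ).1 x‖ ≤ ‖(symZ θ).1 x‖ := by
  have h1 := Real.one_le_cosh (2 * x.1.a)
  have h2 := Real.one_le_cosh (2 * x.2.a)
  rw [symZ, SmoothFn.mul_apply, SmoothFn.mul_apply, SmoothFn.pow_apply, SmoothFn.pow_apply,
    cosh₁_apply, cosh₂_apply, norm_mul, norm_mul, norm_pow, norm_pow, Complex.norm_real,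
    Complex.norm_real, Real.norm_of_nonneg (by linarith), Real.norm_of_nonneg (by linarith)]
  exact le_mul_of_one_le_left (norm_nonneg _)
    (one_le_mul_of_one_le_of_one_le (one_le_pow₀ h1) (one_le_pow₀ h2))

theorem tau_eq (x : AffGroup × AffGroup) : tau.1 x = (‖tau.1 x‖ : ℂ) := by
  rw [norm_tau, tau, SmoothFn.mul_apply, twoCosh_apply, twoCosh_apply]
  simp

/-- For every `N` there is a formally self-adjoint invariant operator whose multiplier is a weight
bounded below by `(|X| + |Z| + τ)^{2N}`, namely `T ^ N` plus a large multiple of a power of `R`. -/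
theorem exists_isWeight_multiplier {θ : ℝ} (hθ : 0 < θ) (N : ℕ) (hN : 0 < N) :
    ∃ P : EnvElt (Gen ⊕ Gen), IsSelfAdj frame₂ volume P ∧
      IsWeight frame₂ (multiplier frame₂ (fun x => Scan x / θ) P) ∧
      ∃ c : ℝ, ∀ x, ‖om θ 1 x‖ ^ (2 * N) ≤ c * ‖multiplier frame₂ (fun x => Scan x / θ) P x‖ := by
  have hθ' := hθ.ne'
  obtain ⟨k₀, hk₀⟩ := exists_symX_symZ_mem θ
  obtain ⟨k, hk⟩ := (opT_pow_one_sub hθ' N).exists_mem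
  set g : SmoothFn := (opT (hatField θ) θ ^ N) 1 - (symX θ ^ 2 + symZ θ ^ 2) ^ N with hg
  obtain ⟨C, hC0, hC⟩ := scalarSymbols.norm_le hk
  obtain ⟨lam, c, hc⟩ := exists_dominating_constant N hN C hC0
  -- `κ ^ n` is `τ ^ (4 n)` up to a constant; `n = N j` makes this `(τ ^ K) ^ (2 N)` with `K = 2 j`,
  -- large enough to absorb the powers `τ ^ k₀` and `τ ^ k` from the terms of lower degree.
  set j : ℕ := k₀ + k + 1 with hj
  set K : ℕ := 2 * j with hKdef
  set n : ℕ := N * j with hn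
  obtain ⟨P, hP⟩ := ((isInvOp_opT θ).pow N).add
    (((isInvOp_opR θ).pow n).smul (lam * 4 ^ (4 * n)))
  have hself : IsSelfAdj frame₂ volume P :=
    (((isTranspose_opT θ).pow N).add (((isTranspose_opR θ).pow n).smul _)).isSelfAdj hP
  have hconj := ((isConj_opT θ θ).pow N).add
    (((isConj_opR θ θ).pow n).smul ((lam * 4 ^ (4 * n) : ℝ) : ℂ))
  have hm := multiplier_eq hP hconj
  set m : SmoothFn := (opT (hatField θ) θ ^ N +
    ((lam * 4 ^ (4 * n) : ℝ) : ℂ) • opR (hatField θ) θ ^ n : Module.End ℂ SmoothFn) 1 with hmdef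
  have hm' : m = (symX θ ^ 2 + symZ θ ^ 2) ^ N + g + (lam : ℂ) • tau ^ (4 * n) := by
    have e : m = (opT (hatField θ) θ ^ N) 1 +
      ((lam * 4 ^ (4 * n) : ℝ) : ℂ) • (opR (hatField θ) θ ^ n) 1 := rfl
    have e2 : tau = (4 : ℂ) • (cosh₁ * cosh₂) := by
      ext x
      simp only [tau, cosh₁, cosh₂, SmoothFn.smul_apply, SmoothFn.mul_apply]
      ring
    rw [e, opR_pow_one hθ', hg, e2, smul_pow, smul_smul]
    push_cast
    ring
  have hlow : ∀ x, ‖om θ K x‖ ^ (2 * N) ≤ c * ‖m.1 x‖ := by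
    intro x
    obtain ⟨r, hr⟩ := exists_real_symX θ x
    obtain ⟨z, hz⟩ := exists_real_symZ θ x
    have e : m.1 x = ((r ^ 2 + z ^ 2 : ℝ) : ℂ) ^ N + g.1 x +
        (lam : ℂ) * ((‖tau.1 x‖ ^ K : ℝ) : ℂ) ^ (2 * N) := by
      rw [hm', SmoothFn.add_apply, SmoothFn.add_apply, SmoothFn.smul_apply, SmoothFn.pow_apply,
        SmoothFn.pow_apply, SmoothFn.add_apply, SmoothFn.pow_apply, SmoothFn.pow_apply, hr, hz]
      conv_lhs => rw [tau_eq]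
      push_cast
      rw [← pow_mul]
      congr 3
      rw [hn, hKdef]
      ring
    have h1 := hc (r ^ 2 + z ^ 2) (|r| + |z|) (‖tau.1 x‖ ^ K) (g.1 x) (by positivity)
      (by positivity) (by nlinarith [sq_abs r, sq_abs z, sq_nonneg (|r| - |z|)]) ?_
    · rw [← e] at h1
      rwa [norm_om, hr, hz, Complex.norm_real, Complex.norm_real]
    · refine (hC x).trans ?_
      rw [Pi.mul_apply, Pi.pow_apply, Pi.pow_apply, norm_mul, norm_pow, norm_pow]
      have h2 : |r| + |z| + ‖tau.1 x‖ ^ K = ‖om θ K x‖ := by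
        rw [norm_om, hr, hz, Complex.norm_real, Complex.norm_real]; rfl
      rw [h2]
      gcongr
      · exact one_le_norm_tau x
      · omega
      · exact norm_om_mono θ (Nat.zero_le K) x
  have hmem : m.1 ∈ scalarSymbols frame₂ (om θ K ^ (2 * N)) := by
    obtain ⟨hX, hZ⟩ := hk₀ K (by omega)
    have h1 : ((symX θ ^ 2 + symZ θ ^ 2) ^ N : SmoothFn).1 ∈
        scalarSymbols frame₂ (om θ K ^ (2 * N)) := by
      rw [pow_mul]
      exact scalarSymbols.pow (symbolSpace.add (scalarSymbols.pow hX 2) (scalarSymbols.pow hZ 2)) N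
    have h2 : g.1 ∈ scalarSymbols frame₂ (om θ K ^ (2 * N)) := by
      refine symbolSpace.mono hk (C := 1) fun x => ?_
      rw [one_mul, Pi.mul_apply, Pi.pow_apply, Pi.pow_apply, Pi.pow_apply, norm_mul, norm_pow,
        norm_pow, norm_pow]
      obtain ⟨b, hb⟩ : ∃ b, 2 * N = b + 1 := ⟨2 * N - 1, by omega⟩
      rw [hb, Nat.add_sub_cancel, pow_succ']
      gcongr
      · exact norm_tau_pow_le_om θ (by omega) x
      · exact norm_om_mono θ (Nat.zero_le K) x
    have h3 : ((lam : ℂ) • tau ^ (4 * n) : SmoothFn).1 ∈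
        scalarSymbols frame₂ (om θ K ^ (2 * N)) := by
      have := scalarSymbols.pow isWeight_tau.2 (4 * n)
      refine symbolSpace.const_smul (symbolSpace.mono this (C := 1) fun x => ?_) _
      rw [one_mul, Pi.pow_apply, Pi.pow_apply, norm_pow, norm_pow,
        show 4 * n = K * (2 * N) by rw [hn, hKdef]; ring, pow_mul]
      exact pow_le_pow_left₀ (by positivity) (norm_tau_pow_le_om θ le_rfl x) _
    rw [hm']
    exact symbolSpace.add (symbolSpace.add h1 h2) h3
  refine ⟨P, hself, ?_, c, fun x => ?_⟩
  · rw [hm]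
    refine ⟨fun x h0 => ?_, symbolSpace.mono hmem (C := c) fun x => by
      rw [Pi.pow_apply, norm_pow]; exact hlow x⟩
    have := hlow x
    rw [h0, norm_zero, mul_zero] at this
    have h1 := one_le_pow₀ (n := 2 * N) (one_le_norm_om θ K x)
    linarith
  · rw [hm]
    exact (pow_le_pow_left₀ (norm_nonneg _) (norm_om_mono θ (by omega) x) _).trans (hlow x)

/-! ### Adapted operators of arbitrary decay -/

/-- The function `(1 + a₁²) (1 + ℓ₁²) (1 + a₂²) (1 + ℓ₂²)`, with integrable inverse. -/
def den (x : AffGroup × AffGroup) : ℝ :=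
  (1 + x.1.a ^ 2) * (1 + x.1.l ^ 2) * ((1 + x.2.a ^ 2) * (1 + x.2.l ^ 2))

theorem den_pos (x : AffGroup × AffGroup) : 0 < den x := by unfold den; positivity

theorem integrable_inv_den : Integrable (fun x => (den x)⁻¹) volume := by
  have h1 : Integrable (fun y : ℝ × ℝ => (1 + y.1 ^ 2)⁻¹ * (1 + y.2 ^ 2)⁻¹) (volume.prod volume) :=
    integrable_inv_one_add_sq.mul_prod integrable_inv_one_add_sq
  have h2 : Integrable (fun y : AffGroup => (1 + y.a ^ 2)⁻¹ * (1 + y.l ^ 2)⁻¹) volume := h1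
  have h3 : Integrable (fun x : AffGroup × AffGroup =>
      ((1 + x.1.a ^ 2)⁻¹ * (1 + x.1.l ^ 2)⁻¹) * ((1 + x.2.a ^ 2)⁻¹ * (1 + x.2.l ^ 2)⁻¹))
      (volume.prod volume) := h2.mul_prod h2
  refine h3.congr (Eventually.of_forall fun x => ?_)
  simp only [den, mul_inv]

theorem integrable_of_norm_mul_den_le {f : AffGroup × AffGroup → ℂ} (hf : Continuous f) {C : ℝ}
    (h : ∀ x, ‖f x‖ * den x ≤ C) : Integrable f volume := by
  refine (integrable_inv_den.const_mul C).mono' hf.aestronglyMeasurable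
    (Eventually.of_forall fun x => ?_)
  rw [← div_eq_mul_inv, le_div_iff₀ (den_pos x)]
  exact h x

/-- The function `1 + |ℓ₁| + |ℓ₂| + e^{-2 a₁} + e^{-2 a₂}`, which bounds the coefficients that appear
when left-invariant fields are exchanged for right-invariant ones. -/
def rho (x : AffGroup × AffGroup) : ℝ :=
  1 + |x.1.l| + |x.2.l| + Real.exp (-2 * x.1.a) + Real.exp (-2 * x.2.a)

theorem one_le_rho (x : AffGroup × AffGroup) : 1 ≤ rho x := by
  have := abs_nonneg x.1.l
  have := abs_nonneg x.2.l
  have := Real.exp_pos (-2 * x.1.a)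
  have := Real.exp_pos (-2 * x.2.a)
  unfold rho
  linarith

theorem one_add_sq_le_two_cosh (y : ℝ) : 1 + y ^ 2 ≤ 2 * Real.cosh (2 * y) := by
  have h := Real.quadratic_le_exp_of_nonneg (abs_nonneg (2 * y))
  have h2 := exp_le_two_cosh |2 * y|
  rw [Real.cosh_abs] at h2
  have h3 := sq_abs (2 * y)
  have h4 := abs_nonneg (2 * y)
  nlinarith

theorem norm_expo_le_om {θ s t : ℝ} {x : AffGroup × AffGroup}
    (h : ‖(expo s t).1 x‖ ≤ ‖tau.1 x‖) : ‖(expo s t).1 x‖ ≤ ‖om θ 1 x‖ :=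
  h.trans (by simpa using norm_tau_pow_le_om θ (le_refl 1) x)

theorem norm_symX_add_symY_le (θ : ℝ) (x : AffGroup × AffGroup) :
    ‖(symX θ).1 x‖ + ‖(symY θ).1 x‖ ≤ ‖om θ 1 x‖ := by
  rw [norm_om]
  have := norm_symY_le θ x
  have : 0 ≤ ‖tau.1 x‖ ^ 1 := by positivity
  linarith

/-- The coordinates `ℓ₁, ℓ₂` in terms of `X` and `Y`: the linear system that defines the latter has
determinant proportional to `cosh (2 (a₁ - a₂))`, which is at least `1`. -/
theorem abs_l_le {θ : ℝ} (hθ : 0 < θ) (x : AffGroup × AffGroup) :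
    |x.1.l| ≤ θ * ‖om θ 1 x‖ ^ 2 ∧ |x.2.l| ≤ θ * ‖om θ 1 x‖ ^ 2 := by
  have hθ' : (θ : ℂ) ≠ 0 := by exact_mod_cast hθ.ne'
  have hu := Complex.exp_ne_zero (2 * x.1.a)
  have hv := Complex.exp_ne_zero (2 * x.2.a)
  have h1 := one_le_norm_twoCosh 2 (-2) x
  have e1 : (twoCosh 2 (-2)).1 x * coordL₁.1 x = (θ / 2 : ℂ) *
      ((expo (-2) 0).1 x * (symX θ).1 x - (expo 2 0).1 x * (symY θ).1 x) := by
    simp only [twoCosh_2_m2, symX, symY, expo_2_0, expo_m2_0, expo_0_2, expo_0_m2,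
      SmoothFn.smul_apply, SmoothFn.add_apply, SmoothFn.sub_apply, SmoothFn.mul_apply]
    field_simp
    ring
  have e2 : (twoCosh 2 (-2)).1 x * coordL₂.1 x = (θ / 2 : ℂ) *
      ((expo 0 (-2)).1 x * (symX θ).1 x + (expo 0 2).1 x * (symY θ).1 x) := by
    simp only [twoCosh_2_m2, symX, symY, expo_2_0, expo_m2_0, expo_0_2, expo_0_m2,
      SmoothFn.smul_apply, SmoothFn.add_apply, SmoothFn.sub_apply, SmoothFn.mul_apply]
    field_simp
    ring
  have hn : ‖(θ / 2 : ℂ)‖ = θ / 2 := by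
    rw [norm_div, Complex.norm_real, Real.norm_of_nonneg hθ.le, Complex.norm_two]
  have hXY := norm_symX_add_symY_le θ x
  have gen : ∀ {l s t : ℂ}, (twoCosh 2 (-2)).1 x * l = (θ / 2 : ℂ) *
      (s * (symX θ).1 x + t * (symY θ).1 x) → ‖s‖ ≤ ‖om θ 1 x‖ → ‖t‖ ≤ ‖om θ 1 x‖ →
      ‖l‖ ≤ θ * ‖om θ 1 x‖ ^ 2 := by
    intro l s t e hs ht
    have h2 : ‖l‖ ≤ ‖(twoCosh 2 (-2)).1 x * l‖ := by
      rw [norm_mul]; exact le_mul_of_one_le_left (norm_nonneg _) h1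
    refine h2.trans ?_
    rw [e, norm_mul, hn]
    have h3 : ‖s * (symX θ).1 x + t * (symY θ).1 x‖ ≤
        ‖om θ 1 x‖ * (‖(symX θ).1 x‖ + ‖(symY θ).1 x‖) := by
      refine (norm_add_le _ _).trans ?_
      rw [norm_mul, norm_mul, mul_add]
      gcongr
    have h4 : ‖om θ 1 x‖ * (‖(symX θ).1 x‖ + ‖(symY θ).1 x‖) ≤ ‖om θ 1 x‖ ^ 2 := by
      rw [pow_two]; gcongr
    nlinarith [sq_nonneg ‖om θ 1 x‖]
  constructor
  · have := gen (l := coordL₁.1 x) (s := (expo (-2) 0).1 x) (t := -(expo 2 0).1 x)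
      (by rw [e1]; ring) (norm_expo_le_om (norm_expo_m2_0_le x))
      (by rw [norm_neg]; exact norm_expo_le_om (norm_expo_2_0_le x))
    rwa [coordL₁_apply, Complex.norm_real] at this
  · have := gen (l := coordL₂.1 x) (s := (expo 0 (-2)).1 x) (t := (expo 0 2).1 x)
      e2 (norm_expo_le_om (norm_expo_0_m2_le x)) (norm_expo_le_om (norm_expo_0_2_le x))
    rwa [coordL₂_apply, Complex.norm_real] at this

theorem growth_le {θ : ℝ} (hθ : 0 < θ) (M : ℕ) : ∃ C : ℝ, 0 ≤ C ∧ ∀ x,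
    rho x ^ M * ‖tau.1 x‖ ^ M * den x ≤ C * ‖om θ 1 x‖ ^ (3 * M + 10) := by
  refine ⟨(3 + 2 * θ) ^ M * (1 + θ ^ 2) ^ 2, by positivity, fun x => ?_⟩
  obtain ⟨hl1, hl2⟩ := abs_l_le hθ x
  have hw := one_le_norm_om θ 1 x
  have ht : ‖tau.1 x‖ ≤ ‖om θ 1 x‖ := by simpa using norm_tau_pow_le_om θ (le_refl 1) x
  have he1 := norm_expo_le_om (θ := θ) (norm_expo_m2_0_le x)
  have he2 := norm_expo_le_om (θ := θ) (norm_expo_0_m2_le x)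
  rw [norm_expo, zero_mul, add_zero] at he1
  rw [norm_expo, zero_mul, zero_add] at he2
  have ha1 : 1 + x.1.a ^ 2 ≤ ‖om θ 1 x‖ :=
    (one_add_sq_le_two_cosh _).trans ((two_cosh_le_norm_tau₁ x).trans ht)
  have ha2 : 1 + x.2.a ^ 2 ≤ ‖om θ 1 x‖ :=
    (one_add_sq_le_two_cosh _).trans ((two_cosh_le_norm_tau₂ x).trans ht)
  generalize ‖om θ 1 x‖ = w at *
  have hsq : ∀ l : ℝ, |l| ≤ θ * w ^ 2 → 1 + l ^ 2 ≤ (1 + θ ^ 2) * w ^ 4 := fun l hl => by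
    have h1 : l ^ 2 ≤ (θ * w ^ 2) ^ 2 := by
      rw [← sq_abs]; exact pow_le_pow_left₀ (abs_nonneg l) hl 2
    have h2 : 1 ≤ w ^ 4 := one_le_pow₀ hw
    nlinarith
  have hrho : rho x ≤ (3 + 2 * θ) * w ^ 2 := by
    unfold rho
    have : w ≤ w ^ 2 := by nlinarith
    have : 1 ≤ w ^ 2 := by nlinarith
    linarith
  have hrho0 : 0 ≤ rho x := zero_le_one.trans (one_le_rho x)
  calc rho x ^ M * ‖tau.1 x‖ ^ M * den x
      ≤ ((3 + 2 * θ) * w ^ 2) ^ M * w ^ M *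
        ((w * ((1 + θ ^ 2) * w ^ 4)) * (w * ((1 + θ ^ 2) * w ^ 4))) := by
        unfold den
        gcongr
        · exact hsq _ hl1
        · exact hsq _ hl2
    _ = _ := by
        rw [mul_pow, ← pow_mul]
        ring

/-- There are adapted operators whose multiplier grows as fast as desired. -/
theorem exists_isAdapted {θ : ℝ} (hθ : 0 < θ) (M : ℕ) : ∃ P : EnvElt (Gen ⊕ Gen),
    IsAdapted frame₂ volume (fun x => Scan x / θ) P ∧ IsSelfAdj frame₂ volume P ∧
    ∃ C : ℝ, ∀ x, rho x ^ M * ‖tau.1 x‖ ^ M * den x ≤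
      C * ‖multiplier frame₂ (fun x => Scan x / θ) P x‖ := by
  obtain ⟨P, hself, hweight, c, hc⟩ := exists_isWeight_multiplier hθ (3 * M + 10) (by omega)
  obtain ⟨D, hD0, hD⟩ := growth_le hθ M
  have hbound : ∀ x, rho x ^ M * ‖tau.1 x‖ ^ M * den x ≤
      (D * c) * ‖multiplier frame₂ (fun x => Scan x / θ) P x‖ := fun x => by
    have h1 : ‖om θ 1 x‖ ^ (3 * M + 10) ≤ ‖om θ 1 x‖ ^ (2 * (3 * M + 10)) :=
      pow_le_pow_right₀ (one_le_norm_om θ 1 x) (by omega)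
    calc _ ≤ D * ‖om θ 1 x‖ ^ (3 * M + 10) := hD x
      _ ≤ D * (c * ‖multiplier frame₂ (fun x => Scan x / θ) P x‖) := by
        gcongr; exact h1.trans (hc x)
      _ = _ := by ring
  refine ⟨P, ⟨hweight, ?_⟩, hself, _, hbound⟩
  refine integrable_of_norm_mul_den_le (hweight.inv_mem frame₂_zero).1.continuous (C := D * c)
    fun x => ?_
  have h0 := norm_pos_iff.2 (hweight.1 x)
  have h1 : den x ≤ rho x ^ M * ‖tau.1 x‖ ^ M * den x :=
    le_mul_of_one_le_left (den_pos x).le (one_le_mul_of_one_le_of_one_le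
      (one_le_pow₀ (one_le_rho x)) (one_le_pow₀ (one_le_norm_tau x)))
  rw [norm_inv, inv_mul_le_iff₀ h0, mul_comm]
  exact h1.trans (hbound x)

/-! ### The amplitude is a symbol -/

theorem two_cosh_sub_le (y z : ℝ) :
    2 * Real.cosh (y - z) ≤ (2 * Real.cosh y) * (2 * Real.cosh z) := by
  have h := Real.cosh_add y z
  have h2 := Real.cosh_sub y z
  have h3 := Real.cosh_pos (y + z)
  linarith

theorem norm_twoCosh_diff_le (x : AffGroup × AffGroup) :
    ‖(twoCosh 2 (-2)).1 x‖ ≤ ‖tau.1 x‖ := by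
  rw [norm_twoCosh, norm_tau, neg_mul, ← sub_eq_add_neg]
  exact two_cosh_sub_le _ _

/-- The square root of `|Jac_Φ|`, as a smooth function. -/
def ampl : SmoothFn := ofCoord (fun y => Real.sqrt (16 * Real.cosh (2 * y.1.1) *
    Real.cosh (2 * y.1.1 + -2 * y.2.1) * Real.cosh (2 * y.2.1))) <| by
  refine ContDiff.sqrt (by fun_prop) fun y => ?_
  have h1 := Real.cosh_pos (2 * y.1.1)
  have h2 := Real.cosh_pos (2 * y.1.1 + -2 * y.2.1)
  have h3 := Real.cosh_pos (2 * y.2.1)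
  positivity

theorem ampl_apply (x : AffGroup × AffGroup) : ampl.1 x = (Acan x : ℂ) := by
  have h1 := Real.cosh_pos (2 * x.1.a)
  have h2 := Real.cosh_pos (2 * x.1.a + -2 * x.2.a)
  have h3 := Real.cosh_pos (2 * x.2.a)
  have e1 : (2 * ((1 : AffGroup).a - x.1.a)) = -(2 * x.1.a) := by rw [one_def, a_mk]; ring
  have e2 : (2 * (x.2.a - (1 : AffGroup).a)) = 2 * x.2.a := by rw [one_def, a_mk]; ring
  have e3 : (2 * (x.1.a - x.2.a)) = 2 * x.1.a + -2 * x.2.a := by ring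
  have e : JacPhi ![1, x.1, x.2] = 16 * Real.cosh (2 * x.1.a) *
      Real.cosh (2 * x.1.a + -2 * x.2.a) * Real.cosh (2 * x.2.a) := by
    rw [JacPhi_eq]
    simp only [Matrix.cons_val_zero, Matrix.cons_val_one, Matrix.cons_val, e1, e2, e3,
      Real.cosh_neg]
  rw [Acan, e, abs_of_pos (by positivity)]
  rfl

/-- The Jacobian, as a weight. -/
def jac : SmoothFn := (2 : ℂ) • (tau * twoCosh 2 (-2))

theorem isWeight_jac : IsWeight frame₂ jac.1 := by
  have h := IsWeight.mul isWeight_tau (isWeight_twoCosh 2 (-2))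
  refine ⟨fun x => mul_ne_zero two_ne_zero (h.1 x), symbolSpace.const_smul
    (symbolSpace.mono h.2 (C := 1) fun x => ?_) 2⟩
  have e : jac.1 x = 2 * (tau.1 * (twoCosh 2 (-2)).1) x := rfl
  rw [one_mul, e, norm_mul, Complex.norm_two]
  linarith [norm_nonneg ((tau.1 * (twoCosh 2 (-2)).1) x)]

theorem ampl_mul_ampl : ampl * ampl = jac := by
  ext x
  have h1 := Real.cosh_pos (2 * x.1.a)
  have h2 := Real.cosh_pos (2 * x.1.a + -2 * x.2.a)
  have h3 := Real.cosh_pos (2 * x.2.a)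
  have e : ampl.1 x = (Real.sqrt (16 * Real.cosh (2 * x.1.a) *
    Real.cosh (2 * x.1.a + -2 * x.2.a) * Real.cosh (2 * x.2.a)) : ℂ) := rfl
  rw [SmoothFn.mul_apply, e, ← Complex.ofReal_mul, Real.mul_self_sqrt (by positivity), jac,
    SmoothFn.smul_apply, SmoothFn.mul_apply, tau, SmoothFn.mul_apply, twoCosh_apply, twoCosh_apply,
    twoCosh_apply, zero_mul, zero_mul, add_zero, zero_add]
  push_cast
  ring

theorem ampl_ne_zero (x : AffGroup × AffGroup) : ampl.1 x ≠ 0 := fun h => by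
  have := isWeight_jac.1 x
  rw [← ampl_mul_ampl, SmoothFn.mul_apply, h, zero_mul] at this
  exact this rfl

/-- The logarithmic derivative of the amplitude is half of that of the Jacobian. -/
theorem field_ampl (i : Gen ⊕ Gen) :
    field i ampl = ((1 / 2 : ℂ) • (field i jac * invFn jac isWeight_jac)) * ampl := by
  ext x
  have h0 := ampl_ne_zero x
  have h := congrArg (fun f : SmoothFn => f.1 x) (field_mul i ampl ampl)
  rw [ampl_mul_ampl] at h
  simp only [SmoothFn.add_apply, SmoothFn.mul_apply] at h
  rw [SmoothFn.mul_apply, SmoothFn.smul_apply, SmoothFn.mul_apply, invFn_apply, h,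
    show jac.1 x = ampl.1 x * ampl.1 x by rw [← ampl_mul_ampl, SmoothFn.mul_apply]]
  field_simp
  ring

theorem ampl_mem : ampl.1 ∈ scalarSymbols frame₂ (tau.1 ^ 2) := by
  refine mem_scalarSymbols_of_closed {f | ∃ b : SmoothFn, b.1 ∈ scalarSymbols frame₂ 1 ∧
    f = b * ampl} ?_ ?_ ⟨1, scalarSymbols.one, (one_mul _).symm⟩
  · rintro _ ⟨b, hb, rfl⟩ i
    have h1 : (field i jac * invFn jac isWeight_jac).1 ∈ scalarSymbols frame₂ 1 := by
      refine symbolSpace.mono (scalarSymbols.mul (symbolSpace.leftField isWeight_jac.2 i)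
        (isWeight_jac.inv_mem frame₂_zero)) (C := 1) fun x => ?_
      rw [Pi.mul_apply, Pi.inv_apply, mul_inv_cancel₀ (isWeight_jac.1 x)]
      simp
    refine ⟨field i b + b * ((1 / 2 : ℂ) • (field i jac * invFn jac isWeight_jac)),
      symbolSpace.add (symbolSpace.leftField hb i) ?_, ?_⟩
    · have := scalarSymbols.mul hb (symbolSpace.const_smul h1 (1 / 2))
      rwa [mul_one] at this
    · rw [field_mul, field_ampl]
      ring
  · rintro _ ⟨b, hb, rfl⟩
    obtain ⟨B, hB0, hB⟩ := scalarSymbols.norm_le hb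
    refine ⟨B * 2, fun x => ?_⟩
    have h1 := hB x
    rw [Pi.one_apply, norm_one, mul_one] at h1
    have h2 : ‖ampl.1 x‖ ^ 2 ≤ (2 * ‖tau.1 x‖ ^ 2) := by
      have e : ‖ampl.1 x‖ ^ 2 = ‖jac.1 x‖ := by
        rw [← ampl_mul_ampl, SmoothFn.mul_apply, norm_mul, pow_two]
      rw [e, jac, SmoothFn.smul_apply, SmoothFn.mul_apply, norm_mul, norm_mul, Complex.norm_two,
        pow_two]
      have := norm_twoCosh_diff_le x
      gcongr
    have h3 : ‖ampl.1 x‖ ≤ 2 * ‖tau.1 x‖ ^ 2 := by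
      have h4 := one_le_pow₀ (n := 2) (one_le_norm_tau x)
      nlinarith [norm_nonneg (ampl.1 x)]
    rw [SmoothFn.mul_apply, norm_mul, Pi.pow_apply, norm_pow, mul_assoc]
    exact mul_le_mul h1 h3 (norm_nonneg _) hB0

theorem _root_.ContDiff.iteratedDeriv_infty {Ψ : ℝ → ℂ} (h : ContDiff ℝ ∞ Ψ) (j : ℕ) :
    ContDiff ℝ ∞ (iteratedDeriv j Ψ) := by
  induction j with
  | zero => simpa using h
  | succ j ih => rw [iteratedDeriv_succ]; exact (contDiff_infty_iff_deriv.1 ih).2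

/-- The function `Ψ^{(j)} (sinh (2 u) / (2 θ))` of `u = s a₁ + t a₂`. -/
def compSinh (θ s t : ℝ) {Ψ : ℝ → ℂ} (h : ContDiff ℝ ∞ Ψ) (j : ℕ) : SmoothFn :=
  ⟨fun x => iteratedDeriv j Ψ (Real.sinh (2 * (s * x.1.a + t * x.2.a)) / (2 * θ)),
    isSmooth_of_contDiff (f := fun y => iteratedDeriv j Ψ
      (Real.sinh (2 * (s * y.1.1 + t * y.2.1)) / (2 * θ)))
      ((h.iteratedDeriv_infty j).comp (ContDiff.div_const (by fun_prop) _))⟩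

theorem compSinh_apply (θ s t : ℝ) {Ψ : ℝ → ℂ} (h : ContDiff ℝ ∞ Ψ) (j : ℕ)
    (x : AffGroup × AffGroup) : (compSinh θ s t h j).1 x =
      iteratedDeriv j Ψ (Real.sinh (2 * (s * x.1.a + t * x.2.a)) / (2 * θ)) := rfl

theorem isRadial_compSinh (θ s t : ℝ) {Ψ : ℝ → ℂ} (h : ContDiff ℝ ∞ Ψ) (j : ℕ) :
    IsRadial (compSinh θ s t h j) :=
  fun x y h h' => by rw [compSinh_apply, compSinh_apply, h, h']

theorem field_compSinh (θ s t : ℝ) {Ψ : ℝ → ℂ} (h : ContDiff ℝ ∞ Ψ) (j : ℕ) (i : Gen ⊕ Gen) :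
    ∃ c : ℂ, field i (compSinh θ s t h j) =
      compSinh θ s t h (j + 1) * (c • twoCosh (2 * s) (2 * t)) := by
  have key : ∀ (r : ℝ) (u : ℝ → ℝ) (x : AffGroup × AffGroup), u 0 = s * x.1.a + t * x.2.a →
      HasDerivAt u r 0 → HasDerivAt (fun y => iteratedDeriv j Ψ (Real.sinh (2 * u y) / (2 * θ)))
        ((compSinh θ s t h (j + 1) * ((r / (2 * θ) : ℂ) • twoCosh (2 * s) (2 * t))).1 x) 0 := by
    intro r u x hu hd
    have h1 : HasDerivAt (fun y => Real.sinh (2 * u y) / (2 * θ))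
        (Real.cosh (2 * u 0) * (2 * r) / (2 * θ)) 0 := ((hd.const_mul 2).sinh).div_const _
    have h2 : HasDerivAt (iteratedDeriv j Ψ) (iteratedDeriv (j + 1) Ψ (Real.sinh (2 * u 0) / (2 * θ)))
        (Real.sinh (2 * u 0) / (2 * θ)) := by
      rw [iteratedDeriv_succ]
      exact (((h.iteratedDeriv_infty j).differentiable (by simp)) _).hasDerivAt
    have h3 := HasDerivAt.scomp (0 : ℝ) h2 h1
    refine h3.congr_deriv ?_
    rw [SmoothFn.mul_apply, SmoothFn.smul_apply, twoCosh_apply, compSinh_apply, hu,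
      Complex.real_smul]
    have e : 2 * (s * x.1.a + t * x.2.a) = 2 * s * x.1.a + 2 * t * x.2.a := by ring
    rw [e]
    push_cast
    ring
  rcases i with (i | i) <;> cases i
  · refine ⟨s / (2 * θ), field_eq_of_hasDerivAt fun x => ?_⟩
    simp only [mul_frame₂_inl_H, compSinh_apply, a_mk]
    refine key s (fun y => s * (x.1.a + y) + t * x.2.a) x (by simp) ?_
    simpa using (((hasDerivAt_id (0 : ℝ)).const_add x.1.a).const_mul s).add_const (t * x.2.a)
  · exact ⟨0, by rw [(isRadial_compSinh θ s t h j).field_inl_E]; simp⟩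
  · refine ⟨t / (2 * θ), field_eq_of_hasDerivAt fun x => ?_⟩
    simp only [mul_frame₂_inr_H, compSinh_apply, a_mk]
    refine key t (fun y => s * x.1.a + t * (x.2.a + y)) x (by simp) ?_
    simpa using (((hasDerivAt_id (0 : ℝ)).const_add x.2.a).const_mul t).const_add (s * x.1.a)
  · exact ⟨0, by rw [(isRadial_compSinh θ s t h j).field_inr_E]; simp⟩

/-- Composition of a function of symbol type with `sinh (2 u) / (2 θ)`: the decay of the derivatives
of the function compensates the growth of the derivatives of the hyperbolic sine. -/
theorem exists_compSinh_mem {θ : ℝ} (hθ : 0 < θ) (s t : ℝ) {Ψ : ℝ → ℂ} (hΨ : IsSymbolType Ψ) :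
    ∃ k : ℕ, (compSinh θ s t hΨ.1 0).1 ∈
      scalarSymbols frame₂ ((twoCosh (2 * s) (2 * t)).1 ^ k) := by
  obtain ⟨h, N, hN⟩ := hΨ
  set W := twoCosh (2 * s) (2 * t) with hW
  have hWw : IsWeight frame₂ W.1 := isWeight_twoCosh _ _
  let gen : Set SmoothFn := {f | ∃ (j : ℕ) (g : SmoothFn), g.1 ∈ scalarSymbols frame₂ (W.1 ^ j) ∧
    f = compSinh θ s t h j * g}
  refine ⟨⌈|N|⌉₊, mem_scalarSymbols_of_closed (AddSubmonoid.closure gen : Set SmoothFn) ?_ ?_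
    (AddSubmonoid.subset_closure ⟨0, 1, by rw [pow_zero]; exact scalarSymbols.one,
      (mul_one _).symm⟩)⟩
  · intro f hf i
    induction hf using AddSubmonoid.closure_induction with
    | mem f hf =>
      obtain ⟨j, g, hg, rfl⟩ := hf
      obtain ⟨c, hc⟩ := field_compSinh θ s t h j i
      rw [field_mul, hc, mul_assoc]
      refine add_mem (AddSubmonoid.subset_closure ⟨j + 1, _, ?_, rfl⟩)
        (AddSubmonoid.subset_closure ⟨j, _, symbolSpace.leftField hg i, rfl⟩)
      rw [pow_succ']
      exact scalarSymbols.mul (symbolSpace.const_smul hWw.2 c) hg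
    | zero => rw [map_zero]; exact zero_mem _
    | add f g _ _ hf hg => rw [map_add]; exact add_mem hf hg
  · intro f hf
    induction hf using AddSubmonoid.closure_induction with
    | mem f hf =>
      obtain ⟨j, g, hg, rfl⟩ := hf
      obtain ⟨B, hB0, hB⟩ := scalarSymbols.norm_le hg
      obtain ⟨C, hC⟩ := hN j
      refine ⟨|C| * (1 + 1 / (2 * θ)) ^ ⌈|N|⌉₊ * (2 * (1 + 2 * θ)) ^ j * B, fun x => ?_⟩
      have hBx := hB x
      rw [Pi.pow_apply, norm_pow] at hBx
      rw [SmoothFn.mul_apply, norm_mul, compSinh_apply, Pi.pow_apply, norm_pow]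
      have hw : ‖W.1 x‖ = 2 * Real.cosh (2 * (s * x.1.a + t * x.2.a)) := by
        rw [hW, norm_twoCosh]; ring_nf
      set y := Real.sinh (2 * (s * x.1.a + t * x.2.a)) / (2 * θ) with hy
      have hC := hC y
      set w := ‖W.1 x‖ with hwdef
      have hsinh : Real.sinh (2 * (s * x.1.a + t * x.2.a)) = 2 * θ * y := by rw [hy]; field_simp
      have hsq := Real.cosh_sq (2 * (s * x.1.a + t * x.2.a))
      have hcosh := Real.one_le_cosh (2 * (s * x.1.a + t * x.2.a))
      have hyn := abs_nonneg y
      rw [hsinh] at hsq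
      have hlo : w ≤ 2 * (1 + 2 * θ) * (1 + |y|) := by
        have : Real.cosh (2 * (s * x.1.a + t * x.2.a)) ≤ 1 + 2 * θ * |y| := by
          refine abs_le_of_sq_le_sq' ?_ (by positivity) |>.2
          have e : (2 * θ * y) ^ 2 = (2 * θ * |y|) ^ 2 := by rw [mul_pow _ |y|, mul_pow _ y, sq_abs]
          rw [hsq, e]
          nlinarith [mul_nonneg hθ.le hyn]
        rw [hw]
        nlinarith [mul_nonneg hθ.le hyn]
      have hhi : 1 + |y| ≤ (1 + 1 / (2 * θ)) * w := by
        have h1 : |2 * θ * y| ≤ Real.cosh (2 * (s * x.1.a + t * x.2.a)) := by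
          refine abs_le_of_sq_le_sq ?_ (by linarith)
          rw [hsq]; linarith
        rw [abs_mul, abs_of_pos (by positivity)] at h1
        have h2 : |y| ≤ 1 / (2 * θ) * w := by
          rw [one_div, ← div_eq_inv_mul, le_div_iff₀ (by positivity), hw]
          linarith
        have h3 : 1 ≤ w := by rw [hw]; linarith
        linarith
      have hw1 : 1 ≤ w := by rw [hw]; linarith
      have hpos : 0 < 1 + |y| := by positivity
      have hpow : (1 + |y|) ^ (N - j) ≤ (1 + |y|) ^ ⌈|N|⌉₊ / (1 + |y|) ^ j := by
        rw [Real.rpow_sub hpos, Real.rpow_natCast]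
        gcongr
        rw [← Real.rpow_natCast]
        exact Real.rpow_le_rpow_of_exponent_le (by linarith)
          ((le_abs_self N).trans (Nat.le_ceil _))
      have hWj : w ^ j ≤ (2 * (1 + 2 * θ)) ^ j * (1 + |y|) ^ j := by
        rw [← mul_pow]
        exact pow_le_pow_left₀ (by linarith) hlo j
      calc ‖iteratedDeriv j Ψ y‖ * ‖g.1 x‖
          ≤ (|C| * ((1 + |y|) ^ ⌈|N|⌉₊ / (1 + |y|) ^ j)) *
            (B * ((2 * (1 + 2 * θ)) ^ j * (1 + |y|) ^ j)) := by
            refine mul_le_mul (hC.trans ?_) (hBx.trans ?_) (norm_nonneg _) (by positivity)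
            · refine mul_le_mul (le_abs_self C) hpow (by positivity) (abs_nonneg C)
            · gcongr
        _ = |C| * (1 + |y|) ^ ⌈|N|⌉₊ * (2 * (1 + 2 * θ)) ^ j * B := by
            field_simp
        _ ≤ |C| * ((1 + 1 / (2 * θ)) * w) ^ ⌈|N|⌉₊ * (2 * (1 + 2 * θ)) ^ j * B := by
            gcongr
        _ = _ := by rw [mul_pow]; ring
    | zero => exact ⟨0, fun x => by simp⟩
    | add f g _ _ hf hg =>
      obtain ⟨C, hC⟩ := hf
      obtain ⟨D, hD⟩ := hg
      refine ⟨C + D, fun x => ?_⟩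
      rw [SmoothFn.add_apply, add_mul]
      exact (norm_add_le _ _).trans (add_le_add (hC x) (hD x))

theorem exists_compSinh_mem_tau {θ : ℝ} (hθ : 0 < θ) (s t : ℝ) {Ψ : ℝ → ℂ} (hΨ : IsSymbolType Ψ)
    (h : ∀ x, ‖(twoCosh (2 * s) (2 * t)).1 x‖ ≤ ‖tau.1 x‖) :
    ∃ k : ℕ, (compSinh θ s t hΨ.1 0).1 ∈ scalarSymbols frame₂ (tau.1 ^ k) := by
  obtain ⟨k, hk⟩ := exists_compSinh_mem hθ s t hΨ
  refine ⟨k, symbolSpace.mono hk (C := 1) fun x => ?_⟩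
  rw [one_mul, Pi.pow_apply, Pi.pow_apply, norm_pow, norm_pow]
  exact pow_le_pow_left₀ (norm_nonneg _) (h x) k

/-- The scalar amplitude `𝚯 A_can` is a symbol of the growth of a power of `τ`. -/
theorem exists_amplitude_mem {θ : ℝ} (hθ : 0 < θ) {Θ : ℝ → ℂ} (hΘ : IsSymbolType Θ)
    (hΘ_inv : IsSymbolType fun t => (Θ t)⁻¹) :
    ∃ k : ℕ, (fun x => boldTheta θ Θ x * (Acan x : ℂ)) ∈ scalarSymbols frame₂ (tau.1 ^ k) := by
  obtain ⟨k1, h1⟩ := exists_compSinh_mem_tau hθ 1 0 hΘ_inv fun x => by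
    rw [norm_twoCosh]
    refine le_trans (le_of_eq ?_) (two_cosh_le_norm_tau₁ x)
    ring_nf
  obtain ⟨k2, h2⟩ := exists_compSinh_mem_tau hθ 0 (-1) hΘ_inv fun x => by
    rw [norm_twoCosh, ← Real.cosh_neg]
    refine le_trans (le_of_eq ?_) (two_cosh_le_norm_tau₂ x)
    ring_nf
  obtain ⟨k3, h3⟩ := exists_compSinh_mem_tau hθ 1 (-1) hΘ fun x => by
    refine le_trans (le_of_eq ?_) (norm_twoCosh_diff_le x)
    norm_num
  have e : (fun x => boldTheta θ Θ x * (Acan x : ℂ)) = (compSinh θ 1 0 hΘ_inv.1 0 *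
      compSinh θ 0 (-1) hΘ_inv.1 0 * compSinh θ 1 (-1) hΘ.1 0 * ampl).1 := by
    funext x
    have hX : ∀ u, Xi θ Θ u = (Θ (Real.sinh (2 * u) / (2 * θ)))⁻¹ := fun u => by
      rw [Xi, twist, mul_assoc, mul_div_cancel₀ _ hθ.ne']
    rw [SmoothFn.mul_apply, SmoothFn.mul_apply, SmoothFn.mul_apply, compSinh_apply, compSinh_apply,
      compSinh_apply, ampl_apply, boldTheta, hX, hX, hX, iteratedDeriv_zero, iteratedDeriv_zero,
      div_inv_eq_mul]
    ring_nf
  refine ⟨k1 + k2 + k3 + 2, ?_⟩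
  rw [e, pow_add, pow_add, pow_add]
  exact scalarSymbols.mul (scalarSymbols.mul (scalarSymbols.mul h1 h2) h3) ampl_mem

/-! ### Orbits of smooth vectors -/

section Action

variable {A : Type*} [NonUnitalRing A] [Module ℂ A] [IsScalarTower ℂ A A]
  [SMulCommClass ℂ A A] [UniformSpace A] [IsUniformAddGroup A] [T2Space A]
  [ContinuousMul A] {p : ℕ → Seminorm ℂ A} {α : AffGroup →* Module.End ℂ A}

theorem tendsto_of_seminorm (hp : WithSeminorms p) {X : Type*} {l : Filter X} {f : X → A} {y : A}
    (h : ∀ j, Tendsto (fun x => p j (f x - y)) l (𝓝 0)) : Tendsto f l (𝓝 y) := by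
  rw [hp.tendsto_nhds]
  exact fun j ε hε => (h j).eventually (gt_mem_nhds hε)

theorem tendsto_seminorm_sub (hp : WithSeminorms p) {X : Type*} {l : Filter X} {f : X → A} {y : A}
    (h : Tendsto f l (𝓝 y)) (j : ℕ) : Tendsto (fun x => p j (f x - y)) l (𝓝 0) := by
  have h1 : Tendsto (fun x => f x - y) l (𝓝 0) := by simpa using h.sub_const y
  simpa [Function.comp_def] using ((hp.continuous_seminorm j).tendsto 0).comp h1

/-- A strongly continuous isometric action is jointly continuous. -/
theorem tendsto_act (hp : WithSeminorms p) (hα_cont : ∀ v, Continuous fun g => α g v)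
    (hα_isom : ∀ g j v, p j (α g v) = p j v) {X : Type*} {l : Filter X} {g : X → AffGroup}
    {g₀ : AffGroup} {z : X → A} {z₀ : A} (hg : Tendsto g l (𝓝 g₀)) (hz : Tendsto z l (𝓝 z₀)) :
    Tendsto (fun x => α (g x) (z x)) l (𝓝 (α g₀ z₀)) := by
  have h1 : Tendsto (fun x => α (g x) z₀) l (𝓝 (α g₀ z₀)) := ((hα_cont z₀).tendsto g₀).comp hg
  have h2 : Tendsto (fun x => α (g x) (z x - z₀)) l (𝓝 0) := by
    refine tendsto_of_seminorm hp fun j => ?_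
    simpa only [sub_zero, hα_isom] using tendsto_seminorm_sub hp hz j
  have h3 := h1.add h2
  rw [add_zero] at h3
  refine h3.congr fun x => ?_
  rw [← map_add, add_sub_cancel]

/-- The element `α_g` of the action as a continuous linear map. -/
def actCLM (hp : WithSeminorms p) (hα_isom : ∀ g j v, p j (α g v) = p j v) (g : AffGroup) :
    A →L[ℂ] A :=
  ⟨α g, by
    rw [continuous_iff_continuousAt]
    refine fun y => tendsto_of_seminorm hp fun j => ?_
    refine (tendsto_seminorm_sub hp (tendsto_id (x := 𝓝 y)) j).congr fun z => ?_
    change p j (z - y) = p j (α g z - α g y)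
    rw [← map_sub, hα_isom]⟩

theorem actCLM_apply (hp : WithSeminorms p) (hα_isom : ∀ g j v, p j (α g v) = p j v)
    (g : AffGroup) (v : A) : actCLM hp hα_isom g v = α g v := rfl

/-- The infinitesimal action of the generators of `𝕊` on smooth vectors. -/
def infAct (α : AffGroup →* Module.End ℂ A) (i : Gen) (v : A) : A :=
  leftField frame i (fun g => α g v) 1

theorem hasField_act (hp : WithSeminorms p) (hα_isom : ∀ g j v, p j (α g v) = p j v) {v : A}
    (hv : v ∈ smoothVectors α) (i : Gen) :
    HasField frame i (fun g => α g v) (fun g => α g (infAct α i v)) := by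
  intro g
  have h1 := (IsSmooth.hasField hv i) 1
  refine (((actCLM hp hα_isom g).continuous.tendsto _).comp h1).congr fun t => ?_
  simp only [Function.comp_apply, diffQuot, map_smul, map_sub, actCLM_apply, one_mul, map_one,
    Module.End.one_apply, map_mul, Module.End.mul_apply]

theorem infAct_mem (hp : WithSeminorms p) (hα_isom : ∀ g j v, p j (α g v) = p j v) {v : A}
    (hv : v ∈ smoothVectors α) (i : Gen) : infAct α i v ∈ smoothVectors α := by
  have h := IsSmooth.leftField hv i
  rwa [(hasField_act hp hα_isom hv i).leftField_eq] at h

/-- The function `α_{x₁}(v) α_{x₂}(w)`. -/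
def orbit (α : AffGroup →* Module.End ℂ A) (v w : A) (x : AffGroup × AffGroup) : A :=
  α x.1 v * α x.2 w

theorem continuous_orbit (hα_cont : ∀ v, Continuous fun g => α g v) (v w : A) :
    Continuous (orbit α v w) :=
  ((hα_cont v).comp continuous_fst).mul ((hα_cont w).comp continuous_snd)

/-- Orbits are bounded, since the product is continuous and the action isometric. -/
theorem exists_orbit_le (hp : WithSeminorms p) (hα_isom : ∀ g j v, p j (α g v) = p j v) (j : ℕ)
    (v w : A) : ∃ C : ℝ, ∀ x, p j (orbit α v w x) ≤ C := by
  have hc : Tendsto (fun y : A × A => p j (y.1 * y.2)) (𝓝 (0, 0)) (𝓝 0) := by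
    have := ((hp.continuous_seminorm j).comp (continuous_mul (M := A))).tendsto (0, 0)
    simpa [Function.comp_def] using this
  have h1 := hc.eventually (gt_mem_nhds one_pos)
  rw [nhds_prod_eq, eventually_prod_iff] at h1
  obtain ⟨pa, ha, pb, hb, hab⟩ := h1
  obtain ⟨⟨s, r⟩, hr, hs⟩ := hp.hasBasis_zero_ball.mem_iff.1 ha
  obtain ⟨⟨s', r'⟩, hr', hs'⟩ := hp.hasBasis_zero_ball.mem_iff.1 hb
  simp only at hr hs hr' hs'
  have hsup : ∀ (s : Finset ℕ) (g : AffGroup) (v : A), (s.sup p) (α g v) = (s.sup p) v :=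
    fun s g v => by
      have : ∀ (s : Finset ℕ) (g : AffGroup) (v : A), (s.sup p) (α g v) ≤ (s.sup p) v :=
        fun s g v => Seminorm.finset_sup_apply_le (apply_nonneg _ _) fun j hj => by
          rw [hα_isom]; exact Seminorm.le_finset_sup_apply hj
      refine le_antisymm (this s g v) ?_
      have h := this s g⁻¹ (α g v)
      rwa [← Module.End.mul_apply, ← map_mul, inv_mul_cancel, map_one, Module.End.one_apply] at h
  have hscale : ∀ (s : Finset ℕ) (r : ℝ) (v : A), 0 < r → ∃ c : ℝ, 0 < c ∧
      ∀ g, (c : ℂ) • α g v ∈ (s.sup p).ball 0 r := by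
    intro s r v hr
    have hv : 0 ≤ (s.sup p) v := apply_nonneg _ _
    refine ⟨r / (2 * ((s.sup p) v + 1)), by positivity, fun g => ?_⟩
    rw [Seminorm.mem_ball_zero, map_smul_eq_mul, hsup, Complex.norm_real,
      Real.norm_of_nonneg (by positivity), div_mul_eq_mul_div, div_lt_iff₀ (by positivity)]
    nlinarith
  obtain ⟨c, hc0, hcv⟩ := hscale s r v hr
  obtain ⟨d, hd0, hdw⟩ := hscale s' r' w hr'
  refine ⟨(c * d)⁻¹, fun x => ?_⟩
  have h2 := hab (hs (hcv x.1)) (hs' (hdw x.2))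
  simp only at h2
  rw [smul_mul_smul_comm, map_smul_eq_mul, ← Complex.ofReal_mul, Complex.norm_real,
    Real.norm_of_nonneg (by positivity)] at h2
  rw [← one_div, le_div_iff₀ (by positivity), mul_comm]
  exact h2.le

theorem hasField_orbit_inl (hp : WithSeminorms p) (hα_isom : ∀ g j v, p j (α g v) = p j v)
    {v : A} (hv : v ∈ smoothVectors α) (w : A) (i : Gen) :
    HasField frame₂ (Sum.inl i) (orbit α v w) (orbit α (infAct α i v) w) := by
  intro x
  refine ((hasField_act hp hα_isom hv i x.1).mul_const (α x.2 w)).congr fun t => ?_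
  simp only [diffQuot, orbit, frame₂, Prod.fst_mul, Prod.snd_mul, mul_one, ← sub_mul,
    smul_mul_assoc]

theorem hasField_orbit_inr (hp : WithSeminorms p) (hα_isom : ∀ g j v, p j (α g v) = p j v)
    (v : A) {w : A} (hw : w ∈ smoothVectors α) (i : Gen) :
    HasField frame₂ (Sum.inr i) (orbit α v w) (orbit α v (infAct α i w)) := by
  intro x
  refine ((hasField_act hp hα_isom hw i x.2).const_mul (α x.1 v)).congr fun t => ?_
  simp only [diffQuot, orbit, frame₂, Prod.fst_mul, Prod.snd_mul, mul_one, ← mul_sub,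
    mul_smul_comm]

theorem exists_hasField_orbit (hp : WithSeminorms p) (hα_isom : ∀ g j v, p j (α g v) = p j v)
    {v w : A} (hv : v ∈ smoothVectors α) (hw : w ∈ smoothVectors α) (i : Gen ⊕ Gen) :
    ∃ v' ∈ smoothVectors α, ∃ w' ∈ smoothVectors α,
      HasField frame₂ i (orbit α v w) (orbit α v' w') := by
  rcases i with i | i
  · exact ⟨_, infAct_mem hp hα_isom hv i, w, hw, hasField_orbit_inl hp hα_isom hv w i⟩
  · exact ⟨v, hv, _, infAct_mem hp hα_isom hw i, hasField_orbit_inr hp hα_isom v hw i⟩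

theorem orbit_mem_symbolSpace (hp : WithSeminorms p) (hα_cont : ∀ v, Continuous fun g => α g v)
    (hα_isom : ∀ g j v, p j (α g v) = p j v) {v w : A} (hv : v ∈ smoothVectors α)
    (hw : w ∈ smoothVectors α) : orbit α v w ∈ symbolSpace frame₂ p 1 := by
  refine mem_symbolSpace_of_closed
    {F | ∃ v ∈ smoothVectors α, ∃ w ∈ smoothVectors α, F = orbit α v w} ?_ ?_ ?_
    ⟨v, hv, w, hw, rfl⟩
  · rintro _ ⟨v, -, w, -, rfl⟩
    exact continuous_orbit hα_cont v w
  · rintro _ ⟨v, hv, w, hw, rfl⟩ i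
    obtain ⟨v', hv', w', hw', h⟩ := exists_hasField_orbit hp hα_isom hv hw i
    exact ⟨_, ⟨v', hv', w', hw', rfl⟩, h⟩
  · rintro _ ⟨v, -, w, -, rfl⟩ j
    obtain ⟨C, hC⟩ := exists_orbit_le hp hα_isom j v w
    exact ⟨C, fun x => by simpa using hC x⟩

/-! ### Left translation of orbits -/

/-- The derivative at `t = 0` of `α_{exp (t Xᵢ) x}(v)`, expressed by left-invariant fields. -/
def rightAct (α : AffGroup →* Module.End ℂ A) : Gen → A → AffGroup → A
  | Gen.H, v, x => α x (infAct α Gen.H v) + ((2 * x.l : ℝ) : ℂ) • α x (infAct α Gen.E v)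
  | Gen.E, v, x => ((Real.exp (-2 * x.a) : ℝ) : ℂ) • α x (infAct α Gen.E v)

theorem frame_E_mul (x : AffGroup) (t : ℝ) :
    frame Gen.E t * x = x * frame Gen.E (Real.exp (-2 * x.a) * t) := by
  ext <;> simp [frame, mul_def, add_comm]

theorem frame_H_mul (x : AffGroup) (t : ℝ) :
    frame Gen.H t * x = x * frame Gen.H t * frame Gen.E ((1 - Real.exp (-2 * t)) * x.l) := by
  ext
  · simp [frame, mul_def, add_comm]
  · simp [frame, mul_def]; ring

/-- Increments of an orbit map along `E`, with a remainder continuous at `0`. -/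
theorem exists_increment (hp : WithSeminorms p) (hα_isom : ∀ g j v, p j (α g v) = p j v) {v : A}
    (hv : v ∈ smoothVectors α) : ∃ ψ : ℝ → A, Tendsto ψ (𝓝 0) (𝓝 (infAct α Gen.E v)) ∧
      ∀ s, α (frame Gen.E s) v = v + (s : ℂ) • ψ s := by
  classical
  have h := hasField_act hp hα_isom hv Gen.E 1
  simp only [map_one, Module.End.one_apply] at h
  refine ⟨Function.update (diffQuot frame Gen.E (fun g => α g v) 1) 0 (infAct α Gen.E v), ?_, ?_⟩
  · have := continuousAt_update_same.2 h
    rwa [ContinuousAt, Function.update_self] at this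
  · intro s
    rcases eq_or_ne s 0 with rfl | hs
    · simp [frame_zero]
    · have hs' : (s : ℂ) ≠ 0 := by exact_mod_cast hs
      rw [Function.update_of_ne hs, diffQuot, smul_smul]
      simp [hs']

theorem tendsto_left_translate (hp : WithSeminorms p) (hα_cont : ∀ v, Continuous fun g => α g v)
    (hα_isom : ∀ g j v, p j (α g v) = p j v) {v : A} (hv : v ∈ smoothVectors α) (i : Gen)
    (x : AffGroup) :
    Tendsto (fun t : ℝ => ((t⁻¹ : ℝ) : ℂ) • (α (frame i t * x) v - α x v)) (𝓝[≠] 0)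
      (𝓝 (rightAct α i v x)) := by
  have := hp.continuousSMul
  obtain ⟨ψ, hψ, hinc⟩ := exists_increment hp hα_isom hv
  cases i with
  | E =>
    have h1 : Tendsto (fun t : ℝ => Real.exp (-2 * x.a) * t) (𝓝[≠] 0) (𝓝 0) := by
      have : Continuous fun t : ℝ => Real.exp (-2 * x.a) * t := by fun_prop
      simpa using (this.tendsto 0).mono_left nhdsWithin_le_nhds
    have h2 := ((tendsto_act hp hα_cont hα_isom (tendsto_const_nhds (x := x)) (hψ.comp h1)).const_smul
      (((Real.exp (-2 * x.a) : ℝ) : ℂ)))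
    refine h2.congr' ?_
    filter_upwards [self_mem_nhdsWithin] with t ht
    have ht' : (t : ℂ) ≠ 0 := by exact_mod_cast ht
    rw [frame_E_mul, map_mul, Module.End.mul_apply, hinc, map_add, add_sub_cancel_left, map_smul,
      smul_smul, Function.comp_apply]
    congr 1
    push_cast
    field_simp
  | H =>
    have h0 := hasField_act hp hα_isom hv Gen.H x
    have hs : Tendsto (fun t : ℝ => (1 - Real.exp (-2 * t)) * x.l) (𝓝[≠] 0) (𝓝 0) := by
      have : Continuous fun t : ℝ => (1 - Real.exp (-2 * t)) * x.l := by fun_prop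
      simpa using (this.tendsto 0).mono_left nhdsWithin_le_nhds
    have hq : Tendsto (fun t : ℝ => ((t⁻¹ * ((1 - Real.exp (-2 * t)) * x.l) : ℝ) : ℂ)) (𝓝[≠] 0)
        (𝓝 ((2 * x.l : ℝ) : ℂ)) := by
      have hd : HasDerivAt (fun t : ℝ => (1 - Real.exp (-2 * t)) * x.l) (2 * x.l) 0 := by
        simpa using ((((hasDerivAt_id (0 : ℝ)).const_mul (-2)).exp).const_sub 1).mul_const x.l
      rw [hasDerivAt_iff_tendsto_slope_zero] at hd
      have := (Complex.continuous_ofReal.tendsto _).comp hd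
      refine this.congr fun t => ?_
      simp
    have hg : Tendsto (fun t : ℝ => x * frame Gen.H t) (𝓝[≠] 0) (𝓝 x) := by
      have : Continuous fun t : ℝ => x * frame Gen.H t :=
        continuous_const.mul (continuous_frame Gen.H)
      simpa [frame_zero] using (this.tendsto 0).mono_left nhdsWithin_le_nhds
    have h1 := hq.smul (tendsto_act hp hα_cont hα_isom hg (hψ.comp hs))
    refine (h0.add h1).congr fun t => ?_
    rw [diffQuot, frame_H_mul, map_mul α (x * frame Gen.H t), Module.End.mul_apply, hinc, map_add,
      map_smul, Function.comp_apply, add_sub_right_comm, smul_add, smul_smul]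
    push_cast
    rfl

/-- The derivative at `t = 0` of the orbit function at `exp (t Xᵢ) x`. -/
def rightOrbit (α : AffGroup →* Module.End ℂ A) (i : Gen) (v w : A) (x : AffGroup × AffGroup) : A :=
  rightAct α i v x.1 * α x.2 w + α x.1 v * rightAct α i w x.2

theorem act_orbit (hα_mul : ∀ g v w, α g (v * w) = α g v * α g w) (v w : A) (g : AffGroup)
    (x : AffGroup × AffGroup) : α g (orbit α v w x) = orbit α v w (g * x.1, g * x.2) := by
  simp only [orbit, hα_mul, map_mul, Module.End.mul_apply]

theorem tendsto_left_translate_orbit (hp : WithSeminorms p)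
    (hα_cont : ∀ v, Continuous fun g => α g v) (hα_isom : ∀ g j v, p j (α g v) = p j v) {v w : A}
    (hv : v ∈ smoothVectors α) (hw : w ∈ smoothVectors α) (i : Gen) (x : AffGroup × AffGroup) :
    Tendsto (fun t : ℝ => ((t⁻¹ : ℝ) : ℂ) •
      (orbit α v w (frame i t * x.1, frame i t * x.2) - orbit α v w x)) (𝓝[≠] 0)
      (𝓝 (rightOrbit α i v w x)) := by
  have h1 := tendsto_left_translate hp hα_cont hα_isom hv i x.1
  have h2 := tendsto_left_translate hp hα_cont hα_isom hw i x.2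
  have h3 : Tendsto (fun t : ℝ => α (frame i t * x.2) w) (𝓝[≠] 0) (𝓝 (α x.2 w)) := by
    have : Continuous fun t : ℝ => α (frame i t * x.2) w :=
      (hα_cont w).comp ((continuous_frame i).mul continuous_const)
    simpa [frame_zero] using (this.tendsto 0).mono_left nhdsWithin_le_nhds
  refine ((h1.mul h3).add (h2.const_mul (α x.1 v))).congr fun t => ?_
  rw [orbit, orbit, smul_mul_assoc, mul_smul_comm, ← smul_add, sub_mul, mul_sub]
  congr 1
  abel

theorem rightOrbit_H (v w : A) : rightOrbit α Gen.H v w =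
    orbit α (infAct α Gen.H v) w +
      (fun x : AffGroup × AffGroup => ((2 * x.1.l : ℝ) : ℂ)) • orbit α (infAct α Gen.E v) w +
    (orbit α v (infAct α Gen.H w) +
      (fun x : AffGroup × AffGroup => ((2 * x.2.l : ℝ) : ℂ)) • orbit α v (infAct α Gen.E w)) := by
  funext x
  simp only [rightOrbit, rightAct, orbit, Pi.add_apply, Pi.smul_apply', add_mul, mul_add,
    smul_mul_assoc, mul_smul_comm]

theorem rightOrbit_E (v w : A) : rightOrbit α Gen.E v w =
    (fun x : AffGroup × AffGroup => ((Real.exp (-2 * x.1.a) : ℝ) : ℂ)) • orbit α (infAct α Gen.E v) w +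
      (fun x : AffGroup × AffGroup => ((Real.exp (-2 * x.2.a) : ℝ) : ℂ)) • orbit α v (infAct α Gen.E w) := by
  funext x
  simp only [rightOrbit, rightAct, orbit, Pi.add_apply, Pi.smul_apply', smul_mul_assoc,
    mul_smul_comm]

theorem abs_l₁_le_rho (x : AffGroup × AffGroup) : |x.1.l| ≤ rho x := by
  have := abs_nonneg x.2.l
  have := Real.exp_pos (-2 * x.1.a)
  have := Real.exp_pos (-2 * x.2.a)
  unfold rho
  linarith

theorem abs_l₂_le_rho (x : AffGroup × AffGroup) : |x.2.l| ≤ rho x := by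
  have := abs_nonneg x.1.l
  have := Real.exp_pos (-2 * x.1.a)
  have := Real.exp_pos (-2 * x.2.a)
  unfold rho
  linarith

theorem exp₁_le_rho (x : AffGroup × AffGroup) : Real.exp (-2 * x.1.a) ≤ rho x := by
  have := abs_nonneg x.1.l
  have := abs_nonneg x.2.l
  have := Real.exp_pos (-2 * x.2.a)
  unfold rho
  linarith

theorem exp₂_le_rho (x : AffGroup × AffGroup) : Real.exp (-2 * x.2.a) ≤ rho x := by
  have := abs_nonneg x.1.l
  have := abs_nonneg x.2.l
  have := Real.exp_pos (-2 * x.1.a)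
  unfold rho
  linarith

/-- The bound for `rightOrbit` along the curves `exp (t Xᵢ) x`: its coefficients are constant on
them. -/
theorem exists_rightOrbit_le (hp : WithSeminorms p) (hα_isom : ∀ g j v, p j (α g v) = p j v)
    (j : ℕ) (v w : A) (i : Gen) : ∃ C : ℝ, ∀ (x : AffGroup × AffGroup) (t : ℝ),
      p j (rightOrbit α i v w (frame i t * x.1, frame i t * x.2)) ≤ C * rho x := by
  obtain ⟨C1, h1⟩ := exists_orbit_le (α := α) hp hα_isom j (infAct α Gen.H v) w
  obtain ⟨C2, h2⟩ := exists_orbit_le (α := α) hp hα_isom j (infAct α Gen.E v) w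
  obtain ⟨C3, h3⟩ := exists_orbit_le (α := α) hp hα_isom j v (infAct α Gen.H w)
  obtain ⟨C4, h4⟩ := exists_orbit_le (α := α) hp hα_isom j v (infAct α Gen.E w)
  have hC : ∀ {C : ℝ} {F : AffGroup × AffGroup → A}, (∀ x, p j (F x) ≤ C) → 0 ≤ C :=
    fun h => (apply_nonneg _ _).trans (h 1)
  have hC1 := hC h1
  have hC2 := hC h2
  have hC3 := hC h3
  have hC4 := hC h4
  cases i with
  | H =>
    refine ⟨C1 + 2 * C2 + (C3 + 2 * C4), fun x t => ?_⟩
    set y : AffGroup × AffGroup := (frame Gen.H t * x.1, frame Gen.H t * x.2) with hy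
    have e1 : y.1.l = x.1.l := by simp [hy, frame, mul_def]
    have e2 : y.2.l = x.2.l := by simp [hy, frame, mul_def]
    have hr := one_le_rho x
    have hl1 := abs_l₁_le_rho x
    have hl2 := abs_l₂_le_rho x
    rw [rightOrbit_H]
    simp only [Pi.add_apply, Pi.smul_apply', e1, e2]
    refine ((map_add_le_add _ _ _).trans (add_le_add (map_add_le_add _ _ _)
      (map_add_le_add _ _ _))).trans ?_
    rw [map_smul_eq_mul, map_smul_eq_mul, Complex.norm_real, Complex.norm_real, norm_mul, norm_mul,
      Real.norm_two, Real.norm_eq_abs, Real.norm_eq_abs]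
    calc _ ≤ C1 + 2 * |x.1.l| * C2 + (C3 + 2 * |x.2.l| * C4) := by
          gcongr
          · exact h1 y
          · exact h2 y
          · exact h3 y
          · exact h4 y
      _ ≤ C1 * rho x + 2 * rho x * C2 + (C3 * rho x + 2 * rho x * C4) := by
          gcongr
          · exact le_mul_of_one_le_right hC1 hr
          · exact le_mul_of_one_le_right hC3 hr
      _ = _ := by ring
  | E =>
    refine ⟨C2 + C4, fun x t => ?_⟩
    set y : AffGroup × AffGroup := (frame Gen.E t * x.1, frame Gen.E t * x.2) with hy
    have e1 : y.1.a = x.1.a := by simp [hy, frame, mul_def]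
    have e2 : y.2.a = x.2.a := by simp [hy, frame, mul_def]
    have hl1 := exp₁_le_rho x
    have hl2 := exp₂_le_rho x
    have hr := one_le_rho x
    rw [rightOrbit_E]
    simp only [Pi.add_apply, Pi.smul_apply', e1, e2]
    refine (map_add_le_add _ _ _).trans ?_
    rw [map_smul_eq_mul, map_smul_eq_mul, Complex.norm_real, Complex.norm_real,
      Real.norm_of_nonneg (Real.exp_pos _).le, Real.norm_of_nonneg (Real.exp_pos _).le]
    calc _ ≤ rho x * C2 + rho x * C4 := by
          refine add_le_add (mul_le_mul hl1 (h2 y) (apply_nonneg _ _) (by linarith))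
            (mul_le_mul hl2 (h4 y) (apply_nonneg _ _) (by linarith))
      _ = _ := by ring

end Action

/-! ### Smoothness of weighted orbit integrals -/

section Action

variable {A : Type*} [NonUnitalRing A] [Module ℂ A] [IsScalarTower ℂ A A]
  [SMulCommClass ℂ A A] [UniformSpace A] [IsUniformAddGroup A] [CompleteSpace A] [T2Space A]
  [ContinuousMul A] {p : ℕ → Seminorm ℂ A} {α : AffGroup →* Module.End ℂ A}

/-- The scalar densities with `M` moments for the growth function `rho`. -/
def HasMoment (M : ℕ) (f : AffGroup × AffGroup → ℂ) : Prop :=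
  Continuous f ∧ Integrable (fun x => (rho x : ℂ) ^ M * f x) volume

theorem continuous_rho : Continuous rho := by
  have h1 : Continuous fun x : AffGroup × AffGroup => x.1.a := continuous_a.comp continuous_fst
  have h2 : Continuous fun x : AffGroup × AffGroup => x.2.a := continuous_a.comp continuous_snd
  have h3 : Continuous fun x : AffGroup × AffGroup => x.1.l := continuous_l.comp continuous_fst
  have h4 : Continuous fun x : AffGroup × AffGroup => x.2.l := continuous_l.comp continuous_snd
  unfold rho
  fun_prop

theorem norm_rho_pow_mul (M : ℕ) (f : AffGroup × AffGroup → ℂ) (x : AffGroup × AffGroup) :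
    ‖(rho x : ℂ) ^ M * f x‖ = rho x ^ M * ‖f x‖ := by
  rw [norm_mul, norm_pow, Complex.norm_real, Real.norm_of_nonneg (zero_le_one.trans (one_le_rho x))]

/-- Multiplication by a continuous function bounded by `rho` costs one moment. -/
theorem HasMoment.mul {M : ℕ} {f c : AffGroup × AffGroup → ℂ} (hf : HasMoment (M + 1) f)
    (hc : Continuous c) {C : ℝ} (hC : ∀ x, ‖c x‖ ≤ C * rho x) : HasMoment M (c * f) := by
  have hcont : Continuous fun x => (rho x : ℂ) ^ M * (c * f) x :=
    ((Complex.continuous_ofReal.comp continuous_rho).pow M).mul (hc.mul hf.1)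
  refine ⟨hc.mul hf.1, (hf.2.norm.const_mul C).mono' hcont.aestronglyMeasurable
    (Eventually.of_forall fun x => ?_)⟩
  have h1 := zero_le_one.trans (one_le_rho x)
  rw [norm_rho_pow_mul, norm_rho_pow_mul, Pi.mul_apply, norm_mul]
  calc rho x ^ M * (‖c x‖ * ‖f x‖) ≤ rho x ^ M * ((C * rho x) * ‖f x‖) := by
        gcongr; exact hC x
    _ = _ := by ring

theorem HasMoment.integrable {M : ℕ} {f : AffGroup × AffGroup → ℂ} (hf : HasMoment M f) :
    Integrable f volume := by
  refine hf.2.norm.mono' hf.1.aestronglyMeasurable (Eventually.of_forall fun x => ?_)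
  rw [norm_rho_pow_mul]
  exact le_mul_of_one_le_left (norm_nonneg _) (one_le_pow₀ (one_le_rho x))

theorem HasMoment.of_succ {M : ℕ} {f : AffGroup × AffGroup → ℂ} (hf : HasMoment (M + 1) f) :
    HasMoment M f := by
  have := hf.mul (c := 1) continuous_const (C := 1) fun x => by simpa using one_le_rho x
  rwa [one_mul] at this

theorem exists_integral_orbit (hp : WithSeminorms p) (hα_cont : ∀ v, Continuous fun g => α g v)
    (hα_isom : ∀ g j v, p j (α g v) = p j v) {M : ℕ} {f : AffGroup × AffGroup → ℂ}
    (hf : HasMoment M f) (v w : A) : ∃ u, HasFrechetIntegral volume p (f • orbit α v w) u := by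
  have := hp.continuousSMul
  have hc : Continuous (f • orbit α v w) := hf.1.smul (continuous_orbit hα_cont v w)
  refine exists_hasFrechetIntegral hp volume hc fun j => ?_
  obtain ⟨C, hC⟩ := exists_orbit_le (α := α) hp hα_isom j v w
  refine (hf.integrable.norm.mul_const C).mono'
    ((hp.continuous_seminorm j).comp hc).aestronglyMeasurable (Eventually.of_forall fun x => ?_)
  rw [Real.norm_of_nonneg (apply_nonneg _ _), Pi.smul_apply', map_smul_eq_mul]
  gcongr
  exact hC x

/-- The sums of integrals of orbits of smooth vectors against densities with `M` moments. -/
def momentSpace (p : ℕ → Seminorm ℂ A) (α : AffGroup →* Module.End ℂ A) (M : ℕ) :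
    AddSubmonoid A :=
  AddSubmonoid.closure {u | ∃ f, HasMoment M f ∧ ∃ v ∈ smoothVectors α, ∃ w ∈ smoothVectors α,
    HasFrechetIntegral volume p (f • orbit α v w) u}

theorem mem_momentSpace {M : ℕ} {f : AffGroup × AffGroup → ℂ} (hf : HasMoment M f) {v w u : A}
    (hv : v ∈ smoothVectors α) (hw : w ∈ smoothVectors α)
    (h : HasFrechetIntegral volume p (f • orbit α v w) u) : u ∈ momentSpace p α M :=
  AddSubmonoid.subset_closure ⟨f, hf, v, hv, w, hw, h⟩

theorem _root_.HasFrechetIntegral.act (hp : WithSeminorms p) {X : Type*} [MeasurableSpace X]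
    {μ : Measure X} {f : X → A} {u : A} (h : HasFrechetIntegral μ p f u)
    (hα_isom : ∀ g j v, p j (α g v) = p j v) (g : AffGroup) :
    HasFrechetIntegral μ p (fun x => α g (f x)) (α g u) := by
  refine ⟨(actCLM hp hα_isom g).continuous.comp_aestronglyMeasurable h.1, fun j => ?_, fun φ => ?_⟩
  · simpa only [hα_isom] using h.2.1 j
  · exact h.2.2 (φ.comp (actCLM hp hα_isom g))

/-- Mean value inequality for the orbit function along `exp (t Xᵢ) x`. -/
theorem seminorm_translate_sub_le (hp : WithSeminorms p)
    (hα_cont : ∀ v, Continuous fun g => α g v) (hα_isom : ∀ g j v, p j (α g v) = p j v) {v w : A}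
    (hv : v ∈ smoothVectors α) (hw : w ∈ smoothVectors α) (i : Gen) (j : ℕ)
    (x : AffGroup × AffGroup) {B : ℝ}
    (hB : ∀ t, p j (rightOrbit α i v w (frame i t * x.1, frame i t * x.2)) ≤ B) (t : ℝ) :
    p j (orbit α v w (frame i t * x.1, frame i t * x.2) - orbit α v w x) ≤ B * |t| := by
  set c : ℝ → A := fun t => orbit α v w (frame i t * x.1, frame i t * x.2) with hc
  have h0 : orbit α v w x = c 0 := by simp [hc, frame_zero]
  obtain ⟨φ, hφ, hφx⟩ := hp.exists_dual_eq {j} (c t - c 0)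
  rw [Finset.sup_singleton] at hφ hφx
  have hd : ∀ s, HasDerivAt (fun s => φ (c s))
      (φ (rightOrbit α i v w (frame i s * x.1, frame i s * x.2))) s := by
    intro s
    rw [hasDerivAt_iff_tendsto_slope_zero]
    have h1 := tendsto_left_translate_orbit hp hα_cont hα_isom hv hw i
      (frame i s * x.1, frame i s * x.2)
    refine ((φ.continuous.tendsto _).comp h1).congr fun r => ?_
    simp only [Function.comp_apply, hc, map_smul, map_sub, Complex.real_smul, smul_eq_mul]
    rw [add_comm s r, frame_add, mul_assoc, mul_assoc]
  have h2 := Convex.norm_image_sub_le_of_norm_hasDerivWithin_le (s := Set.univ)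
    (fun s _ => (hd s).hasDerivWithinAt) (fun s _ => (hφ _).trans (hB s)) convex_univ
    (Set.mem_univ 0) (Set.mem_univ t)
  rw [← map_sub, hφx, Complex.norm_real, Real.norm_of_nonneg (apply_nonneg _ _), sub_zero,
    Real.norm_eq_abs] at h2
  rw [h0]
  exact h2

/-- Differentiation under the integral sign. The difference quotients are dominated, by the mean value
inequality along `exp (t Xᵢ) x`, by a multiple of `rho`. -/
theorem hasField_integral (hp : WithSeminorms p) (hα_mul : ∀ g v w, α g (v * w) = α g v * α g w)
    (hα_cont : ∀ v, Continuous fun g => α g v) (hα_isom : ∀ g j v, p j (α g v) = p j v)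
    {f : AffGroup × AffGroup → ℂ} (hf : HasMoment 1 f) {v w u u' : A} (hv : v ∈ smoothVectors α)
    (hw : w ∈ smoothVectors α) (i : Gen) (hu : HasFrechetIntegral volume p (f • orbit α v w) u)
    (hu' : HasFrechetIntegral volume p (f • rightOrbit α i v w) u')
    (hcont : Continuous (rightOrbit α i v w)) :
    HasField frame i (fun g => α g u) (fun g => α g u') := by
  have := hp.continuousSMul
  have key : Tendsto (fun t : ℝ => ((t⁻¹ : ℝ) : ℂ) • (α (frame i t) u - u)) (𝓝[≠] 0) (𝓝 u') := by
    refine tendsto_of_seminorm hp fun j => ?_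
    obtain ⟨C, hC⟩ := exists_rightOrbit_le hp hα_isom j v w i
    set D : ℝ → AffGroup × AffGroup → A := fun t x => ((t⁻¹ : ℝ) : ℂ) •
      (orbit α v w (frame i t * x.1, frame i t * x.2) - orbit α v w x) - rightOrbit α i v w x
      with hD
    have hDc : ∀ t, Continuous (D t) := fun t => by
      have h1 := continuous_orbit hα_cont v w
      have h2 : Continuous fun x : AffGroup × AffGroup => (frame i t * x.1, frame i t * x.2) := by
        fun_prop
      exact (((h1.comp h2).sub h1).const_smul _).sub hcont
    have hint : ∀ t, HasFrechetIntegral volume p (f • D t)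
        (((t⁻¹ : ℝ) : ℂ) • (α (frame i t) u - u) - u') := fun t => by
      have h1 := HasFrechetIntegral.act hp hu hα_isom (frame i t)
      have h2 := ((h1.add hp (hu.const_smul hp (-1))).const_smul hp ((t⁻¹ : ℝ) : ℂ)).add hp
        (hu'.const_smul hp (-1))
      rw [neg_one_smul, neg_one_smul, ← sub_eq_add_neg, ← sub_eq_add_neg] at h2
      convert h2 using 1
      · funext x
        simp only [hD, Pi.smul_apply', Pi.smul_apply, Pi.sub_apply, map_smul, act_orbit hα_mul]
        module
      · module
    have hle : ∀ t, p j (((t⁻¹ : ℝ) : ℂ) • (α (frame i t) u - u) - u') ≤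
        ∫ x, ‖f x‖ * p j (D t x) := fun t => by
      simpa only [Pi.smul_apply', map_smul_eq_mul] using (hint t).seminorm_le hp j
    have hlim : Tendsto (fun t => ∫ x, ‖f x‖ * p j (D t x)) (𝓝[≠] 0)
        (𝓝 (∫ _ : AffGroup × AffGroup, (0 : ℝ))) := by
      refine tendsto_integral_filter_of_dominated_convergence
        (fun x => 2 * C * ‖(rho x : ℂ) ^ 1 * f x‖) ?_ ?_ (hf.2.norm.const_mul _) ?_
      · exact Eventually.of_forall fun t =>
          (hf.1.norm.mul ((hp.continuous_seminorm j).comp (hDc t))).aestronglyMeasurable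
      · filter_upwards [self_mem_nhdsWithin] with t ht
        refine Eventually.of_forall fun x => ?_
        have h1 := seminorm_translate_sub_le hp hα_cont hα_isom hv hw i j x (hC x) t
        have h2 := hC x 0
        rw [frame_zero, one_mul, one_mul] at h2
        have ht' : 0 < |t| := abs_pos.2 ht
        have h3 : p j (D t x) ≤ 2 * C * rho x := by
          refine (map_sub_le_add _ _ _).trans ?_
          rw [map_smul_eq_mul, Complex.norm_real, norm_inv, Real.norm_eq_abs]
          have : |t|⁻¹ * p j (orbit α v w (frame i t * x.1, frame i t * x.2) - orbit α v w x) ≤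
              C * rho x := by
            rw [inv_mul_le_iff₀ ht', mul_comm]; exact h1
          have h2' : p j (rightOrbit α i v w x) ≤ C * rho x := h2
          linarith
        rw [Real.norm_of_nonneg (mul_nonneg (norm_nonneg _) (apply_nonneg _ _)), norm_rho_pow_mul,
          pow_one]
        calc ‖f x‖ * p j (D t x) ≤ ‖f x‖ * (2 * C * rho x) := by gcongr
          _ = _ := by ring
      · refine Eventually.of_forall fun x => ?_
        have h1 := tendsto_seminorm_sub hp
          (tendsto_left_translate_orbit hp hα_cont hα_isom hv hw i x) j
        have h2 := h1.const_mul ‖f x‖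
        rw [mul_zero] at h2
        exact h2
    rw [integral_zero] at hlim
    exact squeeze_zero (fun t => apply_nonneg _ _) hle hlim
  intro g
  refine (((actCLM hp hα_isom g).continuous.tendsto _).comp key).congr fun t => ?_
  simp only [Function.comp_apply, diffQuot, map_smul, map_sub, actCLM_apply, map_mul,
    Module.End.mul_apply]

/-- Sums of moment integrals are differentiable along the action, and the derivative loses one moment. -/
theorem exists_hasField_momentSpace (hp : WithSeminorms p)
    (hα_mul : ∀ g v w, α g (v * w) = α g v * α g w)
    (hα_cont : ∀ v, Continuous fun g => α g v) (hα_isom : ∀ g j v, p j (α g v) = p j v)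
    {M : ℕ} {u : A} (hu : u ∈ momentSpace p α (M + 1)) (i : Gen) :
    ∃ u' ∈ momentSpace p α M, HasField frame i (fun g => α g u) (fun g => α g u') := by
  have := hp.continuousSMul
  induction hu using AddSubmonoid.closure_induction with
  | mem u hu =>
    obtain ⟨f, hf, v, hv, w, hw, hu⟩ := hu
    have hf1 : HasMoment 1 f := by
      clear hu
      induction M with
      | zero => exact hf
      | succ M ih => exact ih hf.of_succ
    have hvi := infAct_mem hp hα_isom hv
    have hwi := infAct_mem hp hα_isom hw
    have hco : ∀ v w : A, Continuous (orbit α v w) := continuous_orbit hα_cont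
    have c1 : Continuous fun x : AffGroup × AffGroup => ((2 * x.1.l : ℝ) : ℂ) :=
      Complex.continuous_ofReal.comp (continuous_const.mul (continuous_l.comp continuous_fst))
    have c2 : Continuous fun x : AffGroup × AffGroup => ((2 * x.2.l : ℝ) : ℂ) :=
      Complex.continuous_ofReal.comp (continuous_const.mul (continuous_l.comp continuous_snd))
    have c3 : Continuous fun x : AffGroup × AffGroup => ((Real.exp (-2 * x.1.a) : ℝ) : ℂ) :=
      Complex.continuous_ofReal.comp (Real.continuous_exp.comp
        (continuous_const.mul (continuous_a.comp continuous_fst)))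
    have c4 : Continuous fun x : AffGroup × AffGroup => ((Real.exp (-2 * x.2.a) : ℝ) : ℂ) :=
      Complex.continuous_ofReal.comp (Real.continuous_exp.comp
        (continuous_const.mul (continuous_a.comp continuous_snd)))
    have hterm : ∀ {c : AffGroup × AffGroup → ℂ} {v w : A}, Continuous c →
        (∀ x, ‖c x‖ ≤ 2 * rho x) → v ∈ smoothVectors α → w ∈ smoothVectors α →
        ∃ u' ∈ momentSpace p α M, HasFrechetIntegral volume p (f • (c • orbit α v w)) u' := by
      intro c v w hc hcb hv hw
      have hm := hf.mul hc hcb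
      obtain ⟨u', hu'⟩ := exists_integral_orbit hp hα_cont hα_isom hm v w
      refine ⟨u', mem_momentSpace hm hv hw hu', ?_⟩
      rwa [smul_smul, mul_comm f c]
    have hterm1 : ∀ {v w : A}, v ∈ smoothVectors α → w ∈ smoothVectors α →
        ∃ u' ∈ momentSpace p α M, HasFrechetIntegral volume p (f • orbit α v w) u' := by
      intro v w hv hw
      have h := hterm (c := 1) continuous_const (fun x => by
        rw [Pi.one_apply, norm_one]; linarith [one_le_rho x]) hv hw
      simpa only [one_smul] using h
    cases i with
    | H =>
      obtain ⟨u1, h1, g1⟩ := hterm1 (hvi Gen.H) hw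
      obtain ⟨u2, h2, g2⟩ := hterm c1 (fun x => by
        rw [Complex.norm_real, norm_mul, Real.norm_two, Real.norm_eq_abs]
        linarith [abs_l₁_le_rho x]) (hvi Gen.E) hw
      obtain ⟨u3, h3, g3⟩ := hterm1 hv (hwi Gen.H)
      obtain ⟨u4, h4, g4⟩ := hterm c2 (fun x => by
        rw [Complex.norm_real, norm_mul, Real.norm_two, Real.norm_eq_abs]
        linarith [abs_l₂_le_rho x]) hv (hwi Gen.E)
      refine ⟨u1 + u2 + (u3 + u4), add_mem (add_mem h1 h2) (add_mem h3 h4),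
        hasField_integral hp hα_mul hα_cont hα_isom hf1 hv hw Gen.H hu ?_ ?_⟩
      · rw [rightOrbit_H, smul_add, smul_add, smul_add]
        exact (g1.add hp g2).add hp (g3.add hp g4)
      · rw [rightOrbit_H]
        exact ((hco _ _).add (c1.smul (hco _ _))).add ((hco _ _).add (c2.smul (hco _ _)))
    | E =>
      obtain ⟨u2, h2, g2⟩ := hterm c3 (fun x => by
        rw [Complex.norm_real, Real.norm_of_nonneg (Real.exp_pos _).le]
        linarith [exp₁_le_rho x, one_le_rho x]) (hvi Gen.E) hw
      obtain ⟨u4, h4, g4⟩ := hterm c4 (fun x => by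
        rw [Complex.norm_real, Real.norm_of_nonneg (Real.exp_pos _).le]
        linarith [exp₂_le_rho x, one_le_rho x]) hv (hwi Gen.E)
      refine ⟨u2 + u4, add_mem h2 h4,
        hasField_integral hp hα_mul hα_cont hα_isom hf1 hv hw Gen.E hu ?_ ?_⟩
      · rw [rightOrbit_E, smul_add]
        exact g2.add hp g4
      · rw [rightOrbit_E]
        exact (c3.smul (hco _ _)).add (c4.smul (hco _ _))
  | zero =>
    refine ⟨0, zero_mem _, ?_⟩
    simp only [map_zero]
    exact HasField.const 0
  | add u₁ u₂ _ _ h₁ h₂ =>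
    obtain ⟨u₁', m₁, h₁⟩ := h₁
    obtain ⟨u₂', m₂, h₂⟩ := h₂
    refine ⟨u₁' + u₂', add_mem m₁ m₂, ?_⟩
    simp only [map_add]
    exact h₁.add h₂

/-- A vector which is a sum of moment integrals for every number of moments is smooth. -/
theorem mem_smoothVectors_of_forall_mem (hp : WithSeminorms p)
    (hα_mul : ∀ g v w, α g (v * w) = α g v * α g w)
    (hα_cont : ∀ v, Continuous fun g => α g v) (hα_isom : ∀ g j v, p j (α g v) = p j v)
    {u : A} (hu : ∀ M, u ∈ momentSpace p α M) : u ∈ smoothVectors α := by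
  refine isSmooth_of_closed {F | ∃ u : A, (∀ M, u ∈ momentSpace p α M) ∧ F = fun g => α g u}
    ?_ ?_ ⟨u, hu, rfl⟩
  · rintro _ ⟨u, -, rfl⟩
    exact hα_cont u
  · rintro _ ⟨u, hu, rfl⟩ i
    choose u' hu' hd using fun M =>
      exists_hasField_momentSpace hp hα_mul hα_cont hα_isom (hu (M + 1)) i
    have e : ∀ M, u' M = u' 0 := fun M => by
      have := tendsto_nhds_unique (hd M 1) (hd 0 1)
      simpa only [map_one, Module.End.one_apply] using this
    exact ⟨_, ⟨u' 0, fun M => e M ▸ hu' M, rfl⟩, hd 0⟩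

/-! ### The regularized integrand -/

/-- Sums of orbits of smooth vectors with symbols as coefficients. -/
def orbitSymbols (α : AffGroup →* Module.End ℂ A) (m : AffGroup × AffGroup → ℂ) :
    AddSubmonoid (AffGroup × AffGroup → A) :=
  AddSubmonoid.closure {Φ | ∃ f ∈ scalarSymbols frame₂ m, ∃ v ∈ smoothVectors α,
    ∃ w ∈ smoothVectors α, Φ = f • orbit α v w}

theorem orbitSymbols_const_smul {m : AffGroup × AffGroup → ℂ} {Φ : AffGroup × AffGroup → A}
    (hΦ : Φ ∈ orbitSymbols α m) (c : ℂ) : c • Φ ∈ orbitSymbols α m := by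
  induction hΦ using AddSubmonoid.closure_induction with
  | mem Φ hΦ =>
    obtain ⟨f, hf, v, hv, w, hw, rfl⟩ := hΦ
    refine AddSubmonoid.subset_closure ⟨c • f, symbolSpace.const_smul hf c, v, hv, w, hw, ?_⟩
    rw [smul_assoc]
  | zero => rw [smul_zero]; exact zero_mem _
  | add Φ Ψ _ _ h h' => rw [smul_add]; exact add_mem h h'

theorem invOp_mem_orbitSymbols (hp : WithSeminorms p) (hα_isom : ∀ g j v, p j (α g v) = p j v)
    {m : AffGroup × AffGroup → ℂ} {Φ : AffGroup × AffGroup → A} (hΦ : Φ ∈ orbitSymbols α m)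
    (P : EnvElt (Gen ⊕ Gen)) : invOp frame₂ P Φ ∈ orbitSymbols α m := by
  have := hp.continuousSMul
  have hw : ∀ w, wordField frame₂ w Φ ∈ orbitSymbols α m := fun w => by
    refine wordField_mem_of_closed (orbitSymbols α m : Set (AffGroup × AffGroup → A)) ?_ w hΦ
    intro Φ hΦ i
    induction hΦ using AddSubmonoid.closure_induction with
    | mem Φ hΦ =>
      obtain ⟨f, hf, v, hv, w, hw, rfl⟩ := hΦ
      obtain ⟨v', hv', w', hw', h⟩ := exists_hasField_orbit hp hα_isom hv hw i
      exact ⟨_, add_mem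
        (AddSubmonoid.subset_closure ⟨_, symbolSpace.leftField hf i, v, hv, w, hw, rfl⟩)
        (AddSubmonoid.subset_closure ⟨f, hf, v', hv', w', hw', rfl⟩),
        (hf.1.hasField i).smul h⟩
    | zero => exact ⟨0, zero_mem _, HasField.zero⟩
    | add Φ Ψ _ _ h h' =>
      obtain ⟨Φ', hΦ', h⟩ := h
      obtain ⟨Ψ', hΨ', h'⟩ := h'
      exact ⟨Φ' + Ψ', add_mem hΦ' hΨ', h.add h'⟩
  have e : invOp frame₂ P Φ = ∑ w ∈ P.support, ((P w : ℝ) : ℂ) • wordField frame₂ w Φ := by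
    funext x
    rw [invOp_apply, Finset.sum_apply]
    rfl
  rw [e]
  exact sum_mem fun w _ => orbitSymbols_const_smul (hw w) _

/-- Integrals of orbit symbols of fast decay are sums of moment integrals. -/
theorem mem_momentSpace_of_orbitSymbols (hp : WithSeminorms p)
    (hα_cont : ∀ v, Continuous fun g => α g v) (hα_isom : ∀ g j v, p j (α g v) = p j v)
    {m : AffGroup × AffGroup → ℂ} {M : ℕ} {C : ℝ} (hm : ∀ x, rho x ^ M * ‖m x‖ * den x ≤ C)
    {e : AffGroup × AffGroup → ℂ} (he : Continuous e) (he1 : ∀ x, ‖e x‖ = 1)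
    {Φ : AffGroup × AffGroup → A} (hΦ : Φ ∈ orbitSymbols α m) {u : A}
    (hu : HasFrechetIntegral volume p (e • Φ) u) : u ∈ momentSpace p α M := by
  have := hp.continuousSMul
  have key : ∃ u ∈ momentSpace p α M, HasFrechetIntegral volume p (e • Φ) u := by
    clear hu
    induction hΦ using AddSubmonoid.closure_induction with
    | mem Φ hΦ =>
      obtain ⟨f, hf, v, hv, w, hw, rfl⟩ := hΦ
      obtain ⟨B, hB0, hB⟩ := scalarSymbols.norm_le hf
      have hmom : HasMoment M (e * f) := by
        refine ⟨he.mul hf.1.continuous, ?_⟩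
        have hc : Continuous fun x => (rho x : ℂ) ^ M * (e * f) x :=
          ((Complex.continuous_ofReal.comp continuous_rho).pow M).mul (he.mul hf.1.continuous)
        refine integrable_of_norm_mul_den_le hc (C := B * C) fun x => ?_
        have h1 := zero_le_one.trans (one_le_rho x)
        have h2 := (den_pos x).le
        rw [norm_rho_pow_mul, Pi.mul_apply, norm_mul, he1, one_mul]
        calc rho x ^ M * ‖f x‖ * den x ≤ rho x ^ M * (B * ‖m x‖) * den x := by
              gcongr; exact hB x
          _ = B * (rho x ^ M * ‖m x‖ * den x) := by ring
          _ ≤ B * C := by gcongr; exact hm x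
      obtain ⟨u, hu⟩ := exists_integral_orbit hp hα_cont hα_isom hmom v w
      refine ⟨u, mem_momentSpace hmom hv hw hu, ?_⟩
      rwa [smul_smul]
    | zero =>
      refine ⟨0, zero_mem _, ?_⟩
      rw [smul_zero]
      exact ⟨aestronglyMeasurable_const, fun j => by simp, fun φ => by simp⟩
    | add Φ Ψ _ _ h h' =>
      obtain ⟨u, hu, hi⟩ := h
      obtain ⟨u', hu', hi'⟩ := h'
      refine ⟨u + u', add_mem hu hu', ?_⟩
      rw [smul_add]
      exact hi.add hp hi'
  obtain ⟨u', hu', hi⟩ := key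
  rwa [hu.unique hp hi]

theorem const_smul_mem_smoothVectors (hp : WithSeminorms p) {u : A} (hu : u ∈ smoothVectors α)
    (c : ℂ) : c • u ∈ smoothVectors α := by
  have := hp.continuousSMul
  have h := IsSmooth.const_smul hu c
  have e : (fun g => α g (c • u)) = c • fun g => α g u := by
    funext g
    rw [map_smul]; rfl
  change IsSmooth frame _
  rw [e]
  exact h

end Action

/-! ### The star product -/

section StarProduct

variable {A : Type*} [NonUnitalRing A] [Module ℂ A] [IsScalarTower ℂ A A]
  [SMulCommClass ℂ A A] [UniformSpace A] [IsUniformAddGroup A] [CompleteSpace A] [T2Space A]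
  [ContinuousMul A] {p : ℕ → Seminorm ℂ A} {α : AffGroup →* Module.End ℂ A}

/-- For amplitudes of growth `tau ^ k` there are admissible data with as many moments as wanted. -/
theorem exists_isOscData {θ : ℝ} (hθ : 0 < θ) (k M : ℕ) : ∃ P : EnvElt (Gen ⊕ Gen),
    IsOscData frame₂ volume (fun x => Scan x / θ) P (tau.1 ^ k) ∧
    ∃ C : ℝ, ∀ x, rho x ^ M *
      ‖((multiplier frame₂ (fun x => Scan x / θ) P)⁻¹ * tau.1 ^ k) x‖ * den x ≤ C := by
  obtain ⟨P, hP, hself, C, hC⟩ := exists_isAdapted hθ (M + k)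
  have hk : IsWeight frame₂ (tau.1 ^ k) := isWeight_tau.pow k
  have hb : ∀ x, rho x ^ M *
      ‖((multiplier frame₂ (fun x => Scan x / θ) P)⁻¹ * tau.1 ^ k) x‖ * den x ≤ C := fun x => by
    have h0 := norm_pos_iff.2 (hP.1.1 x)
    have hr := one_le_rho x
    have ht := one_le_norm_tau x
    have hd := (den_pos x).le
    rw [Pi.mul_apply, Pi.inv_apply, Pi.pow_apply, norm_mul, norm_inv, norm_pow]
    calc rho x ^ M * (‖multiplier frame₂ (fun x => Scan x / θ) P x‖⁻¹ * ‖tau.1 x‖ ^ k) * den x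
        = ‖multiplier frame₂ (fun x => Scan x / θ) P x‖⁻¹ *
          (rho x ^ M * ‖tau.1 x‖ ^ k * den x) := by ring
      _ ≤ ‖multiplier frame₂ (fun x => Scan x / θ) P x‖⁻¹ *
          (rho x ^ (M + k) * ‖tau.1 x‖ ^ (M + k) * den x) := by
        gcongr <;> first | assumption | omega
      _ ≤ C := by
        rw [inv_mul_le_iff₀ h0]
        exact (hC x).trans_eq (mul_comm _ _)
  refine ⟨P, ⟨hP, hself, hk, ?_⟩, C, hb⟩
  have hc : Continuous ((multiplier frame₂ (fun x => Scan x / θ) P)⁻¹ * tau.1 ^ k) :=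
    (hP.1.inv_mem frame₂_zero).1.continuous.mul hk.2.1.continuous
  refine (integrable_of_norm_mul_den_le hc (C := C) fun x => ?_).congr
    (Eventually.of_forall fun x => ?_)
  · have h1 : 1 ≤ rho x ^ M := one_le_pow₀ (one_le_rho x)
    refine le_trans ?_ (hb x)
    have := den_pos x
    gcongr
    exact le_mul_of_one_le_left (norm_nonneg _) h1
  · exact (div_eq_inv_mul _ _).symm

/-- For data with `M` moments the value of the oscillatory integral is a sum of moment integrals. -/
theorem exists_mem_momentSpace (hp : WithSeminorms p) (hα_cont : ∀ v, Continuous fun g => α g v)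
    (hα_isom : ∀ g j v, p j (α g v) = p j v) {θ : ℝ} {k M : ℕ} {P : EnvElt (Gen ⊕ Gen)}
    (hP : IsOscData frame₂ volume (fun x => Scan x / θ) P (tau.1 ^ k)) {C : ℝ}
    (hC : ∀ x, rho x ^ M *
      ‖((multiplier frame₂ (fun x => Scan x / θ) P)⁻¹ * tau.1 ^ k) x‖ * den x ≤ C)
    {f : AffGroup × AffGroup → ℂ} (hf : f ∈ scalarSymbols frame₂ (tau.1 ^ k)) {v w : A}
    (hv : v ∈ smoothVectors α) (hw : w ∈ smoothVectors α) :
    ∃ u ∈ momentSpace p α M, HasFrechetIntegral volume p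
      (fun x => expPhase (fun x => Scan x / θ) x •
        invOp frame₂ P ((multiplier frame₂ (fun x => Scan x / θ) P)⁻¹ • (f • orbit α v w)) x) u := by
  have := hp.continuousSMul
  have hS : IsSmooth frame₂ (expPhase fun x => Scan x / θ) := (expS θ).2
  have hF : f • orbit α v w ∈ symbolSpace frame₂ p (tau.1 ^ k) := by
    have := scalarSymbols.smul hf (orbit_mem_symbolSpace hp hα_cont hα_isom hv hw)
    rwa [mul_one] at this
  obtain ⟨u, hu⟩ := IsOscData.exists_integral hp hP frame₂_zero hS hF
  refine ⟨u, mem_momentSpace_of_orbitSymbols hp hα_cont hα_isom hC hS.continuous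
    (norm_expPhase _) (invOp_mem_orbitSymbols hp hα_isom ?_ P) hu, hu⟩
  refine AddSubmonoid.subset_closure ⟨_,
    scalarSymbols.mul (hP.adapted.1.inv_mem frame₂_zero) hf, v, hv, w, hw, ?_⟩
  rw [smul_smul]

end StarProduct

end AffGroup

end

theorem mainTheorem2 {A : Type*} [NonUnitalRing A] [Module ℂ A] [IsScalarTower ℂ A A]
    [SMulCommClass ℂ A A] [UniformSpace A] [IsUniformAddGroup A] [CompleteSpace A] [T2Space A]
    [ContinuousMul A] (p : ℕ → Seminorm ℂ A) (hp : WithSeminorms p)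
    (α : AffGroup →* Module.End ℂ A)
    (hα_mul : ∀ g v w, α g (v * w) = α g v * α g w)
    (hα_cont : ∀ v, Continuous fun g => α g v)
    (hα_isom : ∀ g j v, p j (α g v) = p j v)
    (θ : ℝ) (hθ : 0 < θ) (Θ : ℝ → ℂ) (hΘ_ne : ∀ t, Θ t ≠ 0)
    (hΘ : AffGroup.IsSymbolType Θ) (hΘ_inv : AffGroup.IsSymbolType fun t => (Θ t)⁻¹)
    (v w : A) (hv : v ∈ AffGroup.smoothVectors α) (hw : w ∈ AffGroup.smoothVectors α) :
    (∃ P m₀, IsOscData AffGroup.frame₂ volume (fun x => AffGroup.Scan x / θ) P m₀ ∧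
      AffGroup.integrand α θ Θ v w ∈ symbolSpace AffGroup.frame₂ p m₀) ∧
    ∃ u ∈ AffGroup.smoothVectors α,
      ∀ P m₀, IsOscData AffGroup.frame₂ volume (fun x => AffGroup.Scan x / θ) P m₀ →
        AffGroup.integrand α θ Θ v w ∈ symbolSpace AffGroup.frame₂ p m₀ →
        ∃ J, IsOscillatoryIntegral AffGroup.frame₂ volume p (fun x => AffGroup.Scan x / θ) P m₀ J ∧
          u = (((θ ^ 2)⁻¹ : ℝ) : ℂ) • J (AffGroup.integrand α θ Θ v w) := by
  open AffGroup in
  have := hp.continuousSMul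
  obtain ⟨k, hk⟩ := exists_amplitude_mem hθ hΘ hΘ_inv
  have hF : integrand α θ Θ v w ∈ symbolSpace frame₂ p (tau.1 ^ k) := by
    have := scalarSymbols.smul hk (orbit_mem_symbolSpace hp hα_cont hα_isom hv hw)
    rwa [mul_one] at this
  have hS : IsSmooth frame₂ (expPhase fun x => Scan x / θ) := (expS θ).2
  obtain ⟨χ, hχ⟩ := exists_isCutoffSeq
  choose P hP C hC using exists_isOscData hθ k
  choose u hu hui using fun M =>
    exists_mem_momentSpace hp hα_cont hα_isom (hP M) (hC M) hk hv hw
  -- The data vary with `M`, the value of the oscillatory integral does not.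
  have huniq : ∀ M, u M = u 0 := fun M =>
    IsOscData.integral_unique hp (hP M) frameContinuous_frame₂ frame₂_zero hχ hS (hP 0) hF hF
      (hui M) (hui 0)
  have hu0 : u 0 ∈ smoothVectors α :=
    mem_smoothVectors_of_forall_mem hp hα_mul hα_cont hα_isom fun M => huniq M ▸ hu M
  refine ⟨⟨P 0, _, hP 0, hF⟩, _, const_smul_mem_smoothVectors hp hu0 (((θ ^ 2)⁻¹ : ℝ) : ℂ),
    fun Q m₀ hQ hFQ => ?_⟩
  obtain ⟨J, hJ⟩ := IsOscData.exists_isOscillatoryIntegral hp hQ frameContinuous_frame₂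
    frame₂_zero hχ hS
  refine ⟨J, hJ, ?_⟩
  rw [IsOscData.integral_unique hp (hP 0) frameContinuous_frame₂ frame₂_zero hχ hS hQ hF hFQ
    (hui 0) (hJ.formula _ hFQ)]
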